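/- Let $n>1$ and let $\mathbb R^{2n}=\mathbb R^n\oplus\mathbb R^n$ carry its standard inner product and symplectic form. Let $\mathcal{AL}(n,\mathbb R)$ be the manifold of affine Lagrangian subspaces $L\subset\mathbb R^{2n}$ (translates of linear Lagrangian subspaces), and for $L\in\mathcal{AL}(n,\mathbb R)$ let $\mu_L$ be the surface measure on $L$ induced by the Euclidean structure. Let $\mathcal S(\mathcal{AL}(n,\mathbb R))$ be the space of complex $C^\infty$ functions $\varphi$ on $\mathcal{AL}(n,\mathbb R)$ such that $$\sup_L\,(1+d(0,L))^M\,|L_{X_1}\cdots L_{X_k}\varphi(L)|<\infty$$ for all $M\ge 0$, $k\ge0$ and all $X_1,\dots,X_k$ in the Lie algebra of the affine symplectic group $\mathrm{Sp}(2n,\mathbb R)\ltimes\mathbb R^{2n}$, where $L_X$ is the derivative along the vector field given by $X$; it is topologized by these seminorms. Let $\mathcal B(\mathbb R^{2n})$ be the space of complex $C^\infty$ functions $g$ on $\mathbb R^{2n}$ with $$H_\alpha(g)=\sup_{x\in\mathbb R^{2n}}(1+|x|)^n\,|\partial^\alpha g(x)|<\infty$$ for every multi-index $\alpha$, topologized by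 the seminorms $H_\alpha$. Let $\mathcal B'(\mathbb R^{2n})$ and $\mathcal S'(\mathcal{AL}(n,\mathbb R))$ be the spaces of continuous linear functionals on $\mathcal B(\mathbb R^{2n})$ and $\mathcal S(\mathcal{AL}(n,\mathbb R))$, with the topology of pointwise convergence. For $x\in\mathbb R^{2n}$ let $\sigma_x$ be the unique probability measure on $\mathcal{AL}_x=\{L: x\in L\}$ invariant under the stabilizer of $x$ in $\mathrm U(n)\ltimes\mathbb R^{2n}$, and let $dL$ be the $\mathrm U(n)\ltimes\mathbb R^{2n}$-invariant measure on $\mathcal{AL}(n,\mathbb R)$ normalized by $d\sigma_x(L)\,dx=d\mu_L(x)\,dL$. Embed $\mathcal S(\mathbb R^{2n})$ into $\mathcal B'(\mathbb R^{2n})$ by $(f,g)=\int_{\mathbb R^{2n}} f g\,dx$ and $\mathcal S(\mathcal{AL}(n,\mathbb R))$ into $\mathcal S'(\mathcal{AL}(n,\mathbb R))$ by $(F,\varphi)=\int_{\mathcal{AL}(n,\mathbb R)} F\varphi\,dL$; all these integrals converge absolutely. **Theorem.** The Radon transform $\mathcal R_{comp}f(L)=\int_L f\,d\mu_L$ is a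 linear map $\mathcal S(\mathbb R^{2n})\to\mathcal S(\mathcal{AL}(n,\mathbb R))$, and it has a unique extension to a continuous linear operator $\mathcal B'(\mathbb R^{2n})\to\mathcal S'(\mathcal{AL}(n,\mathbb R))$. For $\varphi\in\mathcal S(\mathcal{AL}(n,\mathbb R))$ put $$\mathfrak a\varphi(x)=\int_{\mathcal{AL}_x}\varphi(L)\,d\sigma_x(L),\qquad x\in\mathbb R^{2n}.$$ Then $\mathfrak a$ is a continuous linear operator $\mathcal S(\mathcal{AL}(n,\mathbb R))\to\mathcal B(\mathbb R^{2n})$, one has $\partial^\alpha\mathfrak a\varphi(x)=O(|x|^{-n})$ as $x\to\infty$ for every $\varphi$ and every multi-index $\alpha$ (including $\alpha=0$), and the extension is given by $$(\mathcal R_{comp}f,\varphi)=(f,\mathfrak a\varphi),\qquad f\in\mathcal B'(\mathbb R^{2n}),\ \varphi\in\mathcal S(\mathcal{AL}(n,\mathbb R)).$$ -/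

import Mathlib

open MeasureTheory Matrix
open scoped ContDiff SchwartzMap

namespace LagrangianRadon

noncomputable section

/-- The Euclidean space `ℝ²ⁿ = ℝⁿ ⊕ ℝⁿ`; `Sum.inl` indexes the coordinates `x`, `Sum.inr` the
coordinates `y`. -/
abbrev E (n : ℕ) : Type := EuclideanSpace ℝ (Fin n ⊕ Fin n)

/-- A linear subspace is Lagrangian if the symplectic form `(v, w) ↦ vᵀ J w` vanishes on it and its
dimension is `n`. -/
def IsLagrangian {n : ℕ} (V : Submodule ℝ (E n)) : Prop :=
  (∀ v ∈ V, ∀ w ∈ V, v.ofLp ⬝ᵥ (J (Fin n) ℝ *ᵥ w.ofLp) = 0) ∧ Module.finrank ℝ V = n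

/-- The affine Lagrangian Grassmannian: translates of Lagrangian linear subspaces. -/
@[ext] structure AL (n : ℕ) where
  carrier : AffineSubspace ℝ (E n)
  nonempty : (carrier : Set (E n)).Nonempty
  lagrangian : IsLagrangian carrier.direction

/-- The affine map `v ↦ g v + c`. -/
def affMap {n : ℕ} (g : Matrix (Fin n ⊕ Fin n) (Fin n ⊕ Fin n) ℝ) (c : E n) : E n →ᵃ[ℝ] E n where
  toFun v := toEuclideanLin g v + c
  linear := toEuclideanLin g
  map_vadd' p v := by simp [add_assoc]

theorem toEuclideanLin_ofLp {m : Type*} [Fintype m] [DecidableEq m] (g : Matrix m m ℝ)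
    (v : EuclideanSpace ℝ m) : (toEuclideanLin g v).ofLp = g *ᵥ v.ofLp := rfl

theorem symplectic_mulVec_injective {n : ℕ} (g : symplecticGroup (Fin n) ℝ) :
    Function.Injective (toEuclideanLin (g : Matrix (Fin n ⊕ Fin n) (Fin n ⊕ Fin n) ℝ)) := by
  intro v w h
  have h1 := congrArg WithLp.ofLp h
  simp only [toEuclideanLin_ofLp] at h1
  have h2 := congrArg ((g⁻¹ : symplecticGroup (Fin n) ℝ).1 *ᵥ ·) h1
  simp only [mulVec_mulVec] at h2
  have h3 : (g⁻¹ : symplecticGroup (Fin n) ℝ).1 * g.1 = 1 :=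
    congrArg Subtype.val (inv_mul_cancel g)
  rw [h3, one_mulVec, one_mulVec] at h2
  exact WithLp.ofLp_injective 2 h2

theorem IsLagrangian.map {n : ℕ} {V : Submodule ℝ (E n)} (hV : IsLagrangian V)
    (g : symplecticGroup (Fin n) ℝ) :
    IsLagrangian (V.map (toEuclideanLin (g : Matrix (Fin n ⊕ Fin n) (Fin n ⊕ Fin n) ℝ))) := by
  refine ⟨?_, ?_⟩
  · rintro _ ⟨v, hv, rfl⟩ _ ⟨w, hw, rfl⟩
    have h := hV.1 v hv w hw
    have hg : g.1ᵀ * J (Fin n) ℝ * g.1 = J (Fin n) ℝ := SymplecticGroup.mem_iff'.1 g.2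
    simp only [toEuclideanLin_ofLp]
    rw [dotProduct_comm, ← dotProduct_transpose_mulVec, mulVec_mulVec, mulVec_mulVec,
      hg]
    exact h
  · exact (LinearEquiv.finrank_eq
      (Submodule.equivMapOfInjective _ (symplectic_mulVec_injective g) V)).symm.trans hV.2

/-- The action of the affine symplectic group: `act g c L = {g v + c | v ∈ L}`. -/
def act {n : ℕ} (g : symplecticGroup (Fin n) ℝ) (c : E n) (L : AL n) : AL n where
  carrier := L.carrier.map (affMap g.1 c)
  nonempty := by
    obtain ⟨v, hv⟩ := L.nonempty
    exact ⟨_, AffineSubspace.mem_map_of_mem _ hv⟩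
  lagrangian := by
    rw [AffineSubspace.map_direction]
    exact L.lagrangian.map g

/-- The symmetric matrix `T` with coordinates `t`, that is `T i j = t s(i, j)`. -/
def symMat {n : ℕ} (t : Sym2 (Fin n) → ℝ) : Matrix (Fin n) (Fin n) ℝ :=
  Matrix.of fun i j => t s(i, j)

theorem symMat_transpose {n : ℕ} (t : Sym2 (Fin n) → ℝ) : (symMat t)ᵀ = symMat t := by
  ext i j
  simp [symMat, Sym2.eq_swap]

/-- The affine map `y ↦ (T y + τ, y)`. -/
def graphMap {n : ℕ} (t : Sym2 (Fin n) → ℝ) (τ : EuclideanSpace ℝ (Fin n)) :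
    EuclideanSpace ℝ (Fin n) →ᵃ[ℝ] E n where
  toFun y := WithLp.toLp 2 (Sum.elim (symMat t *ᵥ y.ofLp + τ.ofLp) y.ofLp)
  linear :=
    { toFun := fun y => WithLp.toLp 2 (Sum.elim (symMat t *ᵥ y.ofLp) y.ofLp)
      map_add' := fun y z => by
        ext i; cases i <;> simp [mulVec_add]
      map_smul' := fun a y => by
        ext i; cases i <;> simp [mulVec_smul] }
  map_vadd' y z := by
    ext i; cases i <;> simp [mulVec_add, add_assoc]

/-- The affine Lagrangian subspace `x = T y + τ`. -/
def graph {n : ℕ} (t : Sym2 (Fin n) → ℝ) (τ : EuclideanSpace ℝ (Fin n)) : AL n where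
  carrier := (⊤ : AffineSubspace ℝ (EuclideanSpace ℝ (Fin n))).map (graphMap t τ)
  nonempty := ⟨graphMap t τ 0, AffineSubspace.mem_map_of_mem _ (AffineSubspace.mem_top _ _ _)⟩
  lagrangian := by
    rw [AffineSubspace.map_direction, AffineSubspace.direction_top]
    refine ⟨?_, ?_⟩
    · rintro _ ⟨y, -, rfl⟩ _ ⟨z, -, rfl⟩
      have h : (symMat t *ᵥ y.ofLp) ⬝ᵥ z.ofLp = y.ofLp ⬝ᵥ (symMat t *ᵥ z.ofLp) := by
        rw [dotProduct_comm, ← dotProduct_transpose_mulVec, symMat_transpose]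
      simp [graphMap, J, fromBlocks_mulVec, neg_mulVec, h]
    · have hinj : Function.Injective (graphMap t τ).linear := by
        intro y z h
        have h1 := congrArg WithLp.ofLp h
        ext i
        have := congrFun h1 (Sum.inr i)
        simpa [graphMap] using this
      rw [← LinearEquiv.finrank_eq (Submodule.equivMapOfInjective _ hinj ⊤)]
      simp

/-- The charts of the atlas: images of `x = T y + τ` under linear symplectic maps `g`. They
correspond to the pairs of transversal Lagrangian subspaces `g (0 ⊕ ℝⁿ)`, `g (ℝⁿ ⊕ 0)`. -/
def chart {n : ℕ} (g : symplecticGroup (Fin n) ℝ) (t : Sym2 (Fin n) → ℝ)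
    (τ : EuclideanSpace ℝ (Fin n)) : AL n :=
  act g 0 (graph t τ)

/-- `C^∞` functions on the manifold `AL n`: smooth in every chart of the atlas. -/
def IsSmooth {n : ℕ} (f : AL n → ℂ) : Prop :=
  ∀ g : symplecticGroup (Fin n) ℝ, ContDiff ℝ ∞
    fun p : (Sym2 (Fin n) → ℝ) × EuclideanSpace ℝ (Fin n) => f (chart g p.1 p.2)

/-- The Lie algebra of the affine symplectic group: the affine vector fields `v ↦ A v + b` with
`A` in the symplectic Lie algebra. -/
abbrev ASpLie (n : ℕ) : Type := LieAlgebra.Symplectic.sp (Fin n) ℝ × E n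

theorem exp_mem_symplecticGroup {n : ℕ} (A : LieAlgebra.Symplectic.sp (Fin n) ℝ) (s : ℝ) :
    NormedSpace.exp (s • A.1) ∈ symplecticGroup (Fin n) ℝ := by
  obtain ⟨A, hA'⟩ := A
  have hA : Aᵀ * J (Fin n) ℝ = J (Fin n) ℝ * (-A) :=
    (mem_skewAdjointMatricesSubmodule _ _).1 hA'
  change NormedSpace.exp (s • A) ∈ _
  clear hA'
  have hJ : IsUnit (J (Fin n) ℝ) := (isUnit_iff_isUnit_det _).2 (isUnit_det_J _ _)
  have hJd := (isUnit_iff_isUnit_det _).1 hJ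
  have h1 : (s • A)ᵀ = J (Fin n) ℝ * (-(s • A)) * (J (Fin n) ℝ)⁻¹ := by
    rw [← smul_neg, Matrix.mul_smul, ← hA, transpose_smul, smul_mul_assoc, Matrix.mul_assoc,
      mul_nonsing_inv _ hJd, Matrix.mul_one]
  generalize s • A = B at h1
  have h2 : (NormedSpace.exp B)ᵀ =
      J (Fin n) ℝ * (NormedSpace.exp B)⁻¹ * (J (Fin n) ℝ)⁻¹ := by
    rw [← exp_transpose, h1, exp_conj _ _ hJ, Matrix.exp_neg]
  have h3 := (isUnit_iff_isUnit_det _).1 (Matrix.isUnit_exp B)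
  rw [SymplecticGroup.mem_iff', h2]
  generalize NormedSpace.exp B = C at h3
  rw [Matrix.mul_assoc _ (J (Fin n) ℝ)⁻¹, nonsing_inv_mul _ hJd, Matrix.mul_one, Matrix.mul_assoc,
    nonsing_inv_mul _ h3, Matrix.mul_one]

/-- The linear part `exp (s A)` of the one-parameter subgroup generated by `v ↦ A v + b`. -/
def expLin {n : ℕ} (X : ASpLie n) (s : ℝ) : symplecticGroup (Fin n) ℝ :=
  ⟨NormedSpace.exp (s • X.1.1), exp_mem_symplecticGroup X.1 s⟩

/-- The translation part `∫₀ˢ exp (r A) b dr` of the one-parameter subgroup generated by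
`v ↦ A v + b`. -/
def expTrans {n : ℕ} (X : ASpLie n) (s : ℝ) : E n :=
  ∫ r in (0 : ℝ)..s, toEuclideanLin (expLin X r).1 X.2

/-- The Lie derivative `L_X f` along the vector field on `AL n` given by `X`. -/
def lieDeriv {n : ℕ} (X : ASpLie n) (f : AL n → ℂ) (L : AL n) : ℂ :=
  deriv (fun s : ℝ => f (act (expLin X s) (expTrans X s) L)) 0

/-- The iterated Lie derivative `L_{X₁} ⋯ L_{Xₖ} f`. -/
def iterLie {n : ℕ} (Xs : List (ASpLie n)) (f : AL n → ℂ) : AL n → ℂ :=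
  Xs.foldr lieDeriv f

theorem mem_act {n : ℕ} (g : symplecticGroup (Fin n) ℝ) (c : E n) (L : AL n) (v : E n) :
    v ∈ (act g c L).carrier ↔ ∃ w ∈ L.carrier, toEuclideanLin g.1 w + c = v :=
  AffineSubspace.mem_map

theorem mem_graph {n : ℕ} (t : Sym2 (Fin n) → ℝ) (τ : EuclideanSpace ℝ (Fin n)) (v : E n) :
    v ∈ (graph t τ).carrier ↔
      v.ofLp ∘ Sum.inl = symMat t *ᵥ (v.ofLp ∘ Sum.inr) + τ.ofLp := by
  constructor
  · intro h
    obtain ⟨y, -, rfl⟩ := AffineSubspace.mem_map.1 h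
    rfl
  · intro h
    refine AffineSubspace.mem_map.2 ⟨WithLp.toLp 2 (v.ofLp ∘ Sum.inr), AffineSubspace.mem_top _ _ _, ?_⟩
    ext i
    rcases i with i | i
    · exact (congrFun h i).symm
    · rfl

theorem act_act {n : ℕ} (g h : symplecticGroup (Fin n) ℝ) (c d : E n) (L : AL n) :
    act g c (act h d L) = act (g * h) (toEuclideanLin g.1 d + c) L := by
  ext v
  simp only [mem_act]
  constructor
  · rintro ⟨_, ⟨w, hw, rfl⟩, rfl⟩
    refine ⟨w, hw, ?_⟩
    ext i
    simp [mulVec_mulVec, add_assoc]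
  · rintro ⟨w, hw, rfl⟩
    refine ⟨_, ⟨w, hw, rfl⟩, ?_⟩
    ext i
    simp [mulVec_mulVec, add_assoc]

/-- The coordinates of the symmetric part of a matrix. -/
def symCoord {n : ℕ} (M : Matrix (Fin n) (Fin n) ℝ) : Sym2 (Fin n) → ℝ :=
  Sym2.lift ⟨fun i j => (M i j + M j i) / 2, fun i j => by ring⟩

theorem symMat_symCoord {n : ℕ} {M : Matrix (Fin n) (Fin n) ℝ} (hM : Mᵀ = M) :
    symMat (symCoord M) = M := by
  ext i j
  have : M j i = M i j := congrFun (congrFun hM i) j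
  simp [symMat, symCoord, this]

theorem act_graph {n : ℕ} (a b c d : Matrix (Fin n) (Fin n) ℝ) (h : symplecticGroup (Fin n) ℝ)
    (hh : h.1 = fromBlocks a b c d) (r : E n)
    (t : Sym2 (Fin n) → ℝ) (τ : EuclideanSpace ℝ (Fin n)) (hD : IsUnit (c * symMat t + d).det) :
    act h r (graph t τ) =
      graph (symCoord ((a * symMat t + b) * (c * symMat t + d)⁻¹))
        (WithLp.toLp 2 (a *ᵥ τ.ofLp + r.ofLp ∘ Sum.inl -
          ((a * symMat t + b) * (c * symMat t + d)⁻¹) *ᵥ (c *ᵥ τ.ofLp + r.ofLp ∘ Sum.inr))) := by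
  have hmem := h.2
  rw [hh, SymplecticGroup.fromBlocks_mem_iff] at hmem
  obtain ⟨h1, h2, h3⟩ := hmem
  have hT := symMat_transpose t
  set T := symMat t
  have hkey : (c * T + d)ᵀ * (a * T + b) = (a * T + b)ᵀ * (c * T + d) := by
    have h3' : dᵀ * a - bᵀ * c = 1 := by
      have := congrArg transpose h3
      simpa using this
    have e1 : dᵀ * a = 1 + bᵀ * c := by rw [← h3']; abel
    have e2 : aᵀ * d = 1 + cᵀ * b := by rw [← h3]; abel
    simp only [transpose_add, transpose_mul, hT, Matrix.add_mul, Matrix.mul_add, Matrix.mul_assoc]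
    rw [← Matrix.mul_assoc cᵀ a, ← Matrix.mul_assoc dᵀ a, e1, e2, ← h1, h2]
    simp only [Matrix.add_mul, Matrix.mul_add, Matrix.mul_assoc, Matrix.one_mul, Matrix.mul_one]
    abel
  have hinv := mul_nonsing_inv _ hD
  have hinv' := nonsing_inv_mul _ hD
  have hDT : IsUnit (c * T + d)ᵀ.det := by rwa [det_transpose]
  have hsym : ((a * T + b) * (c * T + d)⁻¹)ᵀ = (a * T + b) * (c * T + d)⁻¹ := by
    rw [transpose_mul, transpose_nonsing_inv]
    calc ((c * T + d)ᵀ)⁻¹ * (a * T + b)ᵀ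
        = ((c * T + d)ᵀ)⁻¹ * ((a * T + b)ᵀ * (c * T + d)) * (c * T + d)⁻¹ := by
          simp only [Matrix.mul_assoc, hinv, Matrix.mul_one]
      _ = _ := by
          rw [← hkey, ← Matrix.mul_assoc, nonsing_inv_mul _ hDT, Matrix.one_mul]
  ext v
  rw [mem_act, mem_graph, symMat_symCoord hsym]
  set D := c * T + d
  constructor
  · rintro ⟨w, hw, rfl⟩
    rw [mem_graph] at hw
    have e : (h.1 *ᵥ w.ofLp) = Sum.elim (a *ᵥ (w.ofLp ∘ Sum.inl) + b *ᵥ (w.ofLp ∘ Sum.inr))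
        (c *ᵥ (w.ofLp ∘ Sum.inl) + d *ᵥ (w.ofLp ∘ Sum.inr)) := by
      rw [hh, fromBlocks_mulVec]
    have e1 : (toEuclideanLin h.1 w + r).ofLp ∘ Sum.inl =
        (a * T + b) *ᵥ (w.ofLp ∘ Sum.inr) + a *ᵥ τ.ofLp + r.ofLp ∘ Sum.inl := by
      rw [WithLp.ofLp_add, toEuclideanLin_ofLp, e, hw]
      funext i
      simp [mulVec_add, add_mulVec, mulVec_mulVec]
      ring
    have e2 : (toEuclideanLin h.1 w + r).ofLp ∘ Sum.inr =
        D *ᵥ (w.ofLp ∘ Sum.inr) + (c *ᵥ τ.ofLp + r.ofLp ∘ Sum.inr) := by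
      rw [WithLp.ofLp_add, toEuclideanLin_ofLp, e, hw]
      funext i
      simp [D, mulVec_add, add_mulVec, mulVec_mulVec]
      ring
    rw [e1, e2, mulVec_add _ (D *ᵥ _), mulVec_mulVec, Matrix.mul_assoc, hinv', Matrix.mul_one]
    funext i
    simp
    ring
  · intro hv
    obtain ⟨y, hDy⟩ : ∃ y : Fin n → ℝ,
        D *ᵥ y = v.ofLp ∘ Sum.inr - (c *ᵥ τ.ofLp + r.ofLp ∘ Sum.inr) :=
      ⟨D⁻¹ *ᵥ (v.ofLp ∘ Sum.inr - (c *ᵥ τ.ofLp + r.ofLp ∘ Sum.inr)), by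
        rw [mulVec_mulVec, hinv, one_mulVec]⟩
    refine ⟨WithLp.toLp 2 (Sum.elim (T *ᵥ y + τ.ofLp) y), (mem_graph _ _ _).2 rfl, ?_⟩
    have e : (h.1 *ᵥ (Sum.elim (T *ᵥ y + τ.ofLp) y)) =
        Sum.elim (a *ᵥ (T *ᵥ y + τ.ofLp) + b *ᵥ y) (c *ᵥ (T *ᵥ y + τ.ofLp) + d *ᵥ y) := by
      rw [hh, fromBlocks_mulVec]
      rfl
    have e2 : c *ᵥ (T *ᵥ y + τ.ofLp) + d *ᵥ y + r.ofLp ∘ Sum.inr = v.ofLp ∘ Sum.inr := by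
      have : c *ᵥ (T *ᵥ y + τ.ofLp) + d *ᵥ y = D *ᵥ y + c *ᵥ τ.ofLp := by
        simp only [D, mulVec_add, add_mulVec, mulVec_mulVec]
        abel
      rw [this, hDy]
      abel
    have e1 : a *ᵥ (T *ᵥ y + τ.ofLp) + b *ᵥ y + r.ofLp ∘ Sum.inl = v.ofLp ∘ Sum.inl := by
      have h5 : v.ofLp ∘ Sum.inr = D *ᵥ y + (c *ᵥ τ.ofLp + r.ofLp ∘ Sum.inr) := by
        rw [hDy]; abel
      rw [hv, h5, mulVec_add _ (D *ᵥ _), mulVec_mulVec _ _ D, Matrix.mul_assoc, hinv', Matrix.mul_one]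
      simp only [mulVec_add, add_mulVec, mulVec_mulVec]
      abel
    ext i
    rw [WithLp.ofLp_add, toEuclideanLin_ofLp, e]
    rcases i with i | i
    · exact congrFun e1 i
    · exact congrFun e2 i

/-- The linear Lagrangian subspace `0 ⊕ ℝⁿ`. -/
def baseAL (n : ℕ) : AL n := graph 0 0

theorem symMat_zero {n : ℕ} : symMat (0 : Sym2 (Fin n) → ℝ) = 0 := rfl

theorem IsLagrangian.exists_symplectic {n : ℕ} {V : Submodule ℝ (E n)} (hV : IsLagrangian V) :
    ∃ g : symplecticGroup (Fin n) ℝ, ∀ y : Fin n → ℝ,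
      toEuclideanLin g.1 (WithLp.toLp 2 (Sum.elim 0 y)) ∈ V := by
  classical
  let e := (stdOrthonormalBasis ℝ V).reindex (finCongr hV.2)
  have he : ∀ i j, (e i : E n).ofLp ⬝ᵥ (e j : E n).ofLp = if i = j then 1 else 0 := by
    intro i j
    have h := orthonormal_iff_ite.1 e.orthonormal j i
    rw [Submodule.coe_inner, EuclideanSpace.inner_eq_star_dotProduct] at h
    simp only [star_trivial] at h
    rw [h]
    simp [eq_comm]
  have hJe : ∀ i j, (e i : E n).ofLp ⬝ᵥ (J (Fin n) ℝ *ᵥ (e j : E n).ofLp) = 0 :=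
    fun i j => hV.1 _ (e i).2 _ (e j).2
  let g : Matrix (Fin n ⊕ Fin n) (Fin n ⊕ Fin n) ℝ := Matrix.of fun k l =>
    Sum.elim (fun j => -(J (Fin n) ℝ *ᵥ (e j : E n).ofLp) k) (fun j => (e j : E n).ofLp k) l
  have hcol1 : ∀ j, g.col (Sum.inl j) = -(J (Fin n) ℝ *ᵥ (e j : E n).ofLp) := fun j => rfl
  have hcol2 : ∀ j, g.col (Sum.inr j) = (e j : E n).ofLp := fun j => rfl
  have hJJ : ∀ v : Fin n ⊕ Fin n → ℝ, J (Fin n) ℝ *ᵥ (J (Fin n) ℝ *ᵥ v) = -v := fun v => by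
    rw [mulVec_mulVec, J_squared, neg_mulVec, one_mulVec]
  have hJt : ∀ v w : Fin n ⊕ Fin n → ℝ, (J (Fin n) ℝ *ᵥ v) ⬝ᵥ w = -(v ⬝ᵥ (J (Fin n) ℝ *ᵥ w)) :=
    fun v w => by
      rw [dotProduct_comm, ← dotProduct_transpose_mulVec, J_transpose, neg_mulVec, dotProduct_neg]
  have hg : g ∈ symplecticGroup (Fin n) ℝ := by
    rw [SymplecticGroup.mem_iff']
    ext k l
    have h1 : (gᵀ * J (Fin n) ℝ * g) k l = g.col k ⬝ᵥ (J (Fin n) ℝ *ᵥ g.col l) := by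
      rw [Matrix.mul_assoc]
      rfl
    rw [h1]
    rcases k with k | k <;> rcases l with l | l <;>
      simp only [hcol1, hcol2, mulVec_neg, neg_dotProduct, dotProduct_neg, hJJ, hJt, hJe, he] <;>
      simp [J, Matrix.one_apply]
  refine ⟨⟨g, hg⟩, fun y => ?_⟩
  have : toEuclideanLin g (WithLp.toLp 2 (Sum.elim 0 y)) = ∑ j, y j • (e j : E n) := by
    ext k
    simp [g, mulVec, dotProduct, mul_comm]
  rw [this]
  exact Submodule.sum_mem _ fun j _ => Submodule.smul_mem _ _ (e j).2

theorem exists_chart {n : ℕ} (L : AL n) : ∃ (g : symplecticGroup (Fin n) ℝ)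
    (t : Sym2 (Fin n) → ℝ) (τ : EuclideanSpace ℝ (Fin n)), L = chart g t τ := by
  obtain ⟨g, hg⟩ := L.lagrangian.exists_symplectic
  obtain ⟨p, hp⟩ := L.nonempty
  have hdir : (act g p (baseAL n)).carrier.direction = L.carrier.direction := by
    refine Submodule.eq_of_le_of_finrank_eq ?_ ?_
    · change ((baseAL n).carrier.map (affMap g.1 p)).direction ≤ _
      rw [AffineSubspace.map_direction, Submodule.map_le_iff_le_comap]
      intro v hv
      change v ∈ ((⊤ : AffineSubspace ℝ (EuclideanSpace ℝ (Fin n))).map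
        (graphMap 0 0)).direction at hv
      rw [AffineSubspace.map_direction] at hv
      obtain ⟨y, -, rfl⟩ := hv
      have := hg y.ofLp
      simpa [graphMap, symMat_zero, affMap] using this
    · exact (act g p (baseAL n)).lagrangian.2.trans L.lagrangian.2.symm
  have hL : L = act g p (baseAL n) := by
    ext1
    refine (AffineSubspace.ext_of_direction_eq hdir ⟨p, ?_, hp⟩).symm
    refine (mem_act _ _ _ _).2 ⟨0, (mem_graph _ _ _).2 ?_, by simp⟩
    funext i
    simp
  have hginv : (g * g⁻¹ : symplecticGroup (Fin n) ℝ) = 1 := mul_inv_cancel g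
  have h1 : act g p (baseAL n) =
      act g 0 (act 1 (toEuclideanLin (g⁻¹ : symplecticGroup (Fin n) ℝ).1 p) (baseAL n)) := by
    rw [act_act, mul_one]
    congr 1
    ext i
    rw [add_zero, toEuclideanLin_ofLp, toEuclideanLin_ofLp, mulVec_mulVec]
    have : g.1 * (g⁻¹ : symplecticGroup (Fin n) ℝ).1 = 1 := congrArg Subtype.val hginv
    rw [this, one_mulVec]
  have h2 : ((1 : symplecticGroup (Fin n) ℝ) : Matrix (Fin n ⊕ Fin n) (Fin n ⊕ Fin n) ℝ) =
      fromBlocks 1 0 0 1 := fromBlocks_one.symm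
  rw [hL, h1, baseAL, act_graph 1 0 0 1 1 h2 _ _ _ (by simp)]
  exact ⟨_, _, _, rfl⟩

section Smoothness

open scoped Matrix.Norms.Operator

theorem contDiff_of_isLinearMap {V W : Type*} [NormedAddCommGroup V] [NormedSpace ℝ V]
    [FiniteDimensional ℝ V] [NormedAddCommGroup W] [NormedSpace ℝ W] {f : V → W}
    (hf : IsLinearMap ℝ f) : ContDiff ℝ ∞ f :=
  (LinearMap.toContinuousLinearMap (hf.mk' f)).contDiff

theorem contDiffAt_mulVec {V : Type*} [NormedAddCommGroup V] [NormedSpace ℝ V] {m k : Type*}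
    [Fintype m] [Fintype k] [DecidableEq m] [DecidableEq k] {M : V → Matrix m k ℝ} {v : V → k → ℝ}
    {p : V} (hM : ContDiffAt ℝ ∞ M p) (hv : ContDiffAt ℝ ∞ v p) :
    ContDiffAt ℝ ∞ (fun q => M q *ᵥ v q) p := by
  rw [contDiffAt_pi]
  intro i
  have h1 : ∀ j, ContDiffAt ℝ ∞ (fun q => M q i j) p := fun j =>
    (contDiff_of_isLinearMap (f := fun N : Matrix m k ℝ => N i j)
      ⟨fun _ _ => rfl, fun _ _ => rfl⟩).contDiffAt.comp p hM
  have h2 : ∀ j, ContDiffAt ℝ ∞ (fun q => v q j) p := contDiffAt_pi.1 hv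
  change ContDiffAt ℝ ∞ (fun q => ∑ j, M q i j * v q j) p
  exact ContDiffAt.sum fun j _ => (h1 j).mul (h2 j)

theorem contDiff_expLin {n : ℕ} (X : ASpLie n) : ContDiff ℝ ∞ fun s => (expLin X s).1 := by
  have h : ContDiff ℝ ∞ (NormedSpace.exp : Matrix (Fin n ⊕ Fin n) (Fin n ⊕ Fin n) ℝ → _) :=
    contDiff_iff_contDiffAt.2 fun x => (NormedSpace.exp_analytic (𝕂 := ℝ) x).contDiffAt
  exact h.comp (contDiff_id.smul contDiff_const)

theorem contDiff_expTrans {n : ℕ} (X : ASpLie n) : ContDiff ℝ ∞ (expTrans X) := by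
  have hF : ContDiff ℝ ∞ fun r => toEuclideanLin (expLin X r).1 X.2 := by
    have h := contDiff_iff_contDiffAt.2 fun r =>
      contDiffAt_mulVec (contDiff_expLin X).contDiffAt (contDiffAt_const (c := X.2.ofLp) (x := r))
    exact (PiLp.continuousLinearEquiv 2 ℝ fun _ : Fin n ⊕ Fin n => ℝ).symm.contDiff.comp h
  have hd : ∀ s, HasDerivAt (expTrans X) (toEuclideanLin (expLin X s).1 X.2) s := fun s =>
    intervalIntegral.integral_hasDerivAt_right (hF.continuous.intervalIntegrable _ _)
      (hF.continuous.stronglyMeasurableAtFilter _ _) hF.continuous.continuousAt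
  refine contDiff_infty_iff_deriv.2 ⟨fun s => (hd s).differentiableAt, ?_⟩
  have : deriv (expTrans X) = fun s => toEuclideanLin (expLin X s).1 X.2 :=
    funext fun s => (hd s).deriv
  rw [this]
  exact hF

theorem expLin_zero {n : ℕ} (X : ASpLie n) : expLin X 0 = 1 := by
  apply Subtype.ext
  simp [expLin]

theorem act_chart {n : ℕ} (X : ASpLie n) (g : symplecticGroup (Fin n) ℝ) (s : ℝ)
    (t : Sym2 (Fin n) → ℝ) (τ : EuclideanSpace ℝ (Fin n)) :
    act (expLin X s) (expTrans X s) (chart g t τ) =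
      act g 0 (act (g⁻¹ * expLin X s * g)
        (toEuclideanLin (g⁻¹ : symplecticGroup (Fin n) ℝ).1 (expTrans X s)) (graph t τ)) := by
  rw [chart, act_act, act_act, map_zero, zero_add, add_zero, mul_assoc g⁻¹, mul_inv_cancel_left]
  congr 1
  ext i
  have : g.1 * (g⁻¹ : symplecticGroup (Fin n) ℝ).1 = 1 :=
    congrArg Subtype.val (mul_inv_cancel g)
  rw [toEuclideanLin_ofLp, toEuclideanLin_ofLp, mulVec_mulVec, this, one_mulVec]

/-- In a chart, the action of a one-parameter group is a smooth function of time and position. -/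
theorem exists_local_flow {n : ℕ} (X : ASpLie n) (g : symplecticGroup (Fin n) ℝ)
    (p : (Sym2 (Fin n) → ℝ) × EuclideanSpace ℝ (Fin n)) :
    ∃ Φ : ℝ × ((Sym2 (Fin n) → ℝ) × EuclideanSpace ℝ (Fin n)) →
        (Sym2 (Fin n) → ℝ) × EuclideanSpace ℝ (Fin n),
      ContDiffAt ℝ ∞ Φ (0, p) ∧ ∀ᶠ q in nhds ((0 : ℝ), p),
        act (expLin X q.1) (expTrans X q.1) (chart g q.2.1 q.2.2) =
          chart g (Φ q).1 (Φ q).2 := by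
  let h : ℝ → symplecticGroup (Fin n) ℝ := fun s => g⁻¹ * expLin X s * g
  let r : ℝ → E n := fun s => toEuclideanLin (g⁻¹ : symplecticGroup (Fin n) ℝ).1 (expTrans X s)
  have hh : ContDiff ℝ ∞ fun s => (h s).1 :=
    (contDiff_const.mul (contDiff_expLin X)).mul contDiff_const
  have hr : ContDiff ℝ ∞ r :=
    (contDiff_of_isLinearMap (LinearMap.isLinear (toEuclideanLin
      (g⁻¹ : symplecticGroup (Fin n) ℝ).1))).comp (contDiff_expTrans X)
  let a : ℝ → Matrix (Fin n) (Fin n) ℝ := fun s => (h s).1.toBlocks₁₁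
  let b : ℝ → Matrix (Fin n) (Fin n) ℝ := fun s => (h s).1.toBlocks₁₂
  let c : ℝ → Matrix (Fin n) (Fin n) ℝ := fun s => (h s).1.toBlocks₂₁
  let d : ℝ → Matrix (Fin n) (Fin n) ℝ := fun s => (h s).1.toBlocks₂₂
  have ha : ContDiff ℝ ∞ a := (contDiff_of_isLinearMap (f := toBlocks₁₁)
    ⟨fun _ _ => rfl, fun _ _ => rfl⟩).comp hh
  have hb : ContDiff ℝ ∞ b := (contDiff_of_isLinearMap (f := toBlocks₁₂)
    ⟨fun _ _ => rfl, fun _ _ => rfl⟩).comp hh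
  have hc : ContDiff ℝ ∞ c := (contDiff_of_isLinearMap (f := toBlocks₂₁)
    ⟨fun _ _ => rfl, fun _ _ => rfl⟩).comp hh
  have hd : ContDiff ℝ ∞ d := (contDiff_of_isLinearMap (f := toBlocks₂₂)
    ⟨fun _ _ => rfl, fun _ _ => rfl⟩).comp hh
  let P := ℝ × ((Sym2 (Fin n) → ℝ) × EuclideanSpace ℝ (Fin n))
  have hT : ContDiff ℝ ∞ fun q : P => symMat q.2.1 :=
    (contDiff_of_isLinearMap (f := symMat) ⟨fun _ _ => rfl, fun _ _ => rfl⟩).comp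
      (contDiff_fst.comp contDiff_snd)
  let N : P → Matrix (Fin n) (Fin n) ℝ := fun q => a q.1 * symMat q.2.1 + b q.1
  let D : P → Matrix (Fin n) (Fin n) ℝ := fun q => c q.1 * symMat q.2.1 + d q.1
  have hN : ContDiff ℝ ∞ N := ((ha.comp contDiff_fst).mul hT).add (hb.comp contDiff_fst)
  have hD : ContDiff ℝ ∞ D := ((hc.comp contDiff_fst).mul hT).add (hd.comp contDiff_fst)
  have hD0 : D (0, p) = 1 := by
    have h0 : (h 0).1 = fromBlocks 1 0 0 1 := by
      simp [h, expLin_zero, fromBlocks_one]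
    simp only [D, c, d]
    rw [h0, toBlocks_fromBlocks₂₁, toBlocks_fromBlocks₂₂, zero_mul, zero_add]
  have hunit : IsUnit (D (0, p)) := by rw [hD0]; exact isUnit_one
  have hev : ∀ᶠ q in nhds ((0 : ℝ), p), IsUnit (D q) :=
    hD.continuous.continuousAt.eventually (Units.isOpen.mem_nhds hunit)
  have hDinv : ContDiffAt ℝ ∞ (fun q => (D q)⁻¹) (0, p) := by
    obtain ⟨u, hu⟩ := hunit
    have h1 : ContDiffAt ℝ ∞ Ring.inverse (D (0, p)) := hu ▸ contDiffAt_ringInverse ℝ u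
    have h2 := h1.comp (0, p) hD.contDiffAt
    simpa only [Function.comp_def, ← nonsing_inv_eq_ringInverse] using h2
  let S : P → Matrix (Fin n) (Fin n) ℝ := fun q => N q * (D q)⁻¹
  have hS : ContDiffAt ℝ ∞ S (0, p) := hN.contDiffAt.mul hDinv
  have hτ : ContDiff ℝ ∞ fun q : P => q.2.2.ofLp :=
    (contDiff_of_isLinearMap (f := fun τ : EuclideanSpace ℝ (Fin n) => τ.ofLp)
      ⟨fun _ _ => rfl, fun _ _ => rfl⟩).comp (contDiff_snd.comp contDiff_snd)
  have hr1 : ContDiff ℝ ∞ fun q : P => (r q.1).ofLp ∘ Sum.inl :=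
    ((contDiff_of_isLinearMap (f := fun v : E n => v.ofLp ∘ Sum.inl)
      ⟨fun _ _ => rfl, fun _ _ => rfl⟩).comp hr).comp contDiff_fst
  have hr2 : ContDiff ℝ ∞ fun q : P => (r q.1).ofLp ∘ Sum.inr :=
    ((contDiff_of_isLinearMap (f := fun v : E n => v.ofLp ∘ Sum.inr)
      ⟨fun _ _ => rfl, fun _ _ => rfl⟩).comp hr).comp contDiff_fst
  have hσ : ContDiffAt ℝ ∞ (fun q : P => a q.1 *ᵥ q.2.2.ofLp + (r q.1).ofLp ∘ Sum.inl -
      S q *ᵥ (c q.1 *ᵥ q.2.2.ofLp + (r q.1).ofLp ∘ Sum.inr)) (0, p) :=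
    ((contDiffAt_mulVec (ha.comp contDiff_fst).contDiffAt hτ.contDiffAt).add hr1.contDiffAt).sub
      (contDiffAt_mulVec hS
        ((contDiffAt_mulVec (hc.comp contDiff_fst).contDiffAt hτ.contDiffAt).add hr2.contDiffAt))
  have hsym : IsLinearMap ℝ (symCoord (n := n)) := by
    refine ⟨fun M M' => ?_, fun x M => ?_⟩ <;>
    · ext z
      induction z with
      | _ i j => simp [symCoord]; ring
  refine ⟨fun q => (symCoord (S q), WithLp.toLp 2 (a q.1 *ᵥ q.2.2.ofLp + (r q.1).ofLp ∘ Sum.inl -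
      S q *ᵥ (c q.1 *ᵥ q.2.2.ofLp + (r q.1).ofLp ∘ Sum.inr))), ?_, ?_⟩
  · exact ((contDiff_of_isLinearMap hsym).contDiffAt.comp (0, p) hS).prodMk
      ((PiLp.continuousLinearEquiv 2 ℝ fun _ : Fin n => ℝ).symm.contDiff.contDiffAt.comp (0, p) hσ)
  · filter_upwards [hev] with q hq
    rw [act_chart, act_graph (a q.1) (b q.1) (c q.1) (d q.1) (h q.1)
      (fromBlocks_toBlocks _).symm _ _ _ ((isUnit_iff_isUnit_det _).1 hq)]
    rfl

end Smoothness

theorem IsSmooth.exists_local {n : ℕ} {f : AL n → ℂ} (hf : IsSmooth f) (X : ASpLie n)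
    (g : symplecticGroup (Fin n) ℝ) (p : (Sym2 (Fin n) → ℝ) × EuclideanSpace ℝ (Fin n)) :
    ContDiffAt ℝ ∞ (fun q : ℝ × ((Sym2 (Fin n) → ℝ) × EuclideanSpace ℝ (Fin n)) =>
      f (act (expLin X q.1) (expTrans X q.1) (chart g q.2.1 q.2.2))) (0, p) := by
  obtain ⟨Φ, hΦ, hev⟩ := exists_local_flow X g p
  refine ((hf g).contDiffAt.comp (0, p) hΦ).congr_of_eventuallyEq ?_
  filter_upwards [hev] with q hq
  rw [hq]
  rfl

theorem IsSmooth.differentiableAt_flow {n : ℕ} {f : AL n → ℂ} (hf : IsSmooth f) (X : ASpLie n)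
    (L : AL n) : DifferentiableAt ℝ (fun s : ℝ => f (act (expLin X s) (expTrans X s) L)) 0 := by
  obtain ⟨g, t, τ, rfl⟩ := exists_chart L
  have h := (hf.exists_local X g (t, τ)).differentiableAt (by simp)
  exact DifferentiableAt.comp (0 : ℝ) (f := fun s : ℝ => (s, (t, τ))) h
    (differentiableAt_id.prodMk (differentiableAt_const _))

theorem IsSmooth.lieDeriv {n : ℕ} {f : AL n → ℂ} (hf : IsSmooth f) (X : ASpLie n) :
    IsSmooth (lieDeriv X f) := by
  intro g
  let G : ℝ × ((Sym2 (Fin n) → ℝ) × EuclideanSpace ℝ (Fin n)) → ℂ := fun q =>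
    f (act (expLin X q.1) (expTrans X q.1) (chart g q.2.1 q.2.2))
  have hG : ∀ p, ContDiffAt ℝ ∞ G (0, p) := hf.exists_local X g
  have heq : (fun p : (Sym2 (Fin n) → ℝ) × EuclideanSpace ℝ (Fin n) =>
      LagrangianRadon.lieDeriv X f (chart g p.1 p.2)) = fun p => fderiv ℝ G (0, p) (1, 0) := by
    funext p
    have h1 : HasFDerivAt G (fderiv ℝ G (0, p)) (0, p) :=
      ((hG p).differentiableAt (by simp)).hasFDerivAt
    have h2 : HasDerivAt (fun s : ℝ => (s, p)) ((1 : ℝ), 0) 0 :=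
      (hasDerivAt_id _).prodMk (hasDerivAt_const _ _)
    exact (h1.comp_hasDerivAt (0 : ℝ) h2).deriv
  rw [heq, contDiff_iff_contDiffAt]
  intro p
  have h1 : ContDiffAt ℝ ∞ (fderiv ℝ G) (0, p) := (hG p).fderiv_right (by simp)
  have h2 : ContDiffAt ℝ ∞ (fun p' => fderiv ℝ G ((0 : ℝ), p')) p :=
    h1.comp p (contDiffAt_const.prodMk contDiffAt_id)
  exact h2.clm_apply contDiffAt_const

theorem IsSmooth.iterLie {n : ℕ} {f : AL n → ℂ} (hf : IsSmooth f) (Xs : List (ASpLie n)) :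
    IsSmooth (iterLie Xs f) := by
  induction Xs with
  | nil => exact hf
  | cons X Xs ih => exact ih.lieDeriv X

theorem IsSmooth.add {n : ℕ} {f f' : AL n → ℂ} (hf : IsSmooth f) (hf' : IsSmooth f') :
    IsSmooth (f + f') := fun g => (hf g).add (hf' g)

theorem IsSmooth.const_smul {n : ℕ} {f : AL n → ℂ} (hf : IsSmooth f) (z : ℂ) :
    IsSmooth (z • f) := fun g => (hf g).const_smul z

theorem iterLie_add {n : ℕ} {f f' : AL n → ℂ} (hf : IsSmooth f) (hf' : IsSmooth f')
    (Xs : List (ASpLie n)) : iterLie Xs (f + f') = iterLie Xs f + iterLie Xs f' := by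
  induction Xs with
  | nil => rfl
  | cons X Xs ih =>
    change lieDeriv X (iterLie Xs (f + f')) = _
    rw [ih]
    funext L
    exact deriv_fun_add ((hf.iterLie Xs).differentiableAt_flow X L)
      ((hf'.iterLie Xs).differentiableAt_flow X L)

theorem iterLie_smul {n : ℕ} {f : AL n → ℂ} (hf : IsSmooth f) (z : ℂ)
    (Xs : List (ASpLie n)) : iterLie Xs (z • f) = z • iterLie Xs f := by
  induction Xs with
  | nil => rfl
  | cons X Xs ih =>
    change lieDeriv X (iterLie Xs (z • f)) = _
    rw [ih]
    funext L
    exact deriv_fun_const_smul z ((hf.iterLie Xs).differentiableAt_flow X L)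

/-- The weighted supremum seminorm `v ↦ sup_i w i * ‖T v i‖` of a linear family of functions. -/
def supSeminorm {V ι : Type*} [AddCommGroup V] [Module ℂ V] (T : V →ₗ[ℂ] (ι → ℂ)) (w : ι → ℝ)
    (hw : ∀ i, 0 ≤ w i) (hT : ∀ v, ∃ C : ℝ, ∀ i, w i * ‖T v i‖ ≤ C) : Seminorm ℂ V :=
  Seminorm.of (fun v => ⨆ i, w i * ‖T v i‖)
    (fun v v' => by
      have hbdd : ∀ v, BddAbove (Set.range fun i => w i * ‖T v i‖) := fun v => by
        obtain ⟨C, hC⟩ := hT v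
        exact ⟨C, by rintro _ ⟨i, rfl⟩; exact hC i⟩
      refine Real.iSup_le (fun i => ?_) (add_nonneg
        (Real.iSup_nonneg fun i => mul_nonneg (hw i) (norm_nonneg _))
        (Real.iSup_nonneg fun i => mul_nonneg (hw i) (norm_nonneg _)))
      calc w i * ‖T (v + v') i‖ ≤ w i * ‖T v i‖ + w i * ‖T v' i‖ := by
            rw [map_add, Pi.add_apply, ← mul_add]
            exact mul_le_mul_of_nonneg_left (norm_add_le _ _) (hw i)
        _ ≤ _ := add_le_add (le_ciSup (hbdd v) i) (le_ciSup (hbdd v') i))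
    (fun z v => by
      rw [Real.mul_iSup_of_nonneg (norm_nonneg z)]
      congr 1
      funext i
      rw [map_smul, Pi.smul_apply, norm_smul]
      ring)

/-- The Schwartz space `𝓢(AL n)`: smooth functions all of whose iterated Lie derivatives are
`O(d(0, L)^(-M))` for every `M`. -/
def schwartzAL (n : ℕ) : Submodule ℂ (AL n → ℂ) where
  carrier := {f | IsSmooth f ∧ ∀ (Xs : List (ASpLie n)) (M : ℕ), ∃ C : ℝ, ∀ L : AL n,
    (1 + Metric.infDist 0 (L.carrier : Set (E n))) ^ M * ‖iterLie Xs f L‖ ≤ C}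
  zero_mem' := by
    refine ⟨fun g => contDiff_const (c := (0 : ℂ)), fun Xs M => ⟨0, fun L => ?_⟩⟩
    have h0 : iterLie Xs (0 : AL n → ℂ) = 0 := by
      induction Xs with
      | nil => rfl
      | cons X Xs ih =>
        change lieDeriv X (iterLie Xs 0) = 0
        rw [ih]
        funext L
        exact deriv_const _ _
    simp [h0]
  add_mem' := by
    rintro f f' ⟨hf, hfC⟩ ⟨hf', hfC'⟩
    refine ⟨hf.add hf', fun Xs M => ?_⟩
    obtain ⟨C, hC⟩ := hfC Xs M
    obtain ⟨C', hC'⟩ := hfC' Xs M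
    refine ⟨C + C', fun L => ?_⟩
    rw [iterLie_add hf hf', Pi.add_apply]
    refine le_trans ?_ (add_le_add (hC L) (hC' L))
    rw [← mul_add]
    exact mul_le_mul_of_nonneg_left (norm_add_le _ _)
      (pow_nonneg (add_nonneg zero_le_one Metric.infDist_nonneg) _)
  smul_mem' := by
    rintro z f ⟨hf, hfC⟩
    refine ⟨hf.const_smul z, fun Xs M => ?_⟩
    obtain ⟨C, hC⟩ := hfC Xs M
    refine ⟨‖z‖ * C, fun L => ?_⟩
    rw [iterLie_smul hf, Pi.smul_apply, norm_smul, mul_left_comm]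
    exact mul_le_mul_of_nonneg_left (hC L) (norm_nonneg z)

/-- The Schwartz space `𝓢(AL n)` as a type, with its own topology below. -/
def SchwartzAL (n : ℕ) : Type := schwartzAL n

instance (n : ℕ) : AddCommGroup (SchwartzAL n) := inferInstanceAs (AddCommGroup (schwartzAL n))
instance (n : ℕ) : Module ℂ (SchwartzAL n) := inferInstanceAs (Module ℂ (schwartzAL n))
instance (n : ℕ) : CoeFun (SchwartzAL n) (fun _ => AL n → ℂ) := ⟨fun f => f.1⟩

/-- The seminorms `sup_L (1 + d(0, L))^M |L_{X₁} ⋯ L_{Xₖ} f(L)|`. -/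
def schwartzALSeminorm (n : ℕ) : SeminormFamily ℂ (SchwartzAL n) (List (ASpLie n) × ℕ) := fun k =>
  supSeminorm
    { toFun := fun f => iterLie k.1 f.1
      map_add' := fun f f' => iterLie_add f.2.1 f'.2.1 k.1
      map_smul' := fun z f => iterLie_smul f.2.1 z k.1 }
    (fun L => (1 + Metric.infDist 0 (L.carrier : Set (E n))) ^ k.2)
    (fun _ => pow_nonneg (add_nonneg zero_le_one Metric.infDist_nonneg) _)
    (fun f => f.2.2 k.1 k.2)

instance (n : ℕ) : TopologicalSpace (SchwartzAL n) :=
  (schwartzALSeminorm n).moduleFilterBasis.topology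

/-- The partial derivative `∂_{i₁} ⋯ ∂_{iₖ} f` in the coordinates of `ℝ²ⁿ`. -/
def partialDeriv {n k : ℕ} (i : Fin k → Fin n ⊕ Fin n) (f : E n → ℂ) (x : E n) : ℂ :=
  iteratedFDeriv ℝ k f x fun j => EuclideanSpace.single (i j) 1

theorem partialDeriv_add {n k : ℕ} (i : Fin k → Fin n ⊕ Fin n) {f f' : E n → ℂ}
    (hf : ContDiff ℝ ∞ f) (hf' : ContDiff ℝ ∞ f') :
    partialDeriv i (f + f') = partialDeriv i f + partialDeriv i f' := by
  funext x
  have hk : (k : WithTop ℕ∞) ≤ ∞ := by exact_mod_cast le_top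
  simp only [partialDeriv, Pi.add_apply]
  rw [iteratedFDeriv_add_apply (hf.of_le hk).contDiffAt (hf'.of_le hk).contDiffAt]
  rfl

theorem partialDeriv_smul {n k : ℕ} (i : Fin k → Fin n ⊕ Fin n) {f : E n → ℂ}
    (hf : ContDiff ℝ ∞ f) (z : ℂ) : partialDeriv i (z • f) = z • partialDeriv i f := by
  funext x
  have hk : (k : WithTop ℕ∞) ≤ ∞ := by exact_mod_cast le_top
  simp only [partialDeriv, Pi.smul_apply]
  rw [iteratedFDeriv_const_smul_apply (hf.of_le hk).contDiffAt]
  rfl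

/-- The space `𝓑(ℝ²ⁿ)`: smooth functions with `sup_x (1 + |x|)^n |∂^α f(x)| < ∞` for all `α`. -/
def spaceB (n : ℕ) : Submodule ℂ (E n → ℂ) where
  carrier := {f | ContDiff ℝ ∞ f ∧ ∀ (k : ℕ) (i : Fin k → Fin n ⊕ Fin n), ∃ C : ℝ, ∀ x : E n,
    (1 + ‖x‖) ^ n * ‖partialDeriv i f x‖ ≤ C}
  zero_mem' := by
    refine ⟨contDiff_const, fun k i => ⟨0, fun x => ?_⟩⟩
    have h0 : partialDeriv i (0 : E n → ℂ) x = 0 := by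
      simpa using congrFun (partialDeriv_smul i (f := (0 : E n → ℂ)) contDiff_const 0) x
    simp [h0]
  add_mem' := by
    rintro f f' ⟨hf, hfC⟩ ⟨hf', hfC'⟩
    refine ⟨hf.add hf', fun k i => ?_⟩
    obtain ⟨C, hC⟩ := hfC k i
    obtain ⟨C', hC'⟩ := hfC' k i
    refine ⟨C + C', fun x => ?_⟩
    rw [partialDeriv_add i hf hf', Pi.add_apply]
    refine le_trans ?_ (add_le_add (hC x) (hC' x))
    rw [← mul_add]
    exact mul_le_mul_of_nonneg_left (norm_add_le _ _) (by positivity)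
  smul_mem' := by
    rintro z f ⟨hf, hfC⟩
    refine ⟨hf.const_smul z, fun k i => ?_⟩
    obtain ⟨C, hC⟩ := hfC k i
    refine ⟨‖z‖ * C, fun x => ?_⟩
    rw [partialDeriv_smul i hf, Pi.smul_apply, norm_smul, mul_left_comm]
    exact mul_le_mul_of_nonneg_left (hC x) (norm_nonneg z)

/-- The space `𝓑(ℝ²ⁿ)` as a type, with its own topology below. -/
def SpaceB (n : ℕ) : Type := spaceB n

instance (n : ℕ) : AddCommGroup (SpaceB n) := inferInstanceAs (AddCommGroup (spaceB n))
instance (n : ℕ) : Module ℂ (SpaceB n) := inferInstanceAs (Module ℂ (spaceB n))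
instance (n : ℕ) : CoeFun (SpaceB n) (fun _ => E n → ℂ) := ⟨fun f => f.1⟩

/-- The seminorms `H_α(f) = sup_x (1 + |x|)^n |∂^α f(x)|`. -/
def spaceBSeminorm (n : ℕ) :
    SeminormFamily ℂ (SpaceB n) (Σ k : ℕ, Fin k → Fin n ⊕ Fin n) := fun α =>
  supSeminorm
    { toFun := fun f => partialDeriv α.2 f.1
      map_add' := fun f f' => partialDeriv_add α.2 f.2.1 f'.2.1
      map_smul' := fun z f => partialDeriv_smul α.2 f.2.1 z }
    (fun x => (1 + ‖x‖) ^ n) (fun _ => by positivity) (fun f => f.2.2 α.1 α.2)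

instance (n : ℕ) : Nonempty (Σ k : ℕ, Fin k → Fin n ⊕ Fin n) := ⟨⟨0, Fin.elim0⟩⟩

instance (n : ℕ) : TopologicalSpace (SpaceB n) :=
  (spaceBSeminorm n).moduleFilterBasis.topology

/-- The space `𝓑'(ℝ²ⁿ)` of continuous linear functionals on `𝓑(ℝ²ⁿ)`, with the topology of
pointwise convergence. -/
abbrev DualB (n : ℕ) : Type := SpaceB n →Lₚₜ[ℂ] ℂ

/-- The space `𝓢'(AL n)` of continuous linear functionals on `𝓢(AL n)`, with the topology of
pointwise convergence. -/
abbrev DualSchwartzAL (n : ℕ) : Type := SchwartzAL n →Lₚₜ[ℂ] ℂ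

/-- The surface measure `μ_L` on an affine Lagrangian subspace, as a measure on `ℝ²ⁿ`. -/
def surfaceMeasure {n : ℕ} (L : AL n) : Measure (E n) :=
  (μHE[n]).restrict (L.carrier : Set (E n))

/-- The Radon transform `f ↦ ∫_L f dμ_L`. -/
def radon {n : ℕ} (f : E n → ℂ) (L : AL n) : ℂ := ∫ v, f v ∂(surfaceMeasure L)

/-- The embedding `a + i b ↦ (a, b; -b, a)` of the unitary group into the symplectic group. -/
def unitaryToSymplectic {n : ℕ} (u : unitaryGroup (Fin n) ℂ) : symplecticGroup (Fin n) ℝ :=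
  ⟨fromBlocks (u.1.map Complex.re) (u.1.map Complex.im)
      (-u.1.map Complex.im) (u.1.map Complex.re), by
    have h := mem_unitaryGroup_iff'.1 u.2
    have hre : ∀ i j, (u.1.map Complex.re)ᵀ i j = (u.1 j i).re := fun _ _ => rfl
    rw [SymplecticGroup.fromBlocks_mem_iff]
    have key : ∀ i j, (∑ k, star (u.1 k i) * u.1 k j) = (1 : Matrix (Fin n) (Fin n) ℂ) i j :=
      fun i j => congrFun (congrFun h i) j
    have kre : ∀ i j, (∑ k, ((u.1 k i).re * (u.1 k j).re + (u.1 k i).im * (u.1 k j).im)) =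
        (1 : Matrix (Fin n) (Fin n) ℝ) i j := fun i j => by
      have := congrArg Complex.re (key i j)
      rw [Complex.re_sum] at this
      rw [one_apply] at this ⊢
      split_ifs at this ⊢ <;> simpa [Complex.mul_re] using this
    have kim : ∀ i j, (∑ k, ((u.1 k i).re * (u.1 k j).im - (u.1 k i).im * (u.1 k j).re)) = 0 :=
      fun i j => by
        have := congrArg Complex.im (key i j)
        rw [Complex.im_sum] at this
        rw [one_apply] at this
        split_ifs at this <;> simpa [Complex.mul_im, sub_eq_add_neg] using this
    refine ⟨?_, ?_, ?_⟩
    · ext i j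
      have := kim i j
      rw [Finset.sum_sub_distrib] at this
      simp [mul_apply]
      linarith
    · ext i j
      have := kim i j
      rw [Finset.sum_sub_distrib] at this
      simp [mul_apply]
      linarith
    · ext i j
      have := kre i j
      rw [Finset.sum_add_distrib] at this
      simp [mul_apply]
      linarith⟩

instance (n : ℕ) : CompactSpace (unitaryGroup (Fin n) ℂ) := by
  refine isCompact_iff_compactSpace.1 (?_ : IsCompact
    (unitaryGroup (Fin n) ℂ : Set (Matrix (Fin n) (Fin n) ℂ)))
  open scoped Matrix.Norms.Elementwise in
  refine Metric.isCompact_of_isClosed_isBounded ?_ ?_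
  · have : (unitaryGroup (Fin n) ℂ : Set (Matrix (Fin n) (Fin n) ℂ)) = {A | star A * A = 1} := by
      ext A; exact mem_unitaryGroup_iff'
    rw [this]
    exact isClosed_eq (by fun_prop) continuous_const
  · exact (Metric.isBounded_iff_subset_closedBall 0).2 ⟨1, fun A hA => by
      simpa using entrywise_sup_norm_bound_of_unitary hA⟩

instance (n : ℕ) : MeasurableSpace (unitaryGroup (Fin n) ℂ) := borel _
instance (n : ℕ) : BorelSpace (unitaryGroup (Fin n) ℂ) := ⟨rfl⟩

/-- The normalized Haar measure of the unitary group. -/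
def haarU (n : ℕ) : Measure (unitaryGroup (Fin n) ℂ) := Measure.haarMeasure ⊤

/-- The topology of `AL n` as a homogeneous space of `U(n) ⋉ ℝ²ⁿ`. -/
instance (n : ℕ) : TopologicalSpace (AL n) :=
  TopologicalSpace.coinduced
    (fun p : unitaryGroup (Fin n) ℂ × E n => act (unitaryToSymplectic p.1) p.2 (baseAL n))
    inferInstance

instance (n : ℕ) : MeasurableSpace (AL n) := borel _
instance (n : ℕ) : BorelSpace (AL n) := ⟨rfl⟩

/-- The measure `σ_x`: the probability measure on the set of all `L` containing `x` that is
invariant under the stabilizer of `x` in `U(n) ⋉ ℝ²ⁿ`, i.e. the distribution of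
`x + u (0 ⊕ ℝⁿ)` for Haar-random `u` in `U(n)`. -/
def sigma {n : ℕ} (x : E n) : Measure (AL n) :=
  (haarU n).map fun u => act (unitaryToSymplectic u) x (baseAL n)

/-- The `U(n) ⋉ ℝ²ⁿ`-invariant measure `dL` on `AL n`, normalized by
`dσ_x(L) dx = dμ_L(x) dL`: the image of Haar measure times Lebesgue measure under
`(u, τ) ↦ u ((τ, 0) + 0 ⊕ ℝⁿ)`. -/
def measureAL (n : ℕ) : Measure (AL n) :=
  ((haarU n).prod (volume : Measure (EuclideanSpace ℝ (Fin n)))).map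
    fun p => chart (unitaryToSymplectic p.1) 0 p.2

/-- The back-projection `𝔞 φ (x) = ∫ φ(L) dσ_x(L)`. -/
def backProj {n : ℕ} (φ : AL n → ℂ) (x : E n) : ℂ := ∫ L, φ L ∂(sigma x)

end

end LagrangianRadon

open LagrangianRadon

/-! Identify `ℝ²ⁿ` with `ℂⁿ`. The real part of the Hermitian form is the inner product and its
imaginary part is the symplectic form, so an orthonormal basis of a Lagrangian subspace is a unitary
basis of `ℂⁿ`. Hence every affine Lagrangian subspace is `u ((τ, 0) + 0 ⊕ ℝⁿ)` with `u` unitary, and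
its distance to the origin is `‖τ‖` (`exists_chart_unitary`, `infDist_chart_unitary`). As `sigma`
and `measureAL` are images of Haar measure under such parametrizations, the duality of Radon
transform and back-projection is Fubini together with the isometric change of variables `x = u (τ,
y)` (`integral_mul_backProj`).

The Radon transform preserves Schwartz spaces. Over a chart the integral with respect to `dy` is
smooth, because each derivative in the chart coordinates is the same integral of another Schwartz
function (`contDiff_graphInt`). The Jacobian of the chart is never computed: a radial bump has the
same integral over all linear Lagrangian subspaces, so the Jacobian is that constant divided by the
integral of the bump in the given parametrization (`IsParam.radon_eq_div`). Differentiating this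
quotient along a flow gives `L_X (R f) = R (X f) - c_X R f`, where `c_X` depends only on the
direction of `L` (`lieDeriv_radon`). Smooth functions of the direction are bounded, since directions
are parametrized by the compact group `U(n)`, and they are stable under products and Lie
derivatives. Induction then reduces every seminorm of `R f` to plain decay (`exists_iterLie_bound`,
`exists_radon_bound`).

The back-projection intertwines partial derivatives with Lie derivatives along translations
(`partialDeriv_backProj`), so only order zero has to be estimated. Up to a seminorm of `φ`, the
absolute value of the back-projection at `x` is at most the average over `u` of `(1 + |fst (u⁻¹
x)|)^(-(n+1))`. This average is radial and decreasing in `|x|`. Its value at `x` times the volume of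
the ball of radius `|x|`, of order `|x|^(2n)`, is therefore at most its integral over that ball. By
rotation invariance the latter is the integral of the weight itself, which is `O(|x|^n)` because the
weight is integrable in the first factor and constant in the second. The quotient is `O(|x|^(-n))`
(`exists_meanWeight_bound`).

The extension is the transpose of the back-projection. For uniqueness, fix `φ`: a competing
extension followed by evaluation at `φ` is a weak-* continuous functional, hence evaluation at some
`g` in `𝓑`; its values on Schwartz functions identify `g` with the back-projection of `φ`
(`eq_radonExtension`). -/

namespace LagrangianRadon

noncomputable section

/-! ### The unitary group as a group of isometries of `ℝ²ⁿ`. -/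

/-- The complex coordinates `y + i x` of a vector of `ℝ²ⁿ`. -/
def toComplex {n : ℕ} (v : E n) : Fin n → ℂ := fun k => ⟨v (Sum.inr k), v (Sum.inl k)⟩

theorem toComplex_injective {n : ℕ} : Function.Injective (toComplex (n := n)) := by
  intro v w h
  ext k
  rcases k with k | k
  · exact congrArg Complex.im (congrFun h k)
  · exact congrArg Complex.re (congrFun h k)

theorem toComplex_unitary {n : ℕ} (u : unitaryGroup (Fin n) ℂ) (v : E n) :
    toComplex (toEuclideanLin (unitaryToSymplectic u).1 v) = u.1 *ᵥ toComplex v := by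
  funext k
  apply Complex.ext
  · simp [toComplex, unitaryToSymplectic, mulVec, dotProduct, Finset.sum_sub_distrib]
    ring
  · simp [toComplex, unitaryToSymplectic, mulVec, dotProduct, Finset.sum_add_distrib]

theorem star_dotProduct_toComplex {n : ℕ} (v : E n) :
    star (toComplex v) ⬝ᵥ toComplex v = ((‖v‖ ^ 2 : ℝ) : ℂ) := by
  rw [EuclideanSpace.norm_sq_eq, Fintype.sum_sum_type, add_comm, ← Finset.sum_add_distrib]
  simp only [dotProduct, Pi.star_apply]
  push_cast
  refine Finset.sum_congr rfl fun k _ => ?_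
  apply Complex.ext <;> simp [toComplex, ← Complex.ofReal_pow] <;> ring

theorem norm_unitary {n : ℕ} (u : unitaryGroup (Fin n) ℂ) (v : E n) :
    ‖toEuclideanLin (unitaryToSymplectic u).1 v‖ = ‖v‖ := by
  have h := star_dotProduct_toComplex (toEuclideanLin (unitaryToSymplectic u).1 v)
  rw [toComplex_unitary, star_mulVec, ← dotProduct_mulVec, mulVec_mulVec,
    ← star_eq_conjTranspose, mem_unitaryGroup_iff'.1 u.2, one_mulVec,
    star_dotProduct_toComplex] at h
  exact ((pow_left_inj₀ (norm_nonneg _) (norm_nonneg _) two_ne_zero).1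
    (Complex.ofReal_injective h)).symm

/-- The unitary group acts on `ℝ²ⁿ` by isometries. -/
def rot {n : ℕ} (u : unitaryGroup (Fin n) ℂ) : E n ≃ₗᵢ[ℝ] E n :=
  LinearIsometry.toLinearIsometryEquiv
    ⟨toEuclideanLin (unitaryToSymplectic u).1, norm_unitary u⟩ rfl

theorem rot_apply {n : ℕ} (u : unitaryGroup (Fin n) ℂ) (v : E n) :
    rot u v = toEuclideanLin (unitaryToSymplectic u).1 v := rfl

theorem toComplex_rot {n : ℕ} (u : unitaryGroup (Fin n) ℂ) (v : E n) :
    toComplex (rot u v) = u.1 *ᵥ toComplex v := toComplex_unitary u v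

theorem rot_mul {n : ℕ} (u w : unitaryGroup (Fin n) ℂ) (v : E n) :
    rot (u * w) v = rot u (rot w v) := by
  apply toComplex_injective
  simp only [toComplex_rot, mulVec_mulVec]
  rfl

theorem rot_one {n : ℕ} (v : E n) : rot (1 : unitaryGroup (Fin n) ℂ) v = v := by
  apply toComplex_injective
  rw [toComplex_rot]
  simp

theorem rot_symm {n : ℕ} (u : unitaryGroup (Fin n) ℂ) (v : E n) :
    (rot u).symm v = rot u⁻¹ v := by
  rw [LinearIsometryEquiv.symm_apply_eq, ← rot_mul, mul_inv_cancel, rot_one]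

/-- The normalized vector extends to a unitary basis of `ℂⁿ`; the matrix with these columns carries
the `i`-th basis vector to it. -/
theorem exists_rot_single {n : ℕ} (i : Fin n) (v : E n) :
    ∃ u, rot u (‖v‖ • EuclideanSpace.single (Sum.inr i) 1) = v := by
  rcases eq_or_ne v 0 with rfl | hv
  · exact ⟨1, by simp⟩
  let z : EuclideanSpace ℂ (Fin n) := WithLp.toLp 2 (toComplex (‖v‖⁻¹ • v))
  have hz : ‖z‖ = 1 := by
    have h : inner ℂ z z = 1 := by
      rw [EuclideanSpace.inner_eq_star_dotProduct, dotProduct_comm, star_dotProduct_toComplex,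
        norm_smul, norm_inv, norm_norm, inv_mul_cancel₀ (norm_ne_zero_iff.2 hv)]
      simp
    rw [inner_self_eq_norm_sq_to_K] at h
    have h' : ‖z‖ ^ 2 = 1 := Complex.ofReal_injective (by simpa using h)
    exact (pow_eq_one_iff_of_nonneg (norm_nonneg _) two_ne_zero).1 h'
  have ho : Orthonormal ℂ (({i} : Set (Fin n)).domRestrict fun _ => z) :=
    ⟨fun _ => hz, fun a b hab => (hab (Subsingleton.elim a b)).elim⟩
  obtain ⟨b, hb⟩ := ho.exists_orthonormalBasis_extension_of_card_eq (by simp)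
  let u : unitaryGroup (Fin n) ℂ := ⟨(EuclideanSpace.basisFun (Fin n) ℂ).toBasis.toMatrix b,
    (EuclideanSpace.basisFun (Fin n) ℂ).toMatrix_orthonormalBasis_mem_unitary b⟩
  refine ⟨u, ?_⟩
  have h1 : rot u (EuclideanSpace.single (Sum.inr i) 1) = ‖v‖⁻¹ • v := by
    apply toComplex_injective
    rw [toComplex_rot]
    have h2 : toComplex (EuclideanSpace.single (Sum.inr i) (1 : ℝ)) = Pi.single i 1 := by
      funext k
      apply Complex.ext <;> by_cases h : k = i <;> simp [toComplex, h]
    rw [h2, mulVec_single_one]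
    funext k
    change (EuclideanSpace.basisFun (Fin n) ℂ).toBasis.toMatrix b k i = z k
    rw [Module.Basis.toMatrix_apply, hb i rfl]
    simp
  rw [map_smul, h1, smul_inv_smul₀ (norm_ne_zero_iff.2 hv)]

/-- Transitivity on spheres, which makes averages over the unitary group radial. -/
theorem exists_rot_eq {n : ℕ} {v w : E n} (h : ‖v‖ = ‖w‖) : ∃ u, rot u v = w := by
  rcases isEmpty_or_nonempty (Fin n) with hn | ⟨⟨i⟩⟩
  · exact ⟨1, Subsingleton.elim _ _⟩
  obtain ⟨u₁, h₁⟩ := exists_rot_single i v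
  obtain ⟨u₂, h₂⟩ := exists_rot_single i w
  refine ⟨u₂ * u₁⁻¹, ?_⟩
  rw [rot_mul, ← rot_symm, ← h₂, ← h, ← (rot u₁).symm_apply_eq.2 h₁.symm]

/-! ### The splitting `ℝ²ⁿ = ℝⁿ ⊕ ℝⁿ`. -/

/-- The vector `(x, y)` of `ℝⁿ ⊕ ℝⁿ`. -/
def join {n : ℕ} (x y : EuclideanSpace ℝ (Fin n)) : E n :=
  WithLp.toLp 2 (Sum.elim x.ofLp y.ofLp)

/-- The component `x` of `(x, y)`. -/
def fstPart {n : ℕ} : E n →L[ℝ] EuclideanSpace ℝ (Fin n) := LinearMap.toContinuousLinearMap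
  { toFun := fun v => WithLp.toLp 2 (v.ofLp ∘ Sum.inl)
    map_add' := fun _ _ => rfl
    map_smul' := fun _ _ => rfl }

/-- The component `y` of `(x, y)`. -/
def sndPart {n : ℕ} : E n →L[ℝ] EuclideanSpace ℝ (Fin n) := LinearMap.toContinuousLinearMap
  { toFun := fun v => WithLp.toLp 2 (v.ofLp ∘ Sum.inr)
    map_add' := fun _ _ => rfl
    map_smul' := fun _ _ => rfl }

theorem fstPart_join {n : ℕ} (x y : EuclideanSpace ℝ (Fin n)) : fstPart (join x y) = x := rfl

theorem sndPart_join {n : ℕ} (x y : EuclideanSpace ℝ (Fin n)) : sndPart (join x y) = y := rfl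

theorem join_fst_snd {n : ℕ} (v : E n) : join (fstPart v) (sndPart v) = v := by
  ext k
  rcases k with k | k <;> rfl

theorem join_add {n : ℕ} (x y x' y' : EuclideanSpace ℝ (Fin n)) :
    join x y + join x' y' = join (x + x') (y + y') := by
  ext k
  rcases k with k | k <;> rfl

theorem norm_join_sq {n : ℕ} (x y : EuclideanSpace ℝ (Fin n)) :
    ‖join x y‖ ^ 2 = ‖x‖ ^ 2 + ‖y‖ ^ 2 := by
  simp [EuclideanSpace.norm_sq_eq, join, Fintype.sum_sum_type]

theorem norm_fst_le_join {n : ℕ} (x y : EuclideanSpace ℝ (Fin n)) : ‖x‖ ≤ ‖join x y‖ :=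
  abs_le_of_sq_le_sq' (by rw [norm_join_sq]; nlinarith [sq_nonneg ‖y‖]) (norm_nonneg _) |>.2

theorem norm_snd_le_join {n : ℕ} (x y : EuclideanSpace ℝ (Fin n)) : ‖y‖ ≤ ‖join x y‖ :=
  abs_le_of_sq_le_sq' (by rw [norm_join_sq]; nlinarith [sq_nonneg ‖x‖]) (norm_nonneg _) |>.2

theorem norm_join_zero {n : ℕ} (x : EuclideanSpace ℝ (Fin n)) : ‖join x 0‖ = ‖x‖ := by
  have h := norm_join_sq x 0
  rw [norm_zero, zero_pow two_ne_zero, add_zero] at h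
  exact (pow_left_inj₀ (norm_nonneg _) (norm_nonneg _) two_ne_zero).1 h

theorem continuous_join {n : ℕ} :
    Continuous fun p : EuclideanSpace ℝ (Fin n) × EuclideanSpace ℝ (Fin n) => join p.1 p.2 := by
  refine (PiLp.continuous_toLp 2 _).comp (continuous_pi fun k => ?_)
  rcases k with k | k
  · exact (PiLp.continuous_apply 2 _ k).comp continuous_fst
  · exact (PiLp.continuous_apply 2 _ k).comp continuous_snd

theorem measurePreserving_join (n : ℕ) :
    MeasurePreserving
      fun p : EuclideanSpace ℝ (Fin n) × EuclideanSpace ℝ (Fin n) => join p.1 p.2 := by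
  have h1 := (EuclideanSpace.volume_preserving_symm_measurableEquiv_toLp (Fin n)).prod
    (EuclideanSpace.volume_preserving_symm_measurableEquiv_toLp (Fin n))
  have h2 := (volume_measurePreserving_sumPiEquivProdPi (fun _ : Fin n ⊕ Fin n => ℝ)).symm
  exact ((EuclideanSpace.volume_preserving_symm_measurableEquiv_toLp
    (Fin n ⊕ Fin n)).symm.comp h2).comp h1

/-! ### Unitary parametrization of the affine Lagrangian subspaces. -/

/-- In the coordinates `y + i x` the Hermitian product has the inner product as real part and the
symplectic form as imaginary part. On a Lagrangian subspace the latter vanishes, so a real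
orthonormal basis is automatically a unitary one. -/
theorem exists_rot_of_lagrangian {n : ℕ} {V : Submodule ℝ (E n)} (hV : IsLagrangian V) :
    ∃ u : unitaryGroup (Fin n) ℂ, ∀ y, rot u (join 0 y) ∈ V := by
  have e := (stdOrthonormalBasis ℝ V).reindex (finCongr hV.2)
  have he : ∀ i j, ∑ k, ((e i : E n) (Sum.inl k) * (e j : E n) (Sum.inl k) +
      (e i : E n) (Sum.inr k) * (e j : E n) (Sum.inr k)) = if i = j then 1 else 0 := by
    intro i j
    have h := orthonormal_iff_ite.1 e.orthonormal i j
    rw [Submodule.coe_inner, PiLp.inner_apply, Fintype.sum_sum_type, ← Finset.sum_add_distrib] at h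
    rw [← h]
    simp [mul_comm]
  have hJ : ∀ i j, ∑ k, ((e i : E n) (Sum.inr k) * (e j : E n) (Sum.inl k) -
      (e i : E n) (Sum.inl k) * (e j : E n) (Sum.inr k)) = 0 := by
    intro i j
    have h := hV.1 _ (e i).2 _ (e j).2
    simp only [J, fromBlocks_mulVec, dotProduct, Fintype.sum_sum_type] at h
    rw [← h, ← Finset.sum_add_distrib]
    refine Finset.sum_congr rfl fun k _ => ?_
    simp [neg_mulVec]
    ring
  let g : Matrix (Fin n) (Fin n) ℂ := Matrix.of fun k j => toComplex (e j : E n) k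
  have hg : g ∈ unitaryGroup (Fin n) ℂ := by
    rw [mem_unitaryGroup_iff']
    ext i j
    rw [star_eq_conjTranspose, mul_apply]
    apply Complex.ext
    · rw [Complex.re_sum, one_apply]
      transitivity (if i = j then (1 : ℝ) else 0)
      · rw [← he]
        refine Finset.sum_congr rfl fun k _ => ?_
        simp [g, toComplex]
        ring
      · split_ifs <;> simp
    · rw [Complex.im_sum, one_apply]
      transitivity (0 : ℝ)
      · rw [← hJ i j]
        refine Finset.sum_congr rfl fun k _ => ?_
        simp [g, toComplex]
        ring
      · split_ifs <;> simp
  refine ⟨⟨g, hg⟩, fun y => ?_⟩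
  have : rot ⟨g, hg⟩ (join 0 y) = ∑ j, y j • (e j : E n) := by
    apply toComplex_injective
    rw [toComplex_rot]
    funext k
    apply Complex.ext <;> simp [toComplex, g, mulVec, dotProduct, join, mul_comm]
  rw [this]
  exact Submodule.sum_mem _ fun j _ => Submodule.smul_mem _ _ (e j).2

theorem mem_chart_unitary {n : ℕ} (u : unitaryGroup (Fin n) ℂ) (τ : EuclideanSpace ℝ (Fin n))
    (v : E n) : v ∈ (chart (unitaryToSymplectic u) 0 τ).carrier ↔ ∃ y, rot u (join τ y) = v := by
  rw [chart, mem_act]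
  constructor
  · rintro ⟨w, hw, rfl⟩
    rw [mem_graph, symMat_zero, zero_mulVec, zero_add] at hw
    refine ⟨sndPart w, ?_⟩
    rw [add_zero, rot_apply, ← join_fst_snd w]
    congr 2
    exact congrArg (WithLp.toLp 2) hw.symm
  · rintro ⟨y, rfl⟩
    refine ⟨join τ y, ?_, add_zero _⟩
    rw [mem_graph, symMat_zero, zero_mulVec, zero_add]
    rfl

/-- A translation along the subspace does not change it, so only the component of `u⁻¹ c`
transversal to `0 ⊕ ℝⁿ` survives. -/
theorem act_unitary_eq_chart {n : ℕ} (u : unitaryGroup (Fin n) ℂ) (c : E n) :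
    act (unitaryToSymplectic u) c (baseAL n) =
      chart (unitaryToSymplectic u) 0 (fstPart ((rot u).symm c)) := by
  obtain ⟨d, rfl⟩ := (rot u).surjective c
  rw [LinearIsometryEquiv.symm_apply_apply]
  ext v
  rw [mem_chart_unitary, mem_act]
  constructor
  · rintro ⟨w, hw, rfl⟩
    rw [baseAL, mem_graph, symMat_zero, zero_mulVec, zero_add] at hw
    refine ⟨sndPart w + sndPart d, ?_⟩
    have hw' : fstPart w = 0 := congrArg (WithLp.toLp 2) hw
    have h : join (fstPart d) (sndPart w + sndPart d) = w + d := by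
      conv_rhs => rw [← join_fst_snd w, ← join_fst_snd d, join_add, hw', zero_add]
    rw [h, map_add, rot_apply]
  · rintro ⟨y, rfl⟩
    refine ⟨join 0 (y - sndPart d), ?_, ?_⟩
    · rw [baseAL, mem_graph, symMat_zero, zero_mulVec, zero_add]
      rfl
    · have h : join 0 (y - sndPart d) + d = join (fstPart d) y := by
        conv_lhs => rw [← join_fst_snd d, join_add, zero_add, sndPart_join, sub_add_cancel]
      rw [← rot_apply, ← map_add, h]

theorem exists_act_unitary {n : ℕ} (L : AL n) :
    ∃ u c, L = act (unitaryToSymplectic u) c (baseAL n) := by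
  obtain ⟨u, hu⟩ := exists_rot_of_lagrangian L.lagrangian
  obtain ⟨p, hp⟩ := L.nonempty
  refine ⟨u, p, ?_⟩
  -- Both directions have dimension `n`, so one inclusion is enough.
  have hdir : (act (unitaryToSymplectic u) p (baseAL n)).carrier.direction =
      L.carrier.direction := by
    refine Submodule.eq_of_le_of_finrank_eq ?_
      ((act (unitaryToSymplectic u) p (baseAL n)).lagrangian.2.trans L.lagrangian.2.symm)
    change ((baseAL n).carrier.map (affMap (unitaryToSymplectic u).1 p)).direction ≤ _
    rw [AffineSubspace.map_direction, Submodule.map_le_iff_le_comap]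
    intro v hv
    change v ∈ ((⊤ : AffineSubspace ℝ (EuclideanSpace ℝ (Fin n))).map
      (graphMap 0 0)).direction at hv
    rw [AffineSubspace.map_direction] at hv
    obtain ⟨y, -, rfl⟩ := hv
    have := hu y
    simpa [graphMap, symMat_zero, affMap, rot_apply, join] using this
  ext1
  refine (AffineSubspace.ext_of_direction_eq hdir ⟨p, ?_, hp⟩).symm
  refine (mem_act _ _ _ _).2 ⟨0, (mem_graph _ _ _).2 ?_, by simp⟩
  funext i
  simp

theorem exists_chart_unitary {n : ℕ} (L : AL n) :
    ∃ u τ, L = chart (unitaryToSymplectic u) 0 τ := by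
  obtain ⟨u, c, rfl⟩ := exists_act_unitary L
  exact ⟨u, _, act_unitary_eq_chart u c⟩

/-- By Pythagoras the nearest point is `u (τ, 0)`. The weight `(1 + d(0, L))^M` thus becomes `(1 +
‖τ‖)^M`. -/
theorem infDist_chart_unitary {n : ℕ} (u : unitaryGroup (Fin n) ℂ)
    (τ : EuclideanSpace ℝ (Fin n)) :
    Metric.infDist 0 ((chart (unitaryToSymplectic u) 0 τ).carrier : Set (E n)) = ‖τ‖ := by
  have hmem : rot u (join τ 0) ∈ ((chart (unitaryToSymplectic u) 0 τ).carrier : Set (E n)) :=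
    (mem_chart_unitary u τ _).2 ⟨0, rfl⟩
  apply le_antisymm
  · refine (Metric.infDist_le_dist_of_mem hmem).trans ?_
    rw [dist_zero_left, LinearIsometryEquiv.norm_map, norm_join_zero]
  · refine (Metric.le_infDist ⟨_, hmem⟩).2 ?_
    intro v hv
    obtain ⟨y, rfl⟩ := (mem_chart_unitary u τ v).1 hv
    rw [dist_zero_left, LinearIsometryEquiv.norm_map]
    exact norm_fst_le_join τ y

/-! ### Continuity for the homogeneous-space topology. -/

theorem continuous_unitaryToSymplectic {n : ℕ} :
    Continuous fun u : unitaryGroup (Fin n) ℂ => (unitaryToSymplectic u).1 := by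
  have h1 : Continuous fun u : unitaryGroup (Fin n) ℂ => u.1.map Complex.re :=
    continuous_subtype_val.matrix_map Complex.continuous_re
  have h2 : Continuous fun u : unitaryGroup (Fin n) ℂ => u.1.map Complex.im :=
    continuous_subtype_val.matrix_map Complex.continuous_im
  exact h1.matrix_fromBlocks h2 h2.neg h1

theorem continuous_toEuclideanLin {n : ℕ} {X : Type*} [TopologicalSpace X]
    {a : X → Matrix (Fin n ⊕ Fin n) (Fin n ⊕ Fin n) ℝ} {v : X → E n} (ha : Continuous a)
    (hv : Continuous v) : Continuous fun p => toEuclideanLin (a p) (v p) :=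
  (PiLp.continuous_toLp 2 _).comp (ha.matrix_mulVec ((PiLp.continuous_ofLp 2 _).comp hv))

theorem continuous_rot {n : ℕ} {X : Type*} [TopologicalSpace X]
    {u : X → unitaryGroup (Fin n) ℂ} {v : X → E n} (hu : Continuous u)
    (hv : Continuous v) : Continuous fun p => rot (u p) (v p) :=
  continuous_toEuclideanLin (continuous_unitaryToSymplectic.comp hu) hv

theorem continuous_act_unitary_uncurry {n : ℕ} :
    Continuous fun p : unitaryGroup (Fin n) ℂ × E n =>
      act (unitaryToSymplectic p.1) p.2 (baseAL n) := continuous_coinduced_rng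

theorem continuous_act_unitary {n : ℕ} {X : Type*} [TopologicalSpace X]
    {u : X → unitaryGroup (Fin n) ℂ} {v : X → E n} (hu : Continuous u) (hv : Continuous v) :
    Continuous fun p => act (unitaryToSymplectic (u p)) (v p) (baseAL n) := by
  have h := Continuous.comp continuous_act_unitary_uncurry (hu.prodMk hv)
  exact h

theorem chart_unitary_eq_act {n : ℕ} (u : unitaryGroup (Fin n) ℂ)
    (τ : EuclideanSpace ℝ (Fin n)) : chart (unitaryToSymplectic u) 0 τ =
      act (unitaryToSymplectic u) (rot u (join τ 0)) (baseAL n) := by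
  have h := act_unitary_eq_chart u (rot u (join τ 0))
  rw [LinearIsometryEquiv.symm_apply_apply, fstPart_join] at h
  exact h.symm

theorem continuous_chart_unitary {n : ℕ} :
    Continuous fun p : unitaryGroup (Fin n) ℂ × EuclideanSpace ℝ (Fin n) =>
      chart (unitaryToSymplectic p.1) 0 p.2 := by
  have h1 : Continuous fun p : unitaryGroup (Fin n) ℂ × EuclideanSpace ℝ (Fin n) =>
      join p.2 0 :=
    continuous_join.comp (continuous_snd.prodMk continuous_const)
  have h2 := continuous_act_unitary continuous_fst (continuous_rot continuous_fst h1)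
  refine h2.congr fun p => ?_
  exact (chart_unitary_eq_act p.1 p.2).symm

theorem act_eq_act_inv {n : ℕ} (g h : symplecticGroup (Fin n) ℝ) (c : E n) (L : AL n) :
    act h c L = act g 0 (act (g⁻¹ * h)
      (toEuclideanLin (g⁻¹ : symplecticGroup (Fin n) ℝ).1 c) L) := by
  rw [act_act, mul_inv_cancel_left, add_zero]
  congr 1
  ext i
  have : g.1 * (g⁻¹ : symplecticGroup (Fin n) ℝ).1 = 1 :=
    congrArg Subtype.val (mul_inv_cancel g)
  rw [toEuclideanLin_ofLp, toEuclideanLin_ofLp, mulVec_mulVec, this, one_mulVec]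

theorem continuousAt_matrix_inv {X : Type*} [TopologicalSpace X] {m : Type*} [Fintype m]
    [DecidableEq m] {d : X → Matrix m m ℝ} (hd : Continuous d) {x : X} (hx : (d x).det ≠ 0) :
    ContinuousAt (fun p => (d p)⁻¹) x := by
  have h1 : ContinuousAt (fun p => (d p).det⁻¹ • (d p).adjugate) x :=
    (hd.matrix_det.continuousAt.inv₀ hx).smul hd.matrix_adjugate.continuousAt
  refine h1.congr (Filter.Eventually.of_forall fun p => ?_)
  simp only [Matrix.inv_def, Ring.inverse_eq_inv']

theorem continuousAt_matrix_mul {X : Type*} [TopologicalSpace X] {m : Type*} [Fintype m]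
    {a b : X → Matrix m m ℝ} {x : X} (ha : ContinuousAt a x) (hb : ContinuousAt b x) :
    ContinuousAt (fun p => a p * b p) x :=
  (continuous_fst.matrix_mul continuous_snd : Continuous
    fun q : Matrix m m ℝ × Matrix m m ℝ => q.1 * q.2).continuousAt.comp (ha.prodMk hb)

theorem continuousAt_mulVec {X : Type*} [TopologicalSpace X] {m : Type*} [Fintype m]
    {a : X → Matrix m m ℝ} {v : X → m → ℝ} {x : X} (ha : ContinuousAt a x)
    (hv : ContinuousAt v x) : ContinuousAt (fun p => a p *ᵥ v p) x :=
  (continuous_fst.matrix_mulVec continuous_snd : Continuous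
    fun q : Matrix m m ℝ × (m → ℝ) => q.1 *ᵥ q.2).continuousAt.comp (ha.prodMk hv)

theorem continuous_symCoord {n : ℕ} : Continuous (symCoord (n := n)) := by
  refine continuous_pi fun z => ?_
  induction z with
  | _ i j =>
    exact ((continuous_id.matrix_elem i j).add (continuous_id.matrix_elem j i)).div_const 2

/-- In a chart, a continuous family of affine symplectic maps close to the identity moves the
base point continuously. -/
theorem exists_local_act {n : ℕ} {X : Type*} [TopologicalSpace X]
    {h : X → symplecticGroup (Fin n) ℝ} {r : X → E n} (hh : Continuous fun p => (h p).1)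
    (hr : Continuous r) {x : X} (hx : h x = 1) :
    ∃ Φ : X → (Sym2 (Fin n) → ℝ) × EuclideanSpace ℝ (Fin n), ContinuousAt Φ x ∧
      ∀ᶠ p in nhds x, act (h p) (r p) (baseAL n) = graph (Φ p).1 (Φ p).2 := by
  let a : X → Matrix (Fin n) (Fin n) ℝ := fun p => (h p).1.toBlocks₁₁
  let b : X → Matrix (Fin n) (Fin n) ℝ := fun p => (h p).1.toBlocks₁₂
  let c : X → Matrix (Fin n) (Fin n) ℝ := fun p => (h p).1.toBlocks₂₁
  let d : X → Matrix (Fin n) (Fin n) ℝ := fun p => (h p).1.toBlocks₂₂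
  have hb : Continuous b := continuous_matrix fun i j => hh.matrix_elem _ _
  have hd : Continuous d := continuous_matrix fun i j => hh.matrix_elem _ _
  have hd0 : (d x).det ≠ 0 := by
    have h0 : (h x).1 = fromBlocks 1 0 0 1 := by
      simp [hx, fromBlocks_one]
    simp only [d]
    rw [h0, toBlocks_fromBlocks₂₂]
    simp
  have hS : ContinuousAt (fun p => b p * (d p)⁻¹) x :=
    continuousAt_matrix_mul hb.continuousAt (continuousAt_matrix_inv hd hd0)
  have hr1 : Continuous fun p => (r p).ofLp ∘ Sum.inl :=
    continuous_pi fun i => (PiLp.continuous_apply 2 _ _).comp hr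
  have hr2 : Continuous fun p => (r p).ofLp ∘ Sum.inr :=
    continuous_pi fun i => (PiLp.continuous_apply 2 _ _).comp hr
  refine ⟨fun p => (symCoord (b p * (d p)⁻¹), WithLp.toLp 2
    ((r p).ofLp ∘ Sum.inl - (b p * (d p)⁻¹) *ᵥ ((r p).ofLp ∘ Sum.inr))), ?_, ?_⟩
  · exact (continuous_symCoord.continuousAt.comp hS).prodMk
      ((PiLp.continuous_toLp 2 _).continuousAt.comp
        (hr1.continuousAt.sub (continuousAt_mulVec hS hr2.continuousAt)))
  · filter_upwards [hd.matrix_det.continuousAt.eventually_ne hd0] with p hp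
    -- The base point has chart coordinate `T = 0`, so only the lower right block has to be
    -- invertible, and it is the identity at `x`. The translation part may be arbitrary.
    have hp' : IsUnit (c p * symMat 0 + d p).det := by
      rw [symMat_zero, Matrix.mul_zero, zero_add]
      exact isUnit_iff_ne_zero.2 hp
    rw [baseAL, act_graph (a p) (b p) (c p) (d p) (h p) (fromBlocks_toBlocks _).symm _ _ _ hp',
      symMat_zero, Matrix.mul_zero, Matrix.mul_zero, zero_add, zero_add]
    congr 2
    simp

/-- Smooth functions are continuous for the homogeneous-space topology. -/
theorem IsSmooth.continuous {n : ℕ} {f : AL n → ℂ} (hf : IsSmooth f) : Continuous f := by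
  refine continuous_coinduced_dom.2 (continuous_iff_continuousAt.2 ?_)
  rintro ⟨u₀, c₀⟩
  -- The chart is centred at `u₀`: relative to `g` the linear part equals the identity at the point
  -- in question.
  let g := unitaryToSymplectic u₀
  have hh : Continuous fun p : unitaryGroup (Fin n) ℂ × E n =>
      (g⁻¹ * unitaryToSymplectic p.1 : symplecticGroup (Fin n) ℝ).1 := by
    have h1 : Continuous fun p : unitaryGroup (Fin n) ℂ × E n => (unitaryToSymplectic p.1).1 :=
      continuous_unitaryToSymplectic.comp continuous_fst
    exact (continuous_const (y := (g⁻¹ : symplecticGroup (Fin n) ℝ).1)).matrix_mul h1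
  have hr : Continuous fun p : unitaryGroup (Fin n) ℂ × E n =>
      toEuclideanLin (g⁻¹ : symplecticGroup (Fin n) ℝ).1 p.2 :=
    continuous_toEuclideanLin continuous_const continuous_snd
  obtain ⟨Φ, hΦ, hev⟩ := exists_local_act hh hr (x := (u₀, c₀)) (inv_mul_cancel g)
  have h1 : ContinuousAt (fun p => f (chart g (Φ p).1 (Φ p).2)) (u₀, c₀) :=
    ContinuousAt.comp (g := fun p : (Sym2 (Fin n) → ℝ) × EuclideanSpace ℝ (Fin n) =>
      f (chart g p.1 p.2)) (hf g).continuous.continuousAt hΦ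
  refine h1.congr ?_
  filter_upwards [hev] with p hp
  have h2 := act_eq_act_inv g (unitaryToSymplectic p.1) p.2 (baseAL n)
  rw [hp] at h2
  exact congrArg f h2.symm

/-! ### Haar measure and integrals over the Grassmannian. -/

instance (n : ℕ) : SecondCountableTopology (unitaryGroup (Fin n) ℂ) := by
  have : SecondCountableTopology (Matrix (Fin n) (Fin n) ℂ) :=
    inferInstanceAs (SecondCountableTopology (Fin n → Fin n → ℂ))
  exact inferInstanceAs (SecondCountableTopology
    (unitaryGroup (Fin n) ℂ : Set (Matrix (Fin n) (Fin n) ℂ)))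

instance (n : ℕ) : (haarU n).IsHaarMeasure := by unfold haarU; infer_instance

instance (n : ℕ) : IsProbabilityMeasure (haarU n) :=
  ⟨by simpa [haarU] using Measure.haarMeasure_self (K₀ := (⊤ : TopologicalSpace.PositiveCompacts
    (unitaryGroup (Fin n) ℂ)))⟩

theorem measurable_act_unitary {n : ℕ} (x : E n) :
    Measurable fun u : unitaryGroup (Fin n) ℂ => act (unitaryToSymplectic u) x (baseAL n) :=
  (continuous_act_unitary continuous_id continuous_const).measurable

theorem measurable_chart_unitary {n : ℕ} :
    Measurable fun p : unitaryGroup (Fin n) ℂ × EuclideanSpace ℝ (Fin n) =>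
      chart (unitaryToSymplectic p.1) 0 p.2 := continuous_chart_unitary.measurable

instance {n : ℕ} (x : E n) : IsProbabilityMeasure (sigma x) :=
  Measure.isProbabilityMeasure_map (measurable_act_unitary x).aemeasurable

theorem backProj_eq_integral {n : ℕ} {φ : AL n → ℂ} (hφ : Continuous φ) (x : E n) :
    backProj φ x = ∫ u, φ (act (unitaryToSymplectic u) x (baseAL n)) ∂(haarU n) :=
  integral_map (measurable_act_unitary x).aemeasurable hφ.aestronglyMeasurable

theorem integral_measureAL {n : ℕ} {φ : AL n → ℂ} (hφ : Continuous φ) :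
    ∫ L, φ L ∂(measureAL n) = ∫ p, φ (chart (unitaryToSymplectic p.1) 0 p.2)
      ∂((haarU n).prod (volume : Measure (EuclideanSpace ℝ (Fin n)))) :=
  integral_map measurable_chart_unitary.aemeasurable hφ.aestronglyMeasurable

theorem integrable_measureAL {n : ℕ} {φ : AL n → ℂ} (hφ : Continuous φ) :
    Integrable φ (measureAL n) ↔ Integrable
      (fun p : unitaryGroup (Fin n) ℂ × EuclideanSpace ℝ (Fin n) =>
        φ (chart (unitaryToSymplectic p.1) 0 p.2)) ((haarU n).prod volume) :=
  integrable_map_measure hφ.aestronglyMeasurable measurable_chart_unitary.aemeasurable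

/-! ### Differentiation under the integral sign and bounds for Schwartz functions. -/

/-- A family of functions closed under partial derivatives consists of smooth functions. -/
theorem contDiff_of_hasFDerivAt_family {S ι P : Type*} [Fintype ι] [NormedAddCommGroup P]
    [NormedSpace ℝ P] (F : S → P → ℂ) (D : ι → S → S) (ℓ : ι → P →L[ℝ] ℝ)
    (h : ∀ s p, HasFDerivAt (F s) (∑ j, (ℓ j).smulRight (F (D j s) p)) p) (s : S) :
    ContDiff ℝ ∞ (F s) := by
  refine contDiff_infty.2 fun k => ?_
  -- The order is raised for all members of the family at once, because the derivative of one member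
  -- involves the others.
  induction k generalizing s with
  | zero =>
    exact contDiff_zero.2 (continuous_iff_continuousAt.2 fun p => (h s p).continuousAt)
  | succ k ih =>
    have hd : fderiv ℝ (F s) = fun p => ∑ j, (ℓ j).smulRight (F (D j s) p) :=
      funext fun p => (h s p).fderiv
    rw [Nat.cast_add, Nat.cast_one, contDiff_succ_iff_fderiv]
    refine ⟨fun p => (h s p).differentiableAt, by simp, ?_⟩
    rw [hd]
    exact ContDiff.sum fun j _ => contDiff_const.smulRight (ih (D j s))

/-- Differentiation under the integral sign, in coordinates. -/
theorem hasFDerivAt_integral_sum {ι P Ω : Type*} [Fintype ι] [NormedAddCommGroup P]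
    [NormedSpace ℝ P] [MeasurableSpace Ω] {μ : Measure Ω} {g : P → Ω → ℂ} {g' : ι → P → Ω → ℂ}
    {ℓ : ι → P →L[ℝ] ℝ} {bound : ι → Ω → ℝ} (hb : ∀ j, Integrable (bound j) μ)
    (hg : ∀ p, Integrable (g p) μ) (hm : ∀ j p, AEStronglyMeasurable (g' j p) μ)
    (hle : ∀ j p z, ‖g' j p z‖ ≤ bound j z)
    (hd : ∀ p z, HasFDerivAt (fun q => g q z) (∑ j, (ℓ j).smulRight (g' j p z)) p) (p : P) :
    HasFDerivAt (fun q => ∫ z, g q z ∂μ) (∑ j, (ℓ j).smulRight (∫ z, g' j p z ∂μ)) p := by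
  have hi : ∀ j, Integrable (g' j p) μ := fun j =>
    (hb j).mono' (hm j p) (Filter.Eventually.of_forall (hle j p))
  have hΛ : ∀ j, Integrable (fun z => (ℓ j).smulRight (g' j p z)) μ := fun j =>
    (ContinuousLinearMap.smulRightL ℝ P ℂ (ℓ j)).integrable_comp (hi j)
  have hΛ' : ∀ j, ∫ z, (ℓ j).smulRight (g' j p z) ∂μ = (ℓ j).smulRight (∫ z, g' j p z ∂μ) :=
    fun j => (ContinuousLinearMap.smulRightL ℝ P ℂ (ℓ j)).integral_comp_comm (hi j)
  have hle' : ∀ z q, ‖∑ j, (ℓ j).smulRight (g' j q z)‖ ≤ ∑ j, ‖ℓ j‖ * bound j z :=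
    fun z q => (norm_sum_le _ _).trans (Finset.sum_le_sum fun j _ => by
      rw [ContinuousLinearMap.norm_smulRight_apply]
      exact mul_le_mul_of_nonneg_left (hle j q z) (norm_nonneg _))
  have hb' : Integrable (fun z => ∑ j, ‖ℓ j‖ * bound j z) μ :=
    integrable_finsetSum _ fun j _ => (hb j).const_mul _
  have hi' : Integrable (fun z => ∑ j, (ℓ j).smulRight (g' j p z)) μ :=
    integrable_finsetSum (f := fun j z => (ℓ j).smulRight (g' j p z)) Finset.univ fun j _ => hΛ j
  have h := hasFDerivAt_integral_of_dominated_of_fderiv_le (μ := μ) (F := g) (x₀ := p)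
    (F' := fun q z => ∑ j, (ℓ j).smulRight (g' j q z)) (s := Set.univ)
    (bound := fun z => ∑ j, ‖ℓ j‖ * bound j z) Filter.univ_mem
    (Filter.Eventually.of_forall fun q => (hg q).aestronglyMeasurable) (hg p)
    hi'.aestronglyMeasurable
    (Filter.Eventually.of_forall fun z q _ => hle' z q) hb'
    (Filter.Eventually.of_forall fun z q _ => hd q z)
  refine h.congr_fderiv ?_
  rw [integral_finsetSum _ fun j _ => hΛ j]
  exact Finset.sum_congr rfl fun j _ => hΛ' j

theorem integrable_inv_one_add_norm_pow (n : ℕ) :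
    Integrable fun y : EuclideanSpace ℝ (Fin n) => ((1 + ‖y‖) ^ (n + 1))⁻¹ := by
  have h := integrable_one_add_norm (E := EuclideanSpace ℝ (Fin n)) (μ := volume)
    (r := ((n + 1 : ℕ) : ℝ)) (by simp)
  refine h.congr (Filter.Eventually.of_forall fun y => ?_)
  simp only
  rw [Real.rpow_neg (by positivity), Real.rpow_natCast]

theorem exists_schwartz_bound {V W : Type*} [NormedAddCommGroup V] [NormedSpace ℝ V]
    [NormedAddCommGroup W] [NormedSpace ℝ W] (f : 𝓢(V, W)) (k : ℕ) :
    ∃ C, 0 ≤ C ∧ ∀ v, ‖f v‖ ≤ C * ((1 + ‖v‖) ^ k)⁻¹ := by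
  obtain ⟨C, hC⟩ : ∃ C, ∀ v, (1 + ‖v‖) ^ k * ‖f v‖ ≤ C := ⟨_, fun v => by
    have h := SchwartzMap.one_add_le_sup_seminorm_apply (𝕜 := ℝ) (m := (k, 0)) le_rfl le_rfl f v
    rwa [norm_iteratedFDeriv_zero] at h⟩
  refine ⟨C, le_trans (by positivity) (hC 0), fun v => ?_⟩
  rw [le_mul_inv_iff₀ (by positivity), mul_comm]
  exact hC v

/-! ### Smoothness of the integral over a graph in the chart coordinates. -/

/-- The derivative of a Schwartz function along the affine vector field `v ↦ A v + b`. -/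
def fieldDeriv {n : ℕ} (A : E n →L[ℝ] E n) (b : E n) (f : 𝓢(E n, ℂ)) : 𝓢(E n, ℂ) :=
  SchwartzMap.bilinLeftCLM (ContinuousLinearMap.id ℝ (E n →L[ℝ] ℂ))
    (show (fun v => A v + b).HasTemperateGrowth by fun_prop) (SchwartzMap.fderivCLM ℝ (E n) ℂ f)

theorem fieldDeriv_apply {n : ℕ} (A : E n →L[ℝ] E n) (b : E n) (f : 𝓢(E n, ℂ)) (v : E n) :
    fieldDeriv A b f v = fderiv ℝ f v (A v + b) := rfl

/-- The chart coordinates. -/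
abbrev Coord (n : ℕ) : Type := (Sym2 (Fin n) → ℝ) × EuclideanSpace ℝ (Fin n)

/-- The vector field `(x, y) ↦ (T y, 0)`. -/
def coordField {n : ℕ} (p : Coord n) : E n →L[ℝ] E n :=
  LinearMap.toContinuousLinearMap
    { toFun := fun v => join (WithLp.toLp 2 (symMat p.1 *ᵥ (sndPart v).ofLp)) 0
      map_add' := fun v w => by
        rw [map_add, WithLp.ofLp_add, mulVec_add, WithLp.toLp_add, join_add, add_zero]
      map_smul' := fun a v => by
        ext k
        rcases k with k | k <;> simp [join, mulVec_smul] }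

theorem coordField_apply {n : ℕ} (p : Coord n) (v : E n) :
    coordField p v = join (WithLp.toLp 2 (symMat p.1 *ᵥ (sndPart v).ofLp)) 0 := rfl

/-- The derivative of `p ↦ graphMap p.1 p.2 y`. -/
def graphDeriv {n : ℕ} (y : EuclideanSpace ℝ (Fin n)) : Coord n →L[ℝ] E n :=
  LinearMap.toContinuousLinearMap
    { toFun := fun p => join (WithLp.toLp 2 (symMat p.1 *ᵥ y.ofLp) + p.2) 0
      map_add' := fun p q => by
        have h : symMat (p.1 + q.1) = symMat p.1 + symMat q.1 := rfl
        ext k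
        rcases k with k | k
        · simp [join, h, add_mulVec]; ring
        · simp [join]
      map_smul' := fun a p => by
        have h : symMat (a • p.1) = a • symMat p.1 := rfl
        ext k
        rcases k with k | k <;> simp [join, h, smul_mulVec, mul_add] }

theorem graphMap_eq {n : ℕ} (p : Coord n) (y : EuclideanSpace ℝ (Fin n)) :
    graphMap p.1 p.2 y = graphDeriv y p + join 0 y := by
  ext k
  rcases k with k | k <;> simp [graphMap, graphDeriv, join]

/-- Moving the chart coordinates in direction `q` displaces each point of the graph by an affine
vector field on `ℝ²ⁿ` that does not depend on `p`. Differentiating the integral therefore amounts to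
applying this field to the Schwartz function. -/
theorem graphDeriv_eq {n : ℕ} (p q : Coord n) (y : EuclideanSpace ℝ (Fin n)) :
    graphDeriv y q = coordField q (graphMap p.1 p.2 y) + join q.2 0 := by
  rw [coordField_apply, join_add, add_zero]
  rfl

/-- Uniformity in `p` gives one integrable majorant for the whole chart. -/
theorem norm_le_graphMap {n : ℕ} (p : Coord n) (y : EuclideanSpace ℝ (Fin n)) :
    ‖y‖ ≤ ‖graphMap p.1 p.2 y‖ :=
  norm_snd_le_join (WithLp.toLp 2 (symMat p.1 *ᵥ y.ofLp + p.2.ofLp)) y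

theorem continuous_graphMap {n : ℕ} (p : Coord n) : Continuous (graphMap p.1 p.2) :=
  (graphMap p.1 p.2).continuous_of_finiteDimensional

/-- The integral of a Schwartz function over `x = T y + τ`, with respect to `dy`. -/
def graphInt {n : ℕ} (f : 𝓢(E n, ℂ)) (p : Coord n) : ℂ := ∫ y, f (graphMap p.1 p.2 y)

theorem exists_graphMap_bound {n : ℕ} (f : 𝓢(E n, ℂ)) :
    ∃ C, ∀ (p : Coord n) y, ‖f (graphMap p.1 p.2 y)‖ ≤ C * ((1 + ‖y‖) ^ (n + 1))⁻¹ := by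
  obtain ⟨C, hC, hf⟩ := exists_schwartz_bound f (n + 1)
  refine ⟨C, fun p y => (hf _).trans ?_⟩
  have := norm_le_graphMap p y
  gcongr

theorem integrable_graphMap {n : ℕ} (f : 𝓢(E n, ℂ)) (p : Coord n) :
    Integrable fun y => f (graphMap p.1 p.2 y) := by
  obtain ⟨C, hC⟩ := exists_graphMap_bound f
  exact ((integrable_inv_one_add_norm_pow n).const_mul C).mono'
    (f.continuous.comp (continuous_graphMap p)).aestronglyMeasurable
    (Filter.Eventually.of_forall (hC p))

/-- The family of all `graphInt f`, with `f` Schwartz, is closed under partial derivatives: by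
`graphDeriv_eq` each one replaces `f` by its derivative along an affine field, which is again
Schwartz. -/
theorem contDiff_graphInt {n : ℕ} (f : 𝓢(E n, ℂ)) : ContDiff ℝ ∞ (graphInt f) := by
  let b := Module.finBasis ℝ (Coord n)
  let ℓ : Fin _ → Coord n →L[ℝ] ℝ := fun j => LinearMap.toContinuousLinearMap (b.coord j)
  let D : Fin _ → 𝓢(E n, ℂ) → 𝓢(E n, ℂ) := fun j =>
    fieldDeriv (coordField (b j)) (join (b j).2 0)
  refine contDiff_of_hasFDerivAt_family graphInt D ℓ (fun f p => ?_) f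
  choose C hC using fun j => exists_graphMap_bound (D j f)
  refine hasFDerivAt_integral_sum
    (bound := fun j y => C j * ((1 + ‖y‖) ^ (n + 1))⁻¹)
    (fun j => (integrable_inv_one_add_norm_pow n).const_mul _) (integrable_graphMap f)
    (fun j p => (integrable_graphMap (D j f) p).aestronglyMeasurable) (fun j => hC j)
    (fun p y => ?_) p
  have h1 : HasFDerivAt (fun q : Coord n => graphMap q.1 q.2 y) (graphDeriv y) p := by
    simp only [graphMap_eq]
    exact (graphDeriv y).hasFDerivAt.add_const _
  have h2 := (f.hasFDerivAt (graphMap p.1 p.2 y)).comp p h1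
  refine h2.congr_fderiv (ContinuousLinearMap.ext fun q => ?_)
  symm
  conv_rhs => rw [← b.sum_repr q]
  rw [map_sum, _root_.sum_apply]
  refine Finset.sum_congr rfl fun j _ => ?_
  rw [map_smul, ContinuousLinearMap.smulRight_apply, ContinuousLinearMap.comp_apply,
    fieldDeriv_apply, ← graphDeriv_eq]
  rfl

/-! ### Linear parametrizations and the surface measure. -/

/-- `y ↦ p + ℓ y` is a parametrization of `L`. -/
def IsParam {n : ℕ} (L : AL n) (ℓ : EuclideanSpace ℝ (Fin n) →ₗ[ℝ] E n) (p : E n) : Prop :=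
  Function.Injective ℓ ∧ ∀ v, v ∈ L.carrier ↔ ∃ y, p + ℓ y = v

/-- Translations preserve Hausdorff measure, and an injective linear map from `ℝⁿ` scales it by its
Jacobian `normDet`. -/
theorem IsParam.surfaceMeasure_eq {n : ℕ} {L : AL n} {ℓ : EuclideanSpace ℝ (Fin n) →ₗ[ℝ] E n}
    {p : E n} (h : IsParam L ℓ p) : surfaceMeasure L =
      ENNReal.ofReal ℓ.normDet • (volume : Measure (EuclideanSpace ℝ (Fin n))).map
        fun y => p + ℓ y := by
  have hcont : Continuous fun y => p + ℓ y :=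
    continuous_const.add ℓ.continuous_of_finiteDimensional
  ext s hs
  rw [surfaceMeasure, Measure.restrict_apply hs, Measure.smul_apply,
    Measure.map_apply hcont.measurable hs, smul_eq_mul]
  have h1 : s ∩ (L.carrier : Set (E n)) =
      (fun w => p + w) '' (ℓ '' ((fun y => p + ℓ y) ⁻¹' s)) := by
    ext v
    simp only [Set.mem_inter_iff, SetLike.mem_coe, h.2, Set.mem_image, Set.mem_preimage]
    constructor
    · rintro ⟨hv, y, rfl⟩
      exact ⟨ℓ y, ⟨y, hv, rfl⟩, rfl⟩
    · rintro ⟨_, ⟨y, hy, rfl⟩, rfl⟩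
      exact ⟨hy, y, rfl⟩
  have h2 := ℓ.euclideanHausdorffMeasure_image_eq_normDet_mul_volume ((fun y => p + ℓ y) ⁻¹' s)
  rw [finrank_euclideanSpace_fin] at h2
  rw [h1, (isometry_add_left p).euclideanHausdorffMeasure_image, h2]

theorem IsParam.radon_eq {n : ℕ} {L : AL n} {ℓ : EuclideanSpace ℝ (Fin n) →ₗ[ℝ] E n} {p : E n}
    (h : IsParam L ℓ p) {f : E n → ℂ} (hf : Continuous f) :
    radon f L = ℓ.normDet * ∫ y, f (p + ℓ y) := by
  have hcont : Continuous fun y => p + ℓ y :=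
    continuous_const.add ℓ.continuous_of_finiteDimensional
  rw [radon, h.surfaceMeasure_eq, integral_smul_measure,
    integral_map hcont.measurable.aemeasurable hf.aestronglyMeasurable,
    ENNReal.toReal_ofReal ℓ.normDet_nonneg, Complex.real_smul]

theorem IsParam.act {n : ℕ} {L : AL n} {ℓ : EuclideanSpace ℝ (Fin n) →ₗ[ℝ] E n} {p : E n}
    (h : IsParam L ℓ p) (g : symplecticGroup (Fin n) ℝ) (c : E n) :
    IsParam (act g c L) (toEuclideanLin g.1 ∘ₗ ℓ) (toEuclideanLin g.1 p + c) := by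
  refine ⟨(symplectic_mulVec_injective g).comp h.1, fun v => ?_⟩
  rw [mem_act]
  constructor
  · rintro ⟨w, hw, rfl⟩
    obtain ⟨y, rfl⟩ := (h.2 w).1 hw
    exact ⟨y, by rw [map_add, LinearMap.comp_apply]; abel⟩
  · rintro ⟨y, rfl⟩
    exact ⟨_, (h.2 _).2 ⟨y, rfl⟩, by rw [map_add, LinearMap.comp_apply]; abel⟩

/-- The linear subspace parallel to `L`. -/
def dirAL {n : ℕ} (L : AL n) : AL n where
  carrier := L.carrier.direction.toAffineSubspace
  nonempty := ⟨0, L.carrier.direction.zero_mem⟩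
  lagrangian := by
    rw [Submodule.toAffineSubspace_direction]
    exact L.lagrangian

theorem mem_dirAL {n : ℕ} (L : AL n) (v : E n) :
    v ∈ (dirAL L).carrier ↔ v ∈ L.carrier.direction := Iff.rfl

theorem IsParam.dir {n : ℕ} {L : AL n} {ℓ : EuclideanSpace ℝ (Fin n) →ₗ[ℝ] E n} {p : E n}
    (h : IsParam L ℓ p) : IsParam (dirAL L) ℓ 0 := by
  refine ⟨h.1, fun v => ?_⟩
  have hp : p ∈ L.carrier := (h.2 p).2 ⟨0, by simp⟩
  rw [mem_dirAL, AffineSubspace.mem_direction_iff_eq_vsub_right hp]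
  constructor
  · rintro ⟨w, hw, rfl⟩
    obtain ⟨y, rfl⟩ := (h.2 w).1 hw
    exact ⟨y, by simp⟩
  · rintro ⟨y, rfl⟩
    exact ⟨_, (h.2 _).2 ⟨y, rfl⟩, by simp⟩

theorem isParam_graph {n : ℕ} (t : Sym2 (Fin n) → ℝ) (τ : EuclideanSpace ℝ (Fin n)) :
    IsParam (graph t τ) (graphMap t τ).linear (graphMap t τ 0) := by
  have key : ∀ y, graphMap t τ 0 + (graphMap t τ).linear y = graphMap t τ y := fun y => by
    have h := (graphMap t τ).map_vadd 0 y
    simp only [vadd_eq_add, add_zero] at h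
    rw [h, add_comm]
  refine ⟨fun y z h => ?_, fun v => ?_⟩
  · have h1 := congrArg sndPart (congrArg (graphMap t τ 0 + ·) h)
    simp only [key] at h1
    exact h1
  · simp only [key]
    exact AffineSubspace.mem_map.trans ⟨fun ⟨y, _, hy⟩ => ⟨y, hy⟩,
      fun ⟨y, hy⟩ => ⟨y, AffineSubspace.mem_top _ _ _, hy⟩⟩

theorem IsParam.ext {n : ℕ} {L L' : AL n} {ℓ : EuclideanSpace ℝ (Fin n) →ₗ[ℝ] E n} {p : E n}
    (h : IsParam L ℓ p) (h' : IsParam L' ℓ p) : L = L' := by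
  ext v
  rw [h.2, h'.2]

theorem isParam_chart {n : ℕ} (g : symplecticGroup (Fin n) ℝ) (t : Sym2 (Fin n) → ℝ)
    (τ : EuclideanSpace ℝ (Fin n)) :
    IsParam (chart g t τ) (toEuclideanLin g.1 ∘ₗ (graphMap t 0).linear)
      (toEuclideanLin g.1 (graphMap t τ 0)) := by
  have h := (isParam_graph t τ).act g 0
  rw [add_zero] at h
  exact h

theorem graphMap_zero_zero {n : ℕ} (t : Sym2 (Fin n) → ℝ) : graphMap t 0 0 = (0 : E n) := by
  ext k
  rcases k with k | k <;> simp [graphMap]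

theorem dirAL_chart {n : ℕ} (g : symplecticGroup (Fin n) ℝ) (t : Sym2 (Fin n) → ℝ)
    (τ : EuclideanSpace ℝ (Fin n)) : dirAL (chart g t τ) = chart g t 0 := by
  refine (isParam_chart g t τ).dir.ext ?_
  have h := isParam_chart g t 0
  rwa [graphMap_zero_zero, map_zero] at h

/-- The isometric embedding `y ↦ (0, y)`. -/
def sndEmb (n : ℕ) : EuclideanSpace ℝ (Fin n) →ₗᵢ[ℝ] E n where
  toFun := join 0
  map_add' y z := by rw [join_add, add_zero]
  map_smul' a y := by
    ext k
    rcases k with k | k <;> simp [join]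
  norm_map' y := by
    have h := norm_join_sq 0 y
    rw [norm_zero, zero_pow two_ne_zero, zero_add] at h
    exact (pow_left_inj₀ (norm_nonneg _) (norm_nonneg _) two_ne_zero).1 h

/-- The isometric embedding `y ↦ u (0, y)`. -/
def unitaryEmb {n : ℕ} (u : unitaryGroup (Fin n) ℂ) : EuclideanSpace ℝ (Fin n) →ₗᵢ[ℝ] E n :=
  (rot u).toLinearIsometry.comp (sndEmb n)

theorem unitaryEmb_apply {n : ℕ} (u : unitaryGroup (Fin n) ℂ) (y : EuclideanSpace ℝ (Fin n)) :
    unitaryEmb u y = rot u (join 0 y) := rfl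

theorem rot_join_eq {n : ℕ} (u : unitaryGroup (Fin n) ℂ) (τ y : EuclideanSpace ℝ (Fin n)) :
    rot u (join τ 0) + unitaryEmb u y = rot u (join τ y) := by
  rw [unitaryEmb_apply, ← map_add, join_add, add_zero, zero_add]

theorem isParam_chart_unitary {n : ℕ} (u : unitaryGroup (Fin n) ℂ)
    (τ : EuclideanSpace ℝ (Fin n)) : IsParam (chart (unitaryToSymplectic u) 0 τ)
      (unitaryEmb u).toLinearMap (rot u (join τ 0)) := by
  refine ⟨(unitaryEmb u).injective, fun v => ?_⟩
  simp only [LinearIsometry.coe_toLinearMap, rot_join_eq]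
  exact mem_chart_unitary u τ v

/-! ### Decay of the Radon transform. -/

theorem radon_chart_unitary {n : ℕ} (u : unitaryGroup (Fin n) ℂ) (τ : EuclideanSpace ℝ (Fin n))
    {f : E n → ℂ} (hf : Continuous f) :
    radon f (chart (unitaryToSymplectic u) 0 τ) = ∫ y, f (rot u (join τ y)) := by
  rw [(isParam_chart_unitary u τ).radon_eq hf, LinearIsometry.normDet_eq_one]
  simp [rot_join_eq]

/-- A bound for a Schwartz function on `u ((τ, 0) + 0 ⊕ ℝⁿ)`. -/
theorem exists_chart_unitary_bound {n : ℕ} (f : 𝓢(E n, ℂ)) (M : ℕ) :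
    ∃ C, ∀ (u : unitaryGroup (Fin n) ℂ) τ y,
      (1 + ‖τ‖) ^ M * ‖f (rot u (join τ y))‖ ≤ C * ((1 + ‖y‖) ^ (n + 1))⁻¹ := by
  -- `M` powers absorb the weight in `τ`; the other `n + 1` make the bound integrable over `y` in
  -- `ℝⁿ`.
  obtain ⟨C, hC, hf⟩ := exists_schwartz_bound f (M + (n + 1))
  refine ⟨C, fun u τ y => ?_⟩
  have h1 := hf (rot u (join τ y))
  rw [LinearIsometryEquiv.norm_map] at h1
  have h2 := norm_fst_le_join τ y
  have h3 := norm_snd_le_join τ y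
  calc (1 + ‖τ‖) ^ M * ‖f (rot u (join τ y))‖
      ≤ (1 + ‖join τ y‖) ^ M * (C * ((1 + ‖join τ y‖) ^ (M + (n + 1)))⁻¹) := by gcongr
    _ = C * ((1 + ‖join τ y‖) ^ (n + 1))⁻¹ := by
      rw [pow_add]
      field_simp
    _ ≤ _ := by gcongr

theorem continuous_rot_join {n : ℕ} (u : unitaryGroup (Fin n) ℂ)
    (τ : EuclideanSpace ℝ (Fin n)) : Continuous fun y => rot u (join τ y) :=
  (rot u).continuous.comp (continuous_join.comp (continuous_const.prodMk continuous_id))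

theorem integrable_chart_unitary {n : ℕ} (f : 𝓢(E n, ℂ)) (u : unitaryGroup (Fin n) ℂ)
    (τ : EuclideanSpace ℝ (Fin n)) : Integrable fun y => f (rot u (join τ y)) := by
  obtain ⟨C, hC⟩ := exists_chart_unitary_bound f 0
  exact ((integrable_inv_one_add_norm_pow n).const_mul C).mono'
    (f.continuous.comp (continuous_rot_join u τ)).aestronglyMeasurable
    (Filter.Eventually.of_forall fun y => by simpa using hC u τ y)

theorem integrable_surfaceMeasure {n : ℕ} (f : 𝓢(E n, ℂ)) (L : AL n) :
    Integrable f (surfaceMeasure L) := by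
  obtain ⟨u, τ, rfl⟩ := exists_chart_unitary L
  have hp := isParam_chart_unitary u τ
  have hcont : Continuous fun y => rot u (join τ 0) + (unitaryEmb u).toLinearMap y :=
    continuous_const.add (unitaryEmb u).continuous
  rw [hp.surfaceMeasure_eq]
  refine Integrable.smul_measure ?_ ENNReal.ofReal_ne_top
  rw [integrable_map_measure f.continuous.aestronglyMeasurable hcont.measurable.aemeasurable]
  refine (integrable_chart_unitary f u τ).congr (Filter.Eventually.of_forall fun y => ?_)
  exact congrArg f (rot_join_eq u τ y).symm

theorem exists_radon_bound {n : ℕ} (f : 𝓢(E n, ℂ)) (M : ℕ) :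
    ∃ C, ∀ L : AL n, (1 + Metric.infDist 0 (L.carrier : Set (E n))) ^ M * ‖radon f L‖ ≤ C := by
  obtain ⟨C, hC⟩ := exists_chart_unitary_bound f M
  refine ⟨∫ y : EuclideanSpace ℝ (Fin n), C * ((1 + ‖y‖) ^ (n + 1))⁻¹, fun L => ?_⟩
  obtain ⟨u, τ, rfl⟩ := exists_chart_unitary L
  rw [infDist_chart_unitary, radon_chart_unitary u τ f.continuous]
  calc (1 + ‖τ‖) ^ M * ‖∫ y, f (rot u (join τ y))‖
      ≤ (1 + ‖τ‖) ^ M * ∫ y, ‖f (rot u (join τ y))‖ := by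
        gcongr
        exact norm_integral_le_integral_norm _
    _ = ∫ y, (1 + ‖τ‖) ^ M * ‖f (rot u (join τ y))‖ := (integral_const_mul _ _).symm
    _ ≤ _ := integral_mono ((integrable_chart_unitary f u τ).norm.const_mul _)
        ((integrable_inv_one_add_norm_pow n).const_mul C) (hC u τ)

/-! ### The Jacobian as a quotient of integrals of a radial function, and smoothness. -/

/-- A radial test function. -/
def radialBump (n : ℕ) : 𝓢(E n, ℂ) :=
  HasCompactSupport.toSchwartzMap
    (f := fun v => ((Real.smoothTransition (2 - ‖v‖ ^ 2) : ℝ) : ℂ))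
    (HasCompactSupport.intro (isCompact_closedBall 0 2) fun v hv => by
      have hv' : 2 < ‖v‖ := by simpa using hv
      -- For `‖v‖ > 2` the argument `2 - ‖v‖ ^ 2` is negative.
      rw [Real.smoothTransition.zero_of_nonpos (by nlinarith), Complex.ofReal_zero])
    (Complex.ofRealCLM.contDiff.comp
      (Real.smoothTransition.contDiff.comp (contDiff_const.sub (contDiff_norm_sq ℝ))))

/-- The integral of the radial test function over a linear Lagrangian subspace. -/
def bumpInt (n : ℕ) : ℝ :=
  ∫ y : EuclideanSpace ℝ (Fin n), Real.smoothTransition (2 - ‖y‖ ^ 2)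

theorem bumpInt_pos (n : ℕ) : 0 < bumpInt n := by
  have hc : Continuous fun y : EuclideanSpace ℝ (Fin n) =>
      Real.smoothTransition (2 - ‖y‖ ^ 2) :=
    Real.smoothTransition.continuous.comp (continuous_const.sub (continuous_norm.pow 2))
  refine hc.integral_pos_of_hasCompactSupport_nonneg_nonzero
    (HasCompactSupport.intro (isCompact_closedBall 0 2) fun v hv => ?_)
    (fun _ => Real.smoothTransition.nonneg _) (x := 0) ?_
  · have hv' : 2 < ‖v‖ := by simpa using hv
    exact Real.smoothTransition.zero_of_nonpos (by nlinarith)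
  · rw [Real.smoothTransition.one_of_one_le (by norm_num)]
    exact one_ne_zero

/-- The isometric parametrization has Jacobian one and preserves norms, so the integral of a radial
function does not see `L`. -/
theorem radon_radialBump {n : ℕ} (L : AL n) : radon (radialBump n) (dirAL L) = bumpInt n := by
  obtain ⟨u, τ, rfl⟩ := exists_chart_unitary L
  rw [(isParam_chart_unitary u τ).dir.radon_eq (radialBump n).continuous,
    LinearIsometry.normDet_eq_one, Complex.ofReal_one, one_mul, bumpInt, ← integral_complex_ofReal]
  refine integral_congr_ae (Filter.Eventually.of_forall fun y => ?_)
  simp only [zero_add, LinearIsometry.coe_toLinearMap]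
  change ((Real.smoothTransition (2 - ‖unitaryEmb u y‖ ^ 2) : ℝ) : ℂ) = _
  rw [LinearIsometry.norm_map]

/-- The same integral of the bump, evaluated in an arbitrary parametrization. This turns the
Jacobian into the reciprocal of an integral, so its smoothness follows from differentiation under
the integral sign. -/
theorem IsParam.normDet_mul {n : ℕ} {L : AL n} {ℓ : EuclideanSpace ℝ (Fin n) →ₗ[ℝ] E n}
    {p : E n} (h : IsParam L ℓ p) : ℓ.normDet * ∫ y, radialBump n (ℓ y) = bumpInt n := by
  rw [← radon_radialBump L, h.dir.radon_eq (radialBump n).continuous]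
  simp only [zero_add]

theorem IsParam.integral_bump_ne_zero {n : ℕ} {L : AL n}
    {ℓ : EuclideanSpace ℝ (Fin n) →ₗ[ℝ] E n} {p : E n} (h : IsParam L ℓ p) :
    ∫ y, radialBump n (ℓ y) ≠ 0 := fun h0 => by
  have h1 := h.normDet_mul
  rw [h0, mul_zero] at h1
  exact (bumpInt_pos n).ne (Complex.ofReal_injective h1)

theorem IsParam.radon_eq_div {n : ℕ} {L : AL n} {ℓ : EuclideanSpace ℝ (Fin n) →ₗ[ℝ] E n}
    {p : E n} (h : IsParam L ℓ p) {f : E n → ℂ} (hf : Continuous f) :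
    radon f L = bumpInt n * (∫ y, f (p + ℓ y)) / ∫ y, radialBump n (ℓ y) := by
  rw [h.radon_eq hf, ← h.normDet_mul]
  have := h.integral_bump_ne_zero
  field_simp

/-- The linear automorphism of `ℝ²ⁿ` given by a symplectic matrix. -/
def symplecticEquiv {n : ℕ} (g : symplecticGroup (Fin n) ℝ) : E n ≃L[ℝ] E n :=
  (LinearEquiv.ofInjectiveEndo _ (symplectic_mulVec_injective g)).toContinuousLinearEquiv

/-- Numerator and denominator are integrals of Schwartz functions over graphs, so
`contDiff_graphInt` applies to both. The denominator sees only the direction, hence the second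
coordinate `0`. -/
theorem radon_chart {n : ℕ} (f : 𝓢(E n, ℂ)) (g : symplecticGroup (Fin n) ℝ) (p : Coord n) :
    radon f (chart g p.1 p.2) = bumpInt n *
      graphInt (SchwartzMap.compCLMOfContinuousLinearEquiv ℝ (symplecticEquiv g) f) p /
      graphInt (SchwartzMap.compCLMOfContinuousLinearEquiv ℝ (symplecticEquiv g) (radialBump n))
        (p.1, 0) := by
  rw [(isParam_chart g p.1 p.2).radon_eq_div f.continuous]
  have key : ∀ τ y, graphMap p.1 τ 0 + (graphMap p.1 0).linear y = graphMap p.1 τ y := fun τ y => by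
    ext k
    rcases k with k | k <;> simp [graphMap, add_comm]
  have key0 : ∀ y, (graphMap p.1 0).linear y = graphMap p.1 0 y := fun y => by
    rw [← key, graphMap_zero_zero, zero_add]
  simp only [LinearMap.comp_apply, ← map_add, key]
  simp only [key0]
  rfl

theorem isSmooth_radon {n : ℕ} (f : 𝓢(E n, ℂ)) : IsSmooth (radon f) := by
  intro g
  simp only [radon_chart]
  have h1 : ContDiff ℝ ∞ fun p : Coord n => graphInt (SchwartzMap.compCLMOfContinuousLinearEquiv ℝ
      (symplecticEquiv g) (radialBump n)) (p.1, 0) :=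
    (contDiff_graphInt _).comp (contDiff_fst.prodMk contDiff_const)
  have h2 : ContDiff ℝ ∞ fun p : Coord n => (bumpInt n : ℂ) * graphInt
      (SchwartzMap.compCLMOfContinuousLinearEquiv ℝ (symplecticEquiv g) f) p :=
    contDiff_const.mul (contDiff_graphInt _)
  have h0' : ∀ p : Coord n, graphInt (SchwartzMap.compCLMOfContinuousLinearEquiv ℝ
      (symplecticEquiv g) (radialBump n)) (p.1, 0) ≠ 0 := fun p h0 => ?_
  · simp only [div_eq_mul_inv]
    exact h2.mul (h1.inv h0')
  have h := (isParam_chart g p.1 0).integral_bump_ne_zero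
  refine h ?_
  have key0 : ∀ y, (graphMap p.1 0).linear y = graphMap p.1 0 y := fun y => by
    ext k
    rcases k with k | k <;> simp [graphMap]
  simp only [LinearMap.comp_apply, key0]
  exact h0

/-! ### Lie derivatives of the Radon transform. -/

/-- Derivative at time zero of the integral of a Schwartz function along a family of affine maps. -/
theorem hasDerivAt_integral_affine {n : ℕ} {M : ℝ → E n →L[ℝ] E n} {c : ℝ → E n}
    (hM : ContDiff ℝ ∞ M) (hc : ContDiff ℝ ∞ c) (hM0 : M 0 = ContinuousLinearMap.id ℝ (E n))
    (hc0 : c 0 = 0) (f : 𝓢(E n, ℂ)) {w : EuclideanSpace ℝ (Fin n) → E n} (hw : Continuous w)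
    (hle : ∀ y, ‖y‖ ≤ ‖w y‖) :
    HasDerivAt (fun s => ∫ y, f (M s (w y) + c s))
      (∫ y, fieldDeriv (deriv M 0) (deriv c 0) f (w y)) 0 := by
  have hMd : Continuous (deriv M) := hM.continuous_deriv (by simp)
  have hcd : Continuous (deriv c) := hc.continuous_deriv (by simp)
  -- The neighbourhood of zero on which the integrand is dominated: there the affine map is close to
  -- the identity, with small translation and bounded velocity.
  obtain ⟨K, hK0, hK⟩ : ∃ K : ℝ, 0 ≤ K ∧ ∀ᶠ s in nhds (0 : ℝ),
      ‖M s - ContinuousLinearMap.id ℝ (E n)‖ < 1 / 2 ∧ ‖c s‖ < 1 ∧ ‖deriv M s‖ < K ∧ ‖deriv c s‖ < K := by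
    refine ⟨‖deriv M 0‖ + ‖deriv c 0‖ + 1, by positivity, ?_⟩
    have h1 : ContinuousAt (fun s => ‖M s - ContinuousLinearMap.id ℝ (E n)‖) 0 :=
      (hM.continuous.sub continuous_const).norm.continuousAt
    have h2 : ContinuousAt (fun s => ‖c s‖) 0 := hc.continuous.norm.continuousAt
    have h3 : ContinuousAt (fun s => ‖deriv M s‖) 0 := hMd.norm.continuousAt
    have h4 : ContinuousAt (fun s => ‖deriv c s‖) 0 := hcd.norm.continuousAt
    have n1 := norm_nonneg (deriv M 0)
    have n2 := norm_nonneg (deriv c 0)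
    exact (h1.eventually_lt_const (by simp [hM0])).and
      ((h2.eventually_lt_const (by simp [hc0])).and
      ((h3.eventually_lt_const (by linarith)).and
        (h4.eventually_lt_const (by linarith))))
  obtain ⟨C₁, hC₁, hf₁⟩ := exists_schwartz_bound f (n + 1)
  -- One power more than integrability needs, to pay for the linear growth of the velocity.
  obtain ⟨C, hC, hf⟩ := exists_schwartz_bound (SchwartzMap.fderivCLM ℝ (E n) ℂ f) (n + 2)
  have hcont : ∀ s, Continuous fun y => f (M s (w y) + c s) := fun s =>
    f.continuous.comp (((M s).continuous.comp hw).add continuous_const)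
  have hint0 : Integrable fun y => f (M 0 (w y) + c 0) := by
    refine ((integrable_inv_one_add_norm_pow n).const_mul C₁).mono'
      (hcont 0).aestronglyMeasurable (Filter.Eventually.of_forall fun y => ?_)
    rw [hM0, hc0, add_zero, ContinuousLinearMap.id_apply]
    refine (hf₁ _).trans ?_
    have := hle y
    gcongr
  have hder0 : ∀ y, fderiv ℝ f (M 0 (w y) + c 0) (deriv M 0 (w y) + deriv c 0) =
      fieldDeriv (deriv M 0) (deriv c 0) f (w y) := fun y => by
    rw [fieldDeriv_apply, hM0, hc0, add_zero, ContinuousLinearMap.id_apply]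
  have h := hasDerivAt_integral_of_dominated_loc_of_deriv_le (μ := volume) (x₀ := (0 : ℝ))
    (F := fun s y => f (M s (w y) + c s))
    (F' := fun s y => fderiv ℝ f (M s (w y) + c s) (deriv M s (w y) + deriv c s))
    (bound := fun y => C * 3 ^ (n + 2) * K * ((1 + ‖y‖) ^ (n + 1))⁻¹) hK
    (Filter.Eventually.of_forall fun s => (hcont s).aestronglyMeasurable) hint0 ?_
    (Filter.Eventually.of_forall ?_)
    ((integrable_inv_one_add_norm_pow n).const_mul _)
    (Filter.Eventually.of_forall fun y s _ => ?_)
  · simpa only [hder0] using h.2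
  · simp only [hder0]
    exact ((fieldDeriv (deriv M 0) (deriv c 0) f).continuous.comp hw).aestronglyMeasurable
  · rintro y s ⟨hs1, hs2, hs3, hs4⟩
    -- As `M s` is within `1 / 2` of the identity and `‖c s‖ < 1`, half of `‖w y‖` survives up to a
    -- constant; the factor `3` below comes from this.
    have e1 : ‖w y‖ ≤ 2 * ‖M s (w y) + c s‖ + 2 := by
      have a1 : ‖(M s - ContinuousLinearMap.id ℝ (E n)) (w y)‖ ≤ 1 / 2 * ‖w y‖ :=
        ContinuousLinearMap.le_of_opNorm_le _ hs1.le _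
      have a2 : w y = (M s (w y) + c s) -
          ((M s - ContinuousLinearMap.id ℝ (E n)) (w y) + c s) := by
        simp
      have a3 := norm_sub_le (M s (w y) + c s)
          ((M s - ContinuousLinearMap.id ℝ (E n)) (w y) + c s)
      rw [← a2] at a3
      have a4 := norm_add_le ((M s - ContinuousLinearMap.id ℝ (E n)) (w y)) (c s)
      linarith
    have e2 : 1 + ‖w y‖ ≤ 3 * (1 + ‖M s (w y) + c s‖) := by
      have := norm_nonneg (M s (w y) + c s)
      linarith
    have e3 : ‖deriv M s (w y) + deriv c s‖ ≤ K * (1 + ‖w y‖) := by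
      refine (norm_add_le _ _).trans ?_
      have := ContinuousLinearMap.le_of_opNorm_le _ hs3.le (w y)
      linarith
    have e4 : ((1 + ‖M s (w y) + c s‖) ^ (n + 2))⁻¹ ≤
        3 ^ (n + 2) * ((1 + ‖w y‖) ^ (n + 2))⁻¹ := by
      rw [← div_eq_mul_inv, le_div_iff₀ (by positivity), inv_mul_le_iff₀ (by positivity),
        ← mul_pow, mul_comm _ (3 : ℝ)]
      gcongr
    calc ‖fderiv ℝ f (M s (w y) + c s) (deriv M s (w y) + deriv c s)‖
        ≤ ‖fderiv ℝ f (M s (w y) + c s)‖ * ‖deriv M s (w y) + deriv c s‖ :=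
          ContinuousLinearMap.le_opNorm _ _
      _ ≤ C * (3 ^ (n + 2) * ((1 + ‖w y‖) ^ (n + 2))⁻¹) * (K * (1 + ‖w y‖)) := by
          have := (hf (M s (w y) + c s)).trans (mul_le_mul_of_nonneg_left e4 hC)
          exact mul_le_mul this e3 (norm_nonneg _) (by positivity)
      _ = C * 3 ^ (n + 2) * K * ((1 + ‖w y‖) ^ (n + 1))⁻¹ := by
          rw [pow_succ (1 + ‖w y‖)]
          field_simp
      _ ≤ _ := by
          have := hle y
          gcongr
  · have d1 : HasDerivAt (fun s => M s (w y) + c s) (deriv M s (w y) + deriv c s) s :=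
      ((ContinuousLinearMap.apply ℝ (E n) (w y)).hasFDerivAt.comp_hasDerivAt s
        (hM.differentiable (by simp) s).hasDerivAt).add
        (hc.differentiable (by simp) s).hasDerivAt
    exact (f.hasFDerivAt _).comp_hasDerivAt s d1

/-- The linear part of the vector field given by `X`. -/
def fieldLin {n : ℕ} (X : ASpLie n) : E n →L[ℝ] E n :=
  LinearMap.toContinuousLinearMap (toEuclideanLin X.1.1)

/-- The linear part of the flow of `X`. -/
def flowLin {n : ℕ} (X : ASpLie n) (s : ℝ) : E n →L[ℝ] E n :=
  LinearMap.toContinuousLinearMap (toEuclideanLin (expLin X s).1)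

theorem flowLin_apply {n : ℕ} (X : ASpLie n) (s : ℝ) (v : E n) :
    flowLin X s v = toEuclideanLin (expLin X s).1 v := rfl

theorem flowLin_zero {n : ℕ} (X : ASpLie n) : flowLin X 0 = ContinuousLinearMap.id ℝ (E n) := by
  ext1 v
  rw [flowLin_apply, expLin_zero]
  ext k
  simp

theorem expTrans_zero {n : ℕ} (X : ASpLie n) : expTrans X 0 = 0 := by
  simp [expTrans]

section

open scoped Matrix.Norms.Operator

/-- Matrices as continuous linear maps. -/
def matrixCLM (n : ℕ) : Matrix (Fin n ⊕ Fin n) (Fin n ⊕ Fin n) ℝ →L[ℝ] E n →L[ℝ] E n :=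
  LinearMap.toContinuousLinearMap
    (LinearMap.toContinuousLinearMap.toLinearMap ∘ₗ
      (toEuclideanLin : Matrix (Fin n ⊕ Fin n) (Fin n ⊕ Fin n) ℝ ≃ₗ[ℝ] _).toLinearMap)

theorem contDiff_flowLin {n : ℕ} (X : ASpLie n) : ContDiff ℝ ∞ (flowLin X) :=
  (matrixCLM n).contDiff.comp (contDiff_expLin X)

theorem hasDerivAt_flowLin {n : ℕ} (X : ASpLie n) : HasDerivAt (flowLin X) (fieldLin X) 0 := by
  have h := hasDerivAt_exp_smul_const (𝕂 := ℝ) X.1.1 (0 : ℝ)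
  rw [zero_smul, NormedSpace.exp_zero, one_mul] at h
  exact (matrixCLM n).hasFDerivAt.comp_hasDerivAt 0 h

end

theorem hasDerivAt_expTrans {n : ℕ} (X : ASpLie n) : HasDerivAt (expTrans X) X.2 0 := by
  have hF : Continuous fun r => flowLin X r X.2 :=
    (contDiff_flowLin X).continuous.clm_apply continuous_const
  have h := intervalIntegral.integral_hasDerivAt_right (hF.intervalIntegrable 0 0)
    (hF.stronglyMeasurableAtFilter _ _) hF.continuousAt
  rw [flowLin_zero] at h
  exact h

/-- The factor in the Lie derivative of the Radon transform that comes from the change of the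
surface measure. -/
def lieFactor {n : ℕ} (X : ASpLie n) (L : AL n) : ℂ :=
  (bumpInt n : ℂ)⁻¹ * radon (fieldDeriv (fieldLin X) 0 (radialBump n)) (dirAL L)

/-- Along the flow, the transform is a constant times the integral of `f` divided by the integral of
the bump, both over moved copies of one isometric parametrization. The quotient rule gives the
derivative of `f` along the field, and a correction from the denominator. The denominator sees only
linear parts, so the correction involves only the direction of `L`. -/
theorem lieDeriv_radon {n : ℕ} (X : ASpLie n) (f : 𝓢(E n, ℂ)) (L : AL n) :
    lieDeriv X (radon f) L =
      radon (fieldDeriv (fieldLin X) X.2 f) L - lieFactor X L * radon f L := by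
  obtain ⟨u, τ, rfl⟩ := exists_chart_unitary L
  have hp := isParam_chart_unitary u τ
  have hκ : (bumpInt n : ℂ) ≠ 0 := Complex.ofReal_ne_zero.2 (bumpInt_pos n).ne'
  have hd1 := hasDerivAt_integral_affine (contDiff_flowLin X) (contDiff_expTrans X)
    (flowLin_zero X) (expTrans_zero X) f (continuous_rot_join u τ) fun y =>
      (norm_snd_le_join τ y).trans_eq (LinearIsometryEquiv.norm_map _ _).symm
  have hd2 := hasDerivAt_integral_affine (c := fun _ => 0) (contDiff_flowLin X) contDiff_const
    (flowLin_zero X) rfl (radialBump n) (unitaryEmb u).continuous fun y =>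
      ((unitaryEmb u).norm_map y).ge
  rw [(hasDerivAt_flowLin X).deriv, (hasDerivAt_expTrans X).deriv] at hd1
  rw [(hasDerivAt_flowLin X).deriv, deriv_const] at hd2
  have h2 : ∀ s, ∫ y, radialBump n (flowLin X s (unitaryEmb u y) + 0) =
      ∫ y, radialBump n ((toEuclideanLin (expLin X s).1 ∘ₗ (unitaryEmb u).toLinearMap) y) :=
    fun s => by simp only [add_zero]; rfl
  have heq : ∀ s, radon f (act (expLin X s) (expTrans X s) (chart (unitaryToSymplectic u) 0 τ)) =
      bumpInt n * (∫ y, f (flowLin X s (rot u (join τ y)) + expTrans X s)) /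
        ∫ y, radialBump n (flowLin X s (unitaryEmb u y) + 0) := fun s => by
    rw [(hp.act (expLin X s) (expTrans X s)).radon_eq_div f.continuous, h2]
    congr 3
    refine funext fun y => congrArg f ?_
    rw [← rot_join_eq u τ y, map_add (flowLin X s), flowLin_apply, flowLin_apply, LinearMap.comp_apply,
      LinearIsometry.coe_toLinearMap]
    abel
  have hI1 : ∫ y, f (flowLin X 0 (rot u (join τ y)) + expTrans X 0) =
      radon f (chart (unitaryToSymplectic u) 0 τ) := by
    rw [radon_chart_unitary u τ f.continuous, flowLin_zero, expTrans_zero]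
    simp
  have hI2 : ∫ y, radialBump n (flowLin X 0 (unitaryEmb u y) + 0) = bumpInt n := by
    rw [← hp.normDet_mul, LinearIsometry.normDet_eq_one, flowLin_zero]
    simp
  have hJ1 := radon_chart_unitary u τ (fieldDeriv (fieldLin X) X.2 f).continuous
  have hJ2 : ∫ y, fieldDeriv (fieldLin X) 0 (radialBump n) (unitaryEmb u y) =
      radon (fieldDeriv (fieldLin X) 0 (radialBump n))
        (dirAL (chart (unitaryToSymplectic u) 0 τ)) := by
    rw [hp.dir.radon_eq (fieldDeriv (fieldLin X) 0 (radialBump n)).continuous,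
      LinearIsometry.normDet_eq_one]
    simp
  -- At time zero the parametrization is isometric, so the denominator is `bumpInt n`, which is
  -- positive.
  have hd := (hd1.const_mul (bumpInt n : ℂ)).div hd2 (by rw [hI2]; exact hκ)
  rw [hI1, hI2, ← hJ1, hJ2] at hd
  rw [lieDeriv]
  simp only [heq]
  refine (HasDerivAt.deriv hd).trans ?_
  rw [lieFactor]
  field_simp

/-! ### Functions of the direction and the iterated Lie derivatives. -/

/-- Smooth functions of the direction of `L`. -/
structure IsDirectional {n : ℕ} (h : AL n → ℂ) : Prop where
  smooth : IsSmooth h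
  translate : ∀ c L, h (act 1 c L) = h L

/-- Up to translation every `L` is `u (0 ⊕ ℝⁿ)`, and the unitary group is compact. -/
theorem IsDirectional.exists_bound {n : ℕ} {h : AL n → ℂ} (hh : IsDirectional h) :
    ∃ C, ∀ L, ‖h L‖ ≤ C := by
  have hc : Continuous fun u : unitaryGroup (Fin n) ℂ =>
      ‖h (act (unitaryToSymplectic u) 0 (baseAL n))‖ :=
    (hh.smooth.continuous.comp (continuous_act_unitary continuous_id continuous_const)).norm
  obtain ⟨C, hC⟩ := isCompact_univ.bddAbove_image hc.continuousOn
  refine ⟨C, fun L => ?_⟩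
  obtain ⟨u, c, rfl⟩ := exists_act_unitary L
  have h1 : act (unitaryToSymplectic u) c (baseAL n) =
      act 1 c (act (unitaryToSymplectic u) 0 (baseAL n)) := by
    rw [act_act, one_mul, map_zero, zero_add]
  rw [h1, hh.translate]
  exact hC ⟨u, Set.mem_univ _, rfl⟩

theorem isDirectional_const {n : ℕ} (z : ℂ) : IsDirectional fun _ : AL n => z :=
  ⟨fun _ => contDiff_const, fun _ _ => rfl⟩

theorem IsSmooth.mul {n : ℕ} {f f' : AL n → ℂ} (hf : IsSmooth f) (hf' : IsSmooth f') :
    IsSmooth (f * f') := fun g => (hf g).mul (hf' g)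

theorem IsDirectional.mul {n : ℕ} {h h' : AL n → ℂ} (hh : IsDirectional h)
    (hh' : IsDirectional h') : IsDirectional (h * h') :=
  ⟨hh.smooth.mul hh'.smooth, fun c L => by
    rw [Pi.mul_apply, Pi.mul_apply, hh.translate, hh'.translate]⟩

theorem IsDirectional.sub {n : ℕ} {h h' : AL n → ℂ} (hh : IsDirectional h)
    (hh' : IsDirectional h') : IsDirectional (h - h') :=
  ⟨fun g => (hh.smooth g).sub (hh'.smooth g), fun c L => by
    rw [Pi.sub_apply, Pi.sub_apply, hh.translate, hh'.translate]⟩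

theorem toEuclideanLin_one_apply {n : ℕ} (v : E n) :
    toEuclideanLin (1 : symplecticGroup (Fin n) ℝ).1 v = v := by
  ext k
  simp

/-- A translation by `c` followed by the flow is the flow followed by translation by the image of
`c` under the linear part. -/
theorem IsDirectional.lieDeriv {n : ℕ} {h : AL n → ℂ} (hh : IsDirectional h) (X : ASpLie n) :
    IsDirectional (lieDeriv X h) := by
  refine ⟨hh.smooth.lieDeriv X, fun c L => ?_⟩
  rw [LagrangianRadon.lieDeriv, LagrangianRadon.lieDeriv]
  congr 1
  funext s
  have h1 : act (expLin X s) (expTrans X s) (act 1 c L) =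
      act 1 (toEuclideanLin (expLin X s).1 c) (act (expLin X s) (expTrans X s) L) := by
    rw [act_act, act_act, mul_one, one_mul, toEuclideanLin_one_apply, add_comm]
  rw [h1, hh.translate]

theorem exists_isParam {n : ℕ} (L : AL n) :
    ∃ ℓ p, IsParam L ℓ p := by
  obtain ⟨u, τ, rfl⟩ := exists_chart_unitary L
  exact ⟨_, _, isParam_chart_unitary u τ⟩

/-- In a chart, passing to the parallel linear subspace sets `τ = 0`, so smoothness is inherited
from that of a Radon transform. -/
theorem isDirectional_lieFactor {n : ℕ} (X : ASpLie n) : IsDirectional (lieFactor X) := by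
  refine ⟨fun g => ?_, fun c L => ?_⟩
  · simp only [lieFactor, dirAL_chart]
    have h1 := isSmooth_radon (fieldDeriv (fieldLin X) 0 (radialBump n)) g
    have h2 : ContDiff ℝ ∞ fun p : Coord n => ((p.1, 0) : Coord n) :=
      contDiff_fst.prodMk contDiff_const
    have h3 := h1.comp h2
    exact contDiff_const.mul h3
  · obtain ⟨ℓ, p, h⟩ := exists_isParam L
    have h1 := (h.act 1 c).dir
    have h2 : toEuclideanLin (1 : symplecticGroup (Fin n) ℝ).1 ∘ₗ ℓ = ℓ :=
      LinearMap.ext fun y => toEuclideanLin_one_apply _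
    rw [h2] at h1
    rw [lieFactor, lieFactor, h1.ext h.dir]

theorem lieDeriv_mul {n : ℕ} {f f' : AL n → ℂ} (hf : IsSmooth f) (hf' : IsSmooth f')
    (X : ASpLie n) : lieDeriv X (f * f') = lieDeriv X f * f' + f * lieDeriv X f' := by
  funext L
  have h := (hf.differentiableAt_flow X L).hasDerivAt.mul
    (hf'.differentiableAt_flow X L).hasDerivAt
  have h0 : act (expLin X 0) (expTrans X 0) L = L := by
    obtain ⟨ℓ, p, hp⟩ := exists_isParam L
    have h1 := hp.act (expLin X 0) (expTrans X 0)
    have h2 : toEuclideanLin (expLin X 0).1 ∘ₗ ℓ = ℓ := by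
      rw [expLin_zero]
      exact LinearMap.ext fun y => toEuclideanLin_one_apply _
    rw [h2, expTrans_zero, add_zero, expLin_zero, toEuclideanLin_one_apply] at h1
    rw [expLin_zero, expTrans_zero]
    exact h1.ext hp
  rw [h0] at h
  exact h.deriv

/-- The coefficient `h` is needed for the induction: by the Leibniz rule and `lieDeriv_radon`, a Lie
derivative of a product `h * radon f` is a sum of two such products. -/
theorem exists_iterLie_bound {n : ℕ} (Xs : List (ASpLie n)) {h : AL n → ℂ}
    (hh : IsDirectional h) (f : 𝓢(E n, ℂ)) (M : ℕ) :
    ∃ C, ∀ L : AL n, (1 + Metric.infDist 0 (L.carrier : Set (E n))) ^ M *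
      ‖iterLie Xs (h * radon f) L‖ ≤ C := by
  -- The last entry of the list is the derivative applied first, so the list is peeled from its end,
  -- with `h` and `f` variable.
  induction Xs using List.reverseRecOn generalizing h f with
  | nil =>
    obtain ⟨C, hC⟩ := exists_radon_bound f M
    obtain ⟨K, hK⟩ := hh.exists_bound
    refine ⟨K * C, fun L => ?_⟩
    have hK0 : 0 ≤ K := (norm_nonneg _).trans (hK L)
    change _ * ‖h L * radon f L‖ ≤ _
    rw [norm_mul, mul_left_comm]
    have := Metric.infDist_nonneg (x := (0 : E n)) (s := (L.carrier : Set (E n)))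
    exact mul_le_mul (hK L) (hC L) (by positivity) hK0
  | append_singleton Xs X ih =>
    have h1 : lieDeriv X (h * radon f) = (lieDeriv X h - h * lieFactor X) * radon f +
        h * radon (fieldDeriv (fieldLin X) X.2 f) := by
      rw [lieDeriv_mul hh.smooth (isSmooth_radon f)]
      funext L
      simp only [Pi.add_apply, Pi.mul_apply, Pi.sub_apply, lieDeriv_radon]
      ring
    have hd : IsDirectional (lieDeriv X h - h * lieFactor X) :=
      (hh.lieDeriv X).sub (hh.mul (isDirectional_lieFactor X))
    obtain ⟨C₁, hC₁⟩ := ih hd f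
    obtain ⟨C₂, hC₂⟩ := ih hh (fieldDeriv (fieldLin X) X.2 f)
    refine ⟨C₁ + C₂, fun L => ?_⟩
    have h2 : iterLie (Xs ++ [X]) (h * radon f) = iterLie Xs (lieDeriv X (h * radon f)) := by
      simp [iterLie]
    rw [h2, h1, iterLie_add (hd.smooth.mul (isSmooth_radon f)) (hh.smooth.mul (isSmooth_radon _)),
      Pi.add_apply]
    have := Metric.infDist_nonneg (x := (0 : E n)) (s := (L.carrier : Set (E n)))
    refine le_trans ?_ (add_le_add (hC₁ L) (hC₂ L))
    rw [← mul_add]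
    exact mul_le_mul_of_nonneg_left (norm_add_le _ _) (by positivity)

/-- The Radon transform maps Schwartz functions to Schwartz functions. -/
theorem radon_mem_schwartzAL {n : ℕ} (f : 𝓢(E n, ℂ)) : radon f ∈ schwartzAL n := by
  refine ⟨isSmooth_radon f, fun Xs M => ?_⟩
  have h : (fun _ : AL n => (1 : ℂ)) * radon f = radon f := one_mul _
  have h1 := exists_iterLie_bound Xs (isDirectional_const 1) f M
  rwa [h] at h1

/-- The Radon transform as a linear map. -/
def radonLM (n : ℕ) : 𝓢(E n, ℂ) →ₗ[ℂ] SchwartzAL n where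
  toFun f := ⟨radon f, radon_mem_schwartzAL f⟩
  map_add' f g := Subtype.ext <| funext fun L =>
    integral_add (integrable_surfaceMeasure f L) (integrable_surfaceMeasure g L)
  map_smul' z _ := Subtype.ext <| funext fun _ => integral_const_mul z _

/-! ### Derivatives of the back-projection. -/

/-- The infinitesimal translation by `b`. -/
def translation {n : ℕ} (b : E n) : ASpLie n := (0, b)

theorem expLin_translation {n : ℕ} (b : E n) (s : ℝ) : expLin (translation b) s = 1 := by
  apply Subtype.ext
  simp [expLin, translation]

theorem expTrans_translation {n : ℕ} (b : E n) (s : ℝ) : expTrans (translation b) s = s • b := by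
  simp only [expTrans, expLin_translation, toEuclideanLin_one_apply]
  simp [translation]

theorem lieDeriv_translation {n : ℕ} (b : E n) (f : AL n → ℂ) (u : unitaryGroup (Fin n) ℂ)
    (x : E n) : lieDeriv (translation b) f (act (unitaryToSymplectic u) x (baseAL n)) =
      deriv (fun s : ℝ => f (act (unitaryToSymplectic u) (x + s • b) (baseAL n))) 0 := by
  rw [lieDeriv]
  congr 1
  funext s
  rw [act_act, expLin_translation, expTrans_translation, one_mul, toEuclideanLin_one_apply]

/-- As a function of the translation vector, `f` factors through a chart and is smooth. The flow of
an infinitesimal translation is a straight line, so directional derivatives are Lie derivatives. -/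
theorem IsSmooth.hasFDerivAt_translate {n : ℕ} {f : AL n → ℂ} (hf : IsSmooth f)
    (u : unitaryGroup (Fin n) ℂ) (x : E n) :
    HasFDerivAt (fun y => f (act (unitaryToSymplectic u) y (baseAL n)))
      (∑ i, (EuclideanSpace.proj i : E n →L[ℝ] ℝ).smulRight
        (LagrangianRadon.lieDeriv (translation (EuclideanSpace.single i 1)) f
          (act (unitaryToSymplectic u) x (baseAL n)))) x := by
  have h1 : ContDiff ℝ ∞ fun y : E n => ((0, fstPart ((rot u).symm y)) : Coord n) :=
    contDiff_const.prodMk (fstPart.contDiff.comp (rot u).symm.contDiff)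
  have h2 : ContDiff ℝ ∞ fun y => f (act (unitaryToSymplectic u) y (baseAL n)) := by
    have h3 := (hf (unitaryToSymplectic u)).comp h1
    have h4 : (fun y => f (act (unitaryToSymplectic u) y (baseAL n))) =
        (fun p : Coord n => f (chart (unitaryToSymplectic u) p.1 p.2)) ∘
          fun y : E n => ((0, fstPart ((rot u).symm y)) : Coord n) :=
      funext fun y => congrArg f (act_unitary_eq_chart u y)
    rw [h4]
    exact h3
  have h3 := (h2.differentiable (by simp) x).hasFDerivAt
  refine h3.congr_fderiv (ContinuousLinearMap.ext fun b => ?_)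
  have key : ∀ b, LagrangianRadon.lieDeriv (translation b) f
      (act (unitaryToSymplectic u) x (baseAL n)) =
      fderiv ℝ (fun y => f (act (unitaryToSymplectic u) y (baseAL n))) x b := fun b => by
    rw [lieDeriv_translation]
    have h4 : HasDerivAt (fun s : ℝ => x + s • b) b 0 := by
      simpa using ((hasDerivAt_id (0 : ℝ)).smul_const b).const_add x
    have h5 : x + (0 : ℝ) • b = x := by simp
    rw [← h5] at h3
    have h6 := h3.comp_hasDerivAt (0 : ℝ) h4
    rw [h5] at h6
    exact h6.deriv
  rw [_root_.sum_apply]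
  simp only [ContinuousLinearMap.smulRight_apply, key]
  conv_lhs => rw [← (EuclideanSpace.basisFun (Fin n ⊕ Fin n) ℝ).sum_repr b, map_sum]
  refine Finset.sum_congr rfl fun i _ => ?_
  rw [map_smul]
  simp

/-- The Lie derivative on the Schwartz space. -/
def schwartzLie {n : ℕ} (X : ASpLie n) (φ : SchwartzAL n) : SchwartzAL n :=
  ⟨lieDeriv X φ, φ.2.1.lieDeriv X, fun Xs M => by
    obtain ⟨C, hC⟩ := φ.2.2 (Xs ++ [X]) M
    refine ⟨C, fun L => ?_⟩
    have h : iterLie (Xs ++ [X]) φ = iterLie Xs (lieDeriv X φ) := by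
      simp [iterLie]
    rw [← h]
    exact hC L⟩

theorem le_schwartzALSeminorm {n : ℕ} (φ : SchwartzAL n) (Xs : List (ASpLie n)) (M : ℕ)
    (L : AL n) : (1 + Metric.infDist 0 (L.carrier : Set (E n))) ^ M * ‖iterLie Xs φ L‖ ≤
      schwartzALSeminorm n (Xs, M) φ := by
  obtain ⟨C, hC⟩ := φ.2.2 Xs M
  exact le_ciSup (f := fun L : AL n =>
    (1 + Metric.infDist 0 (L.carrier : Set (E n))) ^ M * ‖iterLie Xs φ L‖)
    ⟨C, by rintro _ ⟨L, rfl⟩; exact hC L⟩ L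

theorem norm_le_schwartzALSeminorm {n : ℕ} (φ : SchwartzAL n) (L : AL n) :
    ‖φ L‖ ≤ schwartzALSeminorm n ([], 0) φ := by
  simpa [iterLie] using le_schwartzALSeminorm φ [] 0 L

theorem SchwartzAL.continuous {n : ℕ} (φ : SchwartzAL n) : Continuous φ := φ.2.1.continuous

theorem continuous_unitary_orbit {n : ℕ} (φ : SchwartzAL n) (x : E n) :
    Continuous fun u => φ (act (unitaryToSymplectic u) x (baseAL n)) :=
  φ.continuous.comp (continuous_act_unitary continuous_id continuous_const)

theorem integrable_unitary_orbit {n : ℕ} (φ : SchwartzAL n) (x : E n) :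
    Integrable (fun u => φ (act (unitaryToSymplectic u) x (baseAL n))) (haarU n) :=
  (integrable_const _).mono' (continuous_unitary_orbit φ x).aestronglyMeasurable
    (Filter.Eventually.of_forall fun _ => norm_le_schwartzALSeminorm φ _)

theorem integrable_sigma {n : ℕ} (φ : SchwartzAL n) (x : E n) : Integrable φ (sigma x) :=
  (integrable_const _).mono' φ.continuous.aestronglyMeasurable
    (Filter.Eventually.of_forall fun _ => norm_le_schwartzALSeminorm φ _)

/-- The zeroth seminorm of the Lie derivative is a constant majorant on the unitary group, which has
total mass one. -/
theorem hasFDerivAt_backProj {n : ℕ} (φ : SchwartzAL n) (x : E n) :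
    HasFDerivAt (backProj φ) (∑ i, (EuclideanSpace.proj i : E n →L[ℝ] ℝ).smulRight
      (backProj (schwartzLie (translation (EuclideanSpace.single i 1)) φ) x)) x := by
  have h := hasFDerivAt_integral_sum (μ := haarU n)
    (g := fun x u => φ (act (unitaryToSymplectic u) x (baseAL n)))
    (g' := fun i x u => schwartzLie (translation (EuclideanSpace.single i 1)) φ
      (act (unitaryToSymplectic u) x (baseAL n)))
    (ℓ := fun i => (EuclideanSpace.proj i : E n →L[ℝ] ℝ))
    (bound := fun i _ => schwartzALSeminorm n ([], 0)
      (schwartzLie (translation (EuclideanSpace.single i 1)) φ))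
    (fun _ => integrable_const _) (integrable_unitary_orbit φ)
    (fun _ x => (continuous_unitary_orbit _ x).aestronglyMeasurable)
    (fun _ _ _ => norm_le_schwartzALSeminorm _ _)
    (fun x u => φ.2.1.hasFDerivAt_translate u x) x
  simp only [← backProj_eq_integral (SchwartzAL.continuous _)] at h
  exact h

theorem contDiff_backProj {n : ℕ} (φ : SchwartzAL n) : ContDiff ℝ ∞ (backProj φ) :=
  contDiff_of_hasFDerivAt_family (fun φ : SchwartzAL n => backProj φ)
    (fun i => schwartzLie (translation (EuclideanSpace.single i 1)))
    (fun i => (EuclideanSpace.proj i : E n →L[ℝ] ℝ)) hasFDerivAt_backProj φ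

theorem fderiv_backProj_single {n : ℕ} (φ : SchwartzAL n) (x : E n) (i : Fin n ⊕ Fin n) :
    fderiv ℝ (backProj φ) x (EuclideanSpace.single i 1) =
      backProj (schwartzLie (translation (EuclideanSpace.single i 1)) φ) x := by
  rw [(hasFDerivAt_backProj φ x).fderiv, _root_.sum_apply]
  simp only [ContinuousLinearMap.smulRight_apply]
  rw [Finset.sum_eq_single i]
  · simp
  · intro j _ hj
    simp [hj]
  · simp

/-- The iterated Lie derivative on the Schwartz space. -/
def schwartzIterLie {n : ℕ} (Xs : List (ASpLie n)) (φ : SchwartzAL n) : SchwartzAL n :=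
  Xs.foldr schwartzLie φ

theorem schwartzIterLie_apply {n : ℕ} (Xs : List (ASpLie n)) (φ : SchwartzAL n) :
    (schwartzIterLie Xs φ : AL n → ℂ) = iterLie Xs φ := by
  induction Xs with
  | nil => rfl
  | cons X Xs ih => exact congrArg (lieDeriv X) ih

theorem partialDeriv_backProj {n k : ℕ} (i : Fin k → Fin n ⊕ Fin n) (φ : SchwartzAL n) :
    partialDeriv i (backProj φ) = backProj (schwartzIterLie
      (List.ofFn fun j => translation (EuclideanSpace.single (i j) 1)) φ) := by
  induction k with
  | zero =>
    funext x
    simp [partialDeriv, schwartzIterLie]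
  | succ k ih =>
    funext x
    rw [partialDeriv, iteratedFDeriv_succ_apply_left]
    have hd : DifferentiableAt ℝ (iteratedFDeriv ℝ k (backProj φ)) x :=
      (contDiff_backProj φ).differentiable_iteratedFDeriv (by exact_mod_cast WithTop.coe_lt_top k) x
    have h2 : fderiv ℝ (partialDeriv (i ∘ Fin.succ) (backProj φ)) x
        (EuclideanSpace.single (i 0) 1) =
        fderiv ℝ (iteratedFDeriv ℝ k (backProj φ)) x (EuclideanSpace.single (i 0) 1)
          (Fin.tail fun j => EuclideanSpace.single (i j) 1) := by
      have h3 := (ContinuousMultilinearMap.apply ℝ (fun _ : Fin k => E n) ℂ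
        (Fin.tail fun j => EuclideanSpace.single (i j) 1)).hasFDerivAt.comp x hd.hasFDerivAt
      exact DFunLike.congr_fun h3.fderiv _
    rw [← h2, ih (i ∘ Fin.succ), fderiv_backProj_single, List.ofFn_succ]
    rfl

/-! ### Decay of the averaged weight. -/

/-- The weight that dominates the back-projection. -/
def decayWeight {n : ℕ} (x : E n) : ℝ := ((1 + ‖fstPart x‖) ^ (n + 1))⁻¹

theorem decayWeight_nonneg {n : ℕ} (x : E n) : 0 ≤ decayWeight x := by
  unfold decayWeight
  positivity

theorem decayWeight_le_one {n : ℕ} (x : E n) : decayWeight x ≤ 1 :=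
  inv_le_one_of_one_le₀ (one_le_pow₀ (le_add_of_nonneg_right (norm_nonneg _)))

theorem continuous_decayWeight {n : ℕ} : Continuous (decayWeight (n := n)) :=
  ((continuous_const.add fstPart.continuous.norm).pow _).inv₀ fun _ =>
    (pow_pos (add_pos_of_pos_of_nonneg one_pos (norm_nonneg _)) _).ne'

theorem decayWeight_le_smul {n : ℕ} {c : ℝ} (hc : 0 ≤ c) (hc1 : c ≤ 1) (x : E n) :
    decayWeight x ≤ decayWeight (c • x) := by
  unfold decayWeight
  rw [map_smul, norm_smul, Real.norm_of_nonneg hc]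
  have : c * ‖fstPart x‖ ≤ ‖fstPart x‖ := mul_le_of_le_one_left (norm_nonneg _) hc1
  gcongr

theorem continuous_decayWeight_rot {n : ℕ} :
    Continuous fun p : unitaryGroup (Fin n) ℂ × E n => decayWeight ((rot p.1).symm p.2) := by
  simp only [rot_symm]
  exact continuous_decayWeight.comp (continuous_rot continuous_fst.inv continuous_snd)

/-- The average of the weight over the unitary group. -/
def meanWeight {n : ℕ} (x : E n) : ℝ := ∫ u, decayWeight ((rot u).symm x) ∂(haarU n)

theorem integrable_decayWeight_rot {n : ℕ} (x : E n) :
    Integrable (fun u => decayWeight ((rot u).symm x)) (haarU n) :=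
  (integrable_const (1 : ℝ)).mono'
    (continuous_decayWeight_rot.comp (Continuous.prodMk_left x)).aestronglyMeasurable
    (Filter.Eventually.of_forall fun u => by
      rw [Real.norm_of_nonneg (decayWeight_nonneg _)]
      exact decayWeight_le_one _)

theorem meanWeight_le_one {n : ℕ} (x : E n) : meanWeight x ≤ 1 := by
  have h := integral_mono (integrable_decayWeight_rot x) (integrable_const (1 : ℝ))
    fun u => decayWeight_le_one _
  simpa [meanWeight] using h

/-- Left invariance of Haar measure. -/
theorem meanWeight_rot {n : ℕ} (w : unitaryGroup (Fin n) ℂ) (x : E n) :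
    meanWeight (rot w x) = meanWeight x := by
  rw [meanWeight, meanWeight, ← integral_mul_left_eq_self _ w]
  refine integral_congr_ae (Filter.Eventually.of_forall fun u => ?_)
  simp only [rot_symm, ← rot_mul, _root_.mul_inv_rev, inv_mul_cancel_right]

/-- By rotation invariance and transitivity on spheres, `y` may be replaced by the multiple of `x`
of the same norm, where the weight is monotone for every single `u`. -/
theorem meanWeight_antitone {n : ℕ} {x y : E n} (h : ‖y‖ ≤ ‖x‖) :
    meanWeight x ≤ meanWeight y := by
  rcases eq_or_ne x 0 with rfl | hx
  · rw [norm_zero, norm_le_zero_iff] at h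
    rw [h]
  have hx' : 0 < ‖x‖ := norm_pos_iff.2 hx
  have hc : 0 ≤ ‖y‖ / ‖x‖ := by positivity
  obtain ⟨w, hw⟩ := exists_rot_eq (v := (‖y‖ / ‖x‖) • x) (w := y) (by
    rw [norm_smul, Real.norm_of_nonneg hc, div_mul_cancel₀ _ hx'.ne'])
  rw [← hw, meanWeight_rot]
  refine integral_mono (integrable_decayWeight_rot x) (integrable_decayWeight_rot _) fun u => ?_
  simp only [map_smul]
  exact decayWeight_le_smul hc (div_le_one_of_le₀ h hx'.le) _

theorem integrable_decayWeight_rot_prod {n : ℕ} (R : ℝ) :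
    Integrable (Function.uncurry fun (x : E n) (u : unitaryGroup (Fin n) ℂ) =>
      decayWeight ((rot u).symm x))
      (((volume : Measure (E n)).restrict (Metric.ball (0 : E n) R)).prod (haarU n)) := by
  have : IsFiniteMeasure ((volume : Measure (E n)).restrict (Metric.ball (0 : E n) R)) :=
    ⟨by rw [Measure.restrict_apply_univ]; exact measure_ball_lt_top⟩
  exact (integrable_const (1 : ℝ)).mono'
    (continuous_decayWeight_rot.comp continuous_swap).aestronglyMeasurable
    (Filter.Eventually.of_forall fun p => by
      rw [Function.uncurry, Real.norm_of_nonneg (decayWeight_nonneg _)]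
      exact decayWeight_le_one _)

/-- After Fubini, each rotation preserves both the ball and Lebesgue measure. -/
theorem setIntegral_meanWeight {n : ℕ} (R : ℝ) :
    ∫ x in Metric.ball (0 : E n) R, meanWeight x =
      ∫ x in Metric.ball (0 : E n) R, decayWeight x := by
  simp only [meanWeight]
  rw [integral_integral_swap (integrable_decayWeight_rot_prod R)]
  have h : ∀ u : unitaryGroup (Fin n) ℂ,
      ∫ x in Metric.ball (0 : E n) R, decayWeight ((rot u).symm x) =
      ∫ x in Metric.ball (0 : E n) R, decayWeight x := fun u => by
    have h1 := (rot u).symm.measurePreserving.setIntegral_preimage_emb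
      (rot u).symm.toHomeomorph.measurableEmbedding decayWeight (Metric.ball (0 : E n) R)
    rw [← h1]
    congr 2
    ext v
    simp
  simp [h]

theorem measurableEmbedding_join (n : ℕ) : MeasurableEmbedding
    fun p : EuclideanSpace ℝ (Fin n) × EuclideanSpace ℝ (Fin n) => join p.1 p.2 :=
  continuous_join.measurableEmbedding fun p q h => Prod.ext
    (by simpa only [fstPart_join] using congrArg fstPart h)
    (by simpa only [sndPart_join] using congrArg sndPart h)

/-- The ball lies in the cylinder of all `(x, y)` with `‖y‖ < R`; over it the integral factors. -/
theorem setIntegral_decayWeight_le {n : ℕ} (R : ℝ) :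
    ∫ x in Metric.ball (0 : E n) R, decayWeight x ≤
      (∫ y : EuclideanSpace ℝ (Fin n), ((1 + ‖y‖) ^ (n + 1))⁻¹) *
        volume.real (Metric.ball (0 : EuclideanSpace ℝ (Fin n)) R) := by
  let w : EuclideanSpace ℝ (Fin n) → ℝ := fun y => ((1 + ‖y‖) ^ (n + 1))⁻¹
  let χ : EuclideanSpace ℝ (Fin n) → ℝ := (Metric.ball 0 R).indicator 1
  have hχ : Integrable χ := (integrable_indicator_iff Metric.isOpen_ball.measurableSet).2
    (integrableOn_const (by simp [measure_ball_lt_top.ne]) (by simp))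
  have hp : Integrable fun p : EuclideanSpace ℝ (Fin n) × EuclideanSpace ℝ (Fin n) =>
      w p.1 * χ p.2 := (integrable_inv_one_add_norm_pow n).mul_prod hχ
  have hemb := measurableEmbedding_join n
  have hp' : Integrable fun x : E n => w (fstPart x) * χ (sndPart x) :=
    ((measurePreserving_join n).integrable_comp_emb hemb).1 hp
  rw [← integral_indicator Metric.isOpen_ball.measurableSet]
  calc ∫ x, (Metric.ball (0 : E n) R).indicator decayWeight x
      ≤ ∫ x : E n, w (fstPart x) * χ (sndPart x) := by
        refine integral_mono_of_nonneg (Filter.Eventually.of_forall fun x =>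
          Set.indicator_nonneg (fun _ _ => decayWeight_nonneg _) _) hp'
          (Filter.Eventually.of_forall fun x => ?_)
        by_cases hx : x ∈ Metric.ball (0 : E n) R
        · have h1 : sndPart x ∈ Metric.ball (0 : EuclideanSpace ℝ (Fin n)) R := by
            rw [mem_ball_zero_iff] at hx ⊢
            refine lt_of_le_of_lt ?_ hx
            have := norm_snd_le_join (fstPart x) (sndPart x)
            rwa [join_fst_snd] at this
          simp only [χ, Set.indicator_of_mem hx, Set.indicator_of_mem h1, Pi.one_apply, mul_one]
          exact le_rfl
        · rw [Set.indicator_of_notMem hx]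
          exact mul_nonneg (by positivity)
            (Set.indicator_nonneg (fun _ _ => zero_le_one) _)
    _ = ∫ p : EuclideanSpace ℝ (Fin n) × EuclideanSpace ℝ (Fin n), w p.1 * χ p.2 :=
        ((measurePreserving_join n).integral_comp hemb _).symm
    _ = _ := by
        rw [Measure.volume_eq_prod, integral_prod_mul]
        congr 1
        simp only [χ]
        rw [integral_indicator_one Metric.isOpen_ball.measurableSet]

/-- A radially decreasing function is at most its mean over the ball of radius `‖x‖`. The integral
over this ball grows like `‖x‖ ^ n` and the volume like `‖x‖ ^ (2n)`. -/
theorem exists_meanWeight_bound {n : ℕ} (hn : n ≠ 0) :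
    ∃ C, ∀ x : E n, (1 + ‖x‖) ^ n * meanWeight x ≤ C := by
  let W := ∫ y : EuclideanSpace ℝ (Fin n), ((1 + ‖y‖) ^ (n + 1))⁻¹
  let a := volume.real (Metric.ball (0 : EuclideanSpace ℝ (Fin n)) 1)
  let b := volume.real (Metric.ball (0 : E n) 1)
  have hb : 0 < b := ENNReal.toReal_pos (Metric.measure_ball_pos _ _ one_pos).ne'
    measure_ball_lt_top.ne
  have hW : 0 ≤ W := integral_nonneg fun y => by positivity
  have ha : 0 ≤ a := ENNReal.toReal_nonneg
  have hm0 : ∀ x : E n, 0 ≤ meanWeight x := fun x => integral_nonneg fun u => decayWeight_nonneg _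
  refine ⟨2 ^ n * (1 + W * a / b), fun x => ?_⟩
  have key : ‖x‖ ^ n * meanWeight x ≤ W * a / b := by
    rcases (norm_nonneg x).eq_or_lt with h0 | h0
    · rw [← h0, zero_pow hn, zero_mul]
      positivity
    have e1 : volume.real (Metric.ball (0 : E n) ‖x‖) * meanWeight x ≤
        ∫ y in Metric.ball (0 : E n) ‖x‖, meanWeight y := by
      have hm : IntegrableOn meanWeight (Metric.ball (0 : E n) ‖x‖) :=
        (integrable_decayWeight_rot_prod ‖x‖).integral_prod_left
      have h := setIntegral_mono_on (integrableOn_const measure_ball_lt_top.ne) hm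
        Metric.isOpen_ball.measurableSet
        fun y hy => meanWeight_antitone (x := x) (mem_ball_zero_iff.1 hy).le
      rwa [setIntegral_const, smul_eq_mul] at h
    have e2 : volume.real (Metric.ball (0 : E n) ‖x‖) = ‖x‖ ^ (n + n) * b := by
      rw [Measure.real, Measure.addHaar_ball_of_pos _ _ h0, ENNReal.toReal_mul,
        ENNReal.toReal_ofReal (by positivity)]
      simp [b, Measure.real]
    have e3 : volume.real (Metric.ball (0 : EuclideanSpace ℝ (Fin n)) ‖x‖) = ‖x‖ ^ n * a := by
      rw [Measure.real, Measure.addHaar_ball_of_pos _ _ h0, ENNReal.toReal_mul,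
        ENNReal.toReal_ofReal (by positivity)]
      simp [a, Measure.real]
    have e4 := e1.trans ((setIntegral_meanWeight ‖x‖).trans_le (setIntegral_decayWeight_le ‖x‖))
    rw [e2, e3, pow_add] at e4
    rw [le_div_iff₀ hb]
    have hx : 0 < ‖x‖ ^ n := by positivity
    refine le_of_mul_le_mul_left ?_ hx
    calc _ = ‖x‖ ^ n * ‖x‖ ^ n * b * meanWeight x := by ring
      _ ≤ _ := e4
      _ = _ := by ring
  -- This separates the bound near the origin, where the mean is at most one, from `key`.
  have h2 : (1 + ‖x‖) ^ n ≤ 2 ^ n * (1 + ‖x‖ ^ n) := by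
    calc (1 + ‖x‖) ^ n ≤ 2 ^ (n - 1) * (1 ^ n + ‖x‖ ^ n) :=
          add_pow_le zero_le_one (norm_nonneg _) n
      _ ≤ _ := by
          rw [one_pow]
          gcongr
          · norm_num
          · omega
  calc (1 + ‖x‖) ^ n * meanWeight x ≤ 2 ^ n * (1 + ‖x‖ ^ n) * meanWeight x := by
        gcongr
        exact hm0 x
    _ = 2 ^ n * (meanWeight x + ‖x‖ ^ n * meanWeight x) := by ring
    _ ≤ _ := by
        gcongr
        exact meanWeight_le_one x

/-! ### The back-projection as a continuous operator. -/

theorem withSeminorms_schwartzAL (n : ℕ) : WithSeminorms (schwartzALSeminorm n) := ⟨rfl⟩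

theorem withSeminorms_spaceB (n : ℕ) : WithSeminorms (spaceBSeminorm n) := ⟨rfl⟩

/-- The exponent `n + 1` in the seminorm is that of `decayWeight`, chosen so that the weight is
integrable over `ℝⁿ`. -/
theorem exists_backProj_bound {n : ℕ} (hn : n ≠ 0) :
    ∃ C : ℝ, 0 ≤ C ∧ ∀ (φ : SchwartzAL n) (x : E n),
      (1 + ‖x‖) ^ n * ‖backProj φ x‖ ≤ C * schwartzALSeminorm n ([], n + 1) φ := by
  obtain ⟨C, hC⟩ := exists_meanWeight_bound hn
  have hC0 : 0 ≤ C := le_trans (mul_nonneg (by positivity)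
    (integral_nonneg fun u => decayWeight_nonneg _)) (hC 0)
  refine ⟨C, hC0, fun φ x => ?_⟩
  have hS : 0 ≤ schwartzALSeminorm n ([], n + 1) φ := apply_nonneg _ _
  have h1 : ∀ u : unitaryGroup (Fin n) ℂ, ‖φ (act (unitaryToSymplectic u) x (baseAL n))‖ ≤
      schwartzALSeminorm n ([], n + 1) φ * decayWeight ((rot u).symm x) := fun u => by
    have h := le_schwartzALSeminorm φ [] (n + 1) (act (unitaryToSymplectic u) x (baseAL n))
    have e : Metric.infDist 0
        ((act (unitaryToSymplectic u) x (baseAL n)).carrier : Set (E n)) =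
        ‖fstPart ((rot u).symm x)‖ := by
      rw [act_unitary_eq_chart, infDist_chart_unitary]
    rw [e] at h
    rw [decayWeight, le_mul_inv_iff₀ (by positivity), mul_comm]
    exact h
  have h2 : ‖backProj φ x‖ ≤ schwartzALSeminorm n ([], n + 1) φ * meanWeight x := by
    rw [backProj_eq_integral φ.continuous, meanWeight, ← integral_const_mul]
    exact norm_integral_le_of_norm_le ((integrable_decayWeight_rot x).const_mul _)
      (Filter.Eventually.of_forall h1)
  calc (1 + ‖x‖) ^ n * ‖backProj φ x‖
      ≤ (1 + ‖x‖) ^ n * (schwartzALSeminorm n ([], n + 1) φ * meanWeight x) :=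
        mul_le_mul_of_nonneg_left h2 (by positivity)
    _ = (1 + ‖x‖) ^ n * meanWeight x * schwartzALSeminorm n ([], n + 1) φ := by ring
    _ ≤ _ := mul_le_mul_of_nonneg_right (hC x) hS

/-- Moves derivatives from the function into the seminorm, so that the bound of order zero covers
all partial derivatives with the same constant. -/
theorem schwartzALSeminorm_schwartzIterLie {n : ℕ} (Xs : List (ASpLie n)) (M : ℕ)
    (φ : SchwartzAL n) : schwartzALSeminorm n ([], M) (schwartzIterLie Xs φ) =
      schwartzALSeminorm n (Xs, M) φ := by
  change (⨆ L : AL n, _ * ‖schwartzIterLie Xs φ L‖) = ⨆ L : AL n, _ * ‖iterLie Xs φ L‖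
  rw [schwartzIterLie_apply]

/-- The Lie algebra elements whose Lie derivatives give a partial derivative of the
back-projection. -/
def translations {n k : ℕ} (i : Fin k → Fin n ⊕ Fin n) : List (ASpLie n) :=
  List.ofFn fun j => translation (EuclideanSpace.single (i j) 1)

theorem exists_partialDeriv_backProj_bound {n : ℕ} (hn : n ≠ 0) :
    ∃ C : ℝ, 0 ≤ C ∧ ∀ (φ : SchwartzAL n) (k : ℕ) (i : Fin k → Fin n ⊕ Fin n) (x : E n),
      (1 + ‖x‖) ^ n * ‖partialDeriv i (backProj φ) x‖ ≤
        C * schwartzALSeminorm n (translations i, n + 1) φ := by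
  obtain ⟨C, hC0, hC⟩ := exists_backProj_bound hn
  refine ⟨C, hC0, fun φ k i x => ?_⟩
  rw [partialDeriv_backProj, ← schwartzALSeminorm_schwartzIterLie]
  exact hC _ x

theorem partialDeriv_backProj_isBigO {n : ℕ} (hn : n ≠ 0) (φ : SchwartzAL n) {k : ℕ}
    (i : Fin k → Fin n ⊕ Fin n) :
    partialDeriv i (backProj φ) =O[Bornology.cobounded (E n)] fun x => (‖x‖ ^ n)⁻¹ := by
  obtain ⟨C, -, hC⟩ := exists_partialDeriv_backProj_bound hn
  refine Asymptotics.IsBigO.of_bound (C * schwartzALSeminorm n (translations i, n + 1) φ) ?_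
  filter_upwards [Bornology.eventually_ne_cobounded (0 : E n)] with x hx
  have hx' : 0 < ‖x‖ := norm_pos_iff.2 hx
  rw [Real.norm_of_nonneg (by positivity), le_mul_inv_iff₀ (by positivity), mul_comm]
  refine le_trans (mul_le_mul_of_nonneg_right ?_ (norm_nonneg _)) (hC φ k i x)
  gcongr
  linarith

/-- The back-projection as a linear map between the spaces of test functions. -/
def backProjLM {n : ℕ} (hn : n ≠ 0) : SchwartzAL n →ₗ[ℂ] SpaceB n where
  toFun φ := ⟨backProj φ, contDiff_backProj φ, fun k i => by
    obtain ⟨C, -, hC⟩ := exists_partialDeriv_backProj_bound hn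
    exact ⟨_, hC φ k i⟩⟩
  map_add' φ ψ := Subtype.ext <| funext fun x =>
    integral_add (integrable_sigma φ x) (integrable_sigma ψ x)
  map_smul' c φ := Subtype.ext <| funext fun x => integral_const_mul c φ

theorem continuous_backProjLM {n : ℕ} (hn : n ≠ 0) : Continuous (backProjLM hn) := by
  refine WithSeminorms.continuous_of_isBounded (withSeminorms_schwartzAL n) (withSeminorms_spaceB n) _
    (Seminorm.IsBounded.of_real fun α => ?_)
  obtain ⟨C, hC0, hC⟩ := exists_partialDeriv_backProj_bound hn
  refine ⟨{(translations α.2, n + 1)}, C, fun φ => ?_⟩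
  rw [Finset.sup_singleton]
  exact ciSup_le fun x => hC φ α.1 α.2 x

/-- The back-projection as a continuous linear operator. -/
def backProjCLM {n : ℕ} (hn : n ≠ 0) : SchwartzAL n →L[ℂ] SpaceB n :=
  ⟨backProjLM hn, continuous_backProjLM hn⟩

/-! ### Functions as functionals. -/

theorem norm_le_spaceBSeminorm {n : ℕ} (g : SpaceB n) (x : E n) :
    ‖g x‖ ≤ spaceBSeminorm n ⟨0, Fin.elim0⟩ g := by
  obtain ⟨C, hC⟩ := g.2.2 0 Fin.elim0
  have h := le_ciSup (f := fun x : E n => (1 + ‖x‖) ^ n *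
    ‖partialDeriv (Fin.elim0 : Fin 0 → Fin n ⊕ Fin n) g x‖)
    ⟨C, by rintro _ ⟨x, rfl⟩; exact hC x⟩ x
  refine le_trans ?_ h
  have e : partialDeriv (Fin.elim0 : Fin 0 → Fin n ⊕ Fin n) g x = g x := rfl
  simp only [e]
  exact le_mul_of_one_le_left (norm_nonneg _) (one_le_pow₀ (le_add_of_nonneg_right (norm_nonneg _)))

theorem SpaceB.continuous {n : ℕ} (g : SpaceB n) : Continuous g := g.2.1.continuous

theorem integrable_mul_spaceB {n : ℕ} (f : 𝓢(E n, ℂ)) (g : SpaceB n) :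
    Integrable fun x => f x * g x :=
  f.integrable.mul_bdd (c := spaceBSeminorm n ⟨0, Fin.elim0⟩ g) g.continuous.aestronglyMeasurable
    (Filter.Eventually.of_forall fun x => norm_le_spaceBSeminorm g x)

theorem norm_integral_mul_spaceB_le {n : ℕ} (f : 𝓢(E n, ℂ)) (g : SpaceB n) :
    ‖∫ x, f x * g x‖ ≤ (∫ x, ‖f x‖) * spaceBSeminorm n ⟨0, Fin.elim0⟩ g := by
  rw [← integral_mul_const]
  refine norm_integral_le_of_norm_le (f.integrable.norm.mul_const _)
    (Filter.Eventually.of_forall fun x => ?_)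
  rw [norm_mul]
  exact mul_le_mul_of_nonneg_left (norm_le_spaceBSeminorm g x) (norm_nonneg _)

/-- A Schwartz function regarded as a functional on `𝓑(ℝ²ⁿ)`. -/
def toDualB {n : ℕ} (f : 𝓢(E n, ℂ)) : DualB n :=
  let ℓ : SpaceB n →ₗ[ℂ] ℂ :=
    { toFun := fun g => ∫ x, f x * g x
      map_add' := fun g h => by
        rw [← integral_add (integrable_mul_spaceB f g) (integrable_mul_spaceB f h)]
        exact integral_congr_ae (Filter.Eventually.of_forall fun x => mul_add (f x) (g x) (h x))
      map_smul' := fun c g => by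
        rw [RingHom.id_apply, smul_eq_mul, ← integral_const_mul]
        exact integral_congr_ae (Filter.Eventually.of_forall fun x =>
          mul_left_comm (f x) c (g x)) }
  (⟨ℓ, WithSeminorms.continuous_of_isBounded (withSeminorms_spaceB n) (norm_withSeminorms ℂ ℂ) ℓ
    (Seminorm.IsBounded.of_real fun _ => ⟨{⟨0, Fin.elim0⟩}, ∫ x, ‖f x‖, fun g => by
      rw [Finset.sup_singleton]
      exact norm_integral_mul_spaceB_le f g⟩)⟩ : SpaceB n →L[ℂ] ℂ)

/-- In the coordinates `(u, τ)` the function is `O((1 + ‖τ‖)^(-(n+1)))`, integrable over `ℝⁿ`, and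
the unitary group has finite mass. -/
theorem integrable_schwartzAL {n : ℕ} (F : SchwartzAL n) : Integrable F (measureAL n) := by
  rw [integrable_measureAL F.continuous]
  have h := ((integrable_const (1 : ℝ) (μ := haarU n)).mul_prod
    (integrable_inv_one_add_norm_pow n)).const_mul (schwartzALSeminorm n ([], n + 1) F)
  refine h.mono' (F.continuous.comp continuous_chart_unitary).aestronglyMeasurable
    (Filter.Eventually.of_forall fun p => ?_)
  have h1 := le_schwartzALSeminorm F [] (n + 1) (chart (unitaryToSymplectic p.1) 0 p.2)
  rw [infDist_chart_unitary] at h1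
  rw [one_mul, le_mul_inv_iff₀ (by positivity), mul_comm]
  exact h1

theorem integrable_mul_schwartzAL {n : ℕ} (F φ : SchwartzAL n) :
    Integrable (fun L => F L * φ L) (measureAL n) :=
  (integrable_schwartzAL F).mul_bdd (c := schwartzALSeminorm n ([], 0) φ)
    φ.continuous.aestronglyMeasurable
    (Filter.Eventually.of_forall fun L => norm_le_schwartzALSeminorm φ L)

theorem norm_integral_mul_schwartzAL_le {n : ℕ} (F φ : SchwartzAL n) :
    ‖∫ L, F L * φ L ∂(measureAL n)‖ ≤
      (∫ L, ‖F L‖ ∂(measureAL n)) * schwartzALSeminorm n ([], 0) φ := by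
  rw [← integral_mul_const]
  refine norm_integral_le_of_norm_le ((integrable_schwartzAL F).norm.mul_const _)
    (Filter.Eventually.of_forall fun L => ?_)
  rw [norm_mul]
  exact mul_le_mul_of_nonneg_left (norm_le_schwartzALSeminorm φ L) (norm_nonneg _)

/-- A Schwartz function on the affine Lagrangian Grassmannian regarded as a distribution. -/
def toDualSchwartzAL {n : ℕ} (F : SchwartzAL n) : DualSchwartzAL n :=
  let ℓ : SchwartzAL n →ₗ[ℂ] ℂ :=
    { toFun := fun φ => ∫ L, F L * φ L ∂(measureAL n)
      map_add' := fun φ ψ => by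
        rw [← integral_add (integrable_mul_schwartzAL F φ) (integrable_mul_schwartzAL F ψ)]
        exact integral_congr_ae (Filter.Eventually.of_forall fun L => mul_add (F L) (φ L) (ψ L))
      map_smul' := fun c φ => by
        rw [RingHom.id_apply, smul_eq_mul, ← integral_const_mul]
        exact integral_congr_ae (Filter.Eventually.of_forall fun L =>
          mul_left_comm (F L) c (φ L)) }
  (⟨ℓ, WithSeminorms.continuous_of_isBounded (withSeminorms_schwartzAL n) (norm_withSeminorms ℂ ℂ) ℓ
    (Seminorm.IsBounded.of_real fun _ => ⟨{([], 0)}, ∫ L, ‖F L‖ ∂(measureAL n), fun φ => by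
      rw [Finset.sup_singleton]
      exact norm_integral_mul_schwartzAL_le F φ⟩)⟩ : SchwartzAL n →L[ℂ] ℂ)

/-! ### Duality. -/

/-- The Radon transform and the back-projection are dual to each other. -/
theorem integral_mul_backProj {n : ℕ} (f : 𝓢(E n, ℂ)) (φ : SchwartzAL n) :
    ∫ x, f x * backProj φ x = ∫ L, radon f L * φ L ∂(measureAL n) := by
  have hi : Integrable (Function.uncurry fun (x : E n) (u : unitaryGroup (Fin n) ℂ) =>
      f x * φ (act (unitaryToSymplectic u) x (baseAL n))) (volume.prod (haarU n)) := by
    have h1 : Integrable (fun p : E n × unitaryGroup (Fin n) ℂ => f p.1 * 1)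
      (volume.prod (haarU n)) := f.integrable.mul_prod (integrable_const (1 : ℂ))
    simp only [mul_one] at h1
    have h2 : Continuous fun p : E n × unitaryGroup (Fin n) ℂ =>
        φ (act (unitaryToSymplectic p.2) p.1 (baseAL n)) :=
      φ.continuous.comp (continuous_act_unitary continuous_snd continuous_fst)
    exact h1.mul_bdd (c := schwartzALSeminorm n ([], 0) φ) h2.aestronglyMeasurable
      (Filter.Eventually.of_forall fun p => norm_le_schwartzALSeminorm φ _)
  have hfφ := integrable_mul_schwartzAL (radonLM n f) φ
  have hc : Continuous fun L => radon f L * φ L :=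
    (radonLM n f).continuous.mul φ.continuous
  have hi2 : Integrable (fun p : unitaryGroup (Fin n) ℂ × EuclideanSpace ℝ (Fin n) =>
      radon f (chart (unitaryToSymplectic p.1) 0 p.2) *
        φ (chart (unitaryToSymplectic p.1) 0 p.2)) ((haarU n).prod volume) :=
    (integrable_measureAL hc).1 hfφ
  -- For fixed `u`, substitute `x = u (τ, y)`: the value of `φ` depends on `τ` alone, so integrating
  -- over `y` leaves the Radon transform of `f`.
  have h3 : ∀ u : unitaryGroup (Fin n) ℂ,
      ∫ x, f x * φ (act (unitaryToSymplectic u) x (baseAL n)) =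
        ∫ τ, radon f (chart (unitaryToSymplectic u) 0 τ) *
          φ (chart (unitaryToSymplectic u) 0 τ) := fun u => by
    have hg : Integrable fun x => f x * φ (act (unitaryToSymplectic u) x (baseAL n)) :=
      f.integrable.mul_bdd (c := schwartzALSeminorm n ([], 0) φ)
        (φ.continuous.comp
          (continuous_act_unitary continuous_const continuous_id)).aestronglyMeasurable
        (Filter.Eventually.of_forall fun x => norm_le_schwartzALSeminorm φ _)
    have e : ∀ p : EuclideanSpace ℝ (Fin n) × EuclideanSpace ℝ (Fin n),
        f (rot u (join p.1 p.2)) *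
          φ (act (unitaryToSymplectic u) (rot u (join p.1 p.2)) (baseAL n)) =
        f (rot u (join p.1 p.2)) * φ (chart (unitaryToSymplectic u) 0 p.1) := fun p => by
      rw [act_unitary_eq_chart, LinearIsometryEquiv.symm_apply_apply, fstPart_join]
    have hmp := (rot u).measurePreserving.comp (measurePreserving_join n)
    have hemb := (rot u).toHomeomorph.measurableEmbedding.comp (measurableEmbedding_join n)
    have h4 := hmp.integral_comp hemb
      fun x => f x * φ (act (unitaryToSymplectic u) x (baseAL n))
    have h5 := (hmp.integrable_comp_emb hemb).2 hg
    simp only [Function.comp_def, e] at h4 h5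
    rw [← h4, Measure.volume_eq_prod, integral_prod _ h5]
    refine integral_congr_ae (Filter.Eventually.of_forall fun τ => ?_)
    simp only
    rw [radon_chart_unitary u τ f.continuous, integral_mul_const]
  calc ∫ x, f x * backProj φ x
      = ∫ x, ∫ u, f x * φ (act (unitaryToSymplectic u) x (baseAL n)) ∂(haarU n) := by
        refine integral_congr_ae (Filter.Eventually.of_forall fun x => ?_)
        simp only
        rw [backProj_eq_integral φ.continuous, integral_const_mul]
    _ = ∫ u, (∫ x, f x * φ (act (unitaryToSymplectic u) x (baseAL n))) ∂(haarU n) :=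
        integral_integral_swap hi
    _ = ∫ u, (∫ τ, radon f (chart (unitaryToSymplectic u) 0 τ) *
          φ (chart (unitaryToSymplectic u) 0 τ)) ∂(haarU n) := by simp only [h3]
    _ = _ := by
        rw [integral_measureAL hc]
        exact (integral_prod _ hi2).symm

/-! ### The extension and its uniqueness. -/

/-- Every weak-* continuous functional on `𝓑'(ℝ²ⁿ)` is an evaluation. -/
theorem exists_eq_eval {n : ℕ} (Λ : DualB n →L[ℂ] ℂ) : ∃ g : SpaceB n, ∀ u : DualB n, Λ u = u g := by
  -- The topology of pointwise convergence is the weak topology of the pairing with `𝓑`, whose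
  -- continuous functionals are exactly the evaluations.
  obtain ⟨g, hg⟩ := LinearMap.dualEmbedding_surjective (topDualPairing ℂ (SpaceB n))
    (Λ.comp (PointwiseConvergenceCLM.equivWeakDual ℂ (SpaceB n)).symm.toContinuousLinearMap)
  exact ⟨g, fun u => (DFunLike.congr_fun hg
    (PointwiseConvergenceCLM.equivWeakDual ℂ (SpaceB n) u)).symm⟩

/-- Smooth compactly supported functions already separate locally integrable functions up to null
sets, and continuity removes the null set. -/
theorem SpaceB.ext_of_integral {n : ℕ} {g h : SpaceB n}
    (H : ∀ f : 𝓢(E n, ℂ), ∫ x, f x * g x = ∫ x, f x * h x) : g = h := by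
  have hae : ∀ᵐ x : E n, g x = h x := by
    refine ae_eq_of_integral_contDiff_smul_eq g.continuous.locallyIntegrable
      h.continuous.locallyIntegrable fun ψ hψ hψc => ?_
    have h1 : HasCompactSupport (Complex.ofRealCLM ∘ ψ) := hψc.comp_left rfl
    have h2 : ContDiff ℝ ∞ (Complex.ofRealCLM ∘ ψ) := Complex.ofRealCLM.contDiff.comp hψ
    simpa using H (h1.toSchwartzMap h2)
  exact Subtype.ext (Continuous.ae_eq_iff_eq volume g.continuous h.continuous |>.1 hae)

/-- The extension of the Radon transform to `𝓑'(ℝ²ⁿ)`. -/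
def radonExtension {n : ℕ} (hn : n ≠ 0) : DualB n →L[ℂ] DualSchwartzAL n :=
  PointwiseConvergenceCLM.precomp ℂ (backProjCLM hn)

theorem radonExtension_toDualB {n : ℕ} (hn : n ≠ 0) (f : 𝓢(E n, ℂ)) :
    radonExtension hn (toDualB f) = toDualSchwartzAL (radonLM n f) :=
  DFunLike.ext _ _ fun φ => integral_mul_backProj f φ

/-- Reflexivity of the weak-* pairing stands in for a direct density argument: each scalar component
of `T` is evaluation at one `g`, and testing against Schwartz functions determines `g`. -/
theorem eq_radonExtension {n : ℕ} (hn : n ≠ 0) {T : DualB n →L[ℂ] DualSchwartzAL n}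
    (hT : ∀ f : 𝓢(E n, ℂ), T (toDualB f) = toDualSchwartzAL (radonLM n f)) :
    T = radonExtension hn := by
  refine ContinuousLinearMap.ext fun u => DFunLike.ext _ _ fun φ => ?_
  obtain ⟨g, hg⟩ := exists_eq_eval ((PointwiseConvergenceCLM.evalCLM (RingHom.id ℂ) ℂ φ).comp T)
  have hg' : g = backProjCLM hn φ := SpaceB.ext_of_integral fun f => by
    have h1 : T (toDualB f) φ = toDualB f g := hg (toDualB f)
    rw [hT, ← radonExtension_toDualB hn] at h1
    exact h1.symm
  have h2 : T u φ = u g := hg u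
  rw [h2, hg']
  rfl

end

end LagrangianRadon

theorem mainTheorem5 (n : ℕ) (hn : 1 < n) :
    ∃ (R : 𝓢(E n, ℂ) →ₗ[ℂ] SchwartzAL n) (A : SchwartzAL n →L[ℂ] SpaceB n)
      (ιB : 𝓢(E n, ℂ) → DualB n) (ιS : SchwartzAL n → DualSchwartzAL n)
      (T : DualB n →L[ℂ] DualSchwartzAL n),
      -- the Radon transform maps Schwartz functions to Schwartz functions
      (∀ (f : 𝓢(E n, ℂ)) (L : AL n), Integrable f (surfaceMeasure L) ∧ R f L = radon f L) ∧
      -- the back-projection is a continuous operator into the space of test functions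
      (∀ (φ : SchwartzAL n) (x : E n), Integrable φ (sigma x) ∧ A φ x = backProj φ x) ∧
      -- the back-projection and all its partial derivatives are `O(|x|^(-n))`
      (∀ (φ : SchwartzAL n) (k : ℕ) (i : Fin k → Fin n ⊕ Fin n),
        partialDeriv i (backProj φ) =O[Bornology.cobounded (E n)] fun x => (‖x‖ ^ n)⁻¹) ∧
      -- functions regarded as distributions
      (∀ (f : 𝓢(E n, ℂ)) (g : SpaceB n),
        Integrable (fun x => f x * g x) ∧ ιB f g = ∫ x, f x * g x) ∧
      (∀ F φ : SchwartzAL n, Integrable (fun L => F L * φ L) (measureAL n) ∧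
        ιS F φ = ∫ L, F L * φ L ∂(measureAL n)) ∧
      -- `T` is the unique continuous extension of `R`, and it is dual to the back-projection
      (∀ f : 𝓢(E n, ℂ), T (ιB f) = ιS (R f)) ∧
      (∀ T' : DualB n →L[ℂ] DualSchwartzAL n,
        (∀ f : 𝓢(E n, ℂ), T' (ιB f) = ιS (R f)) → T' = T) ∧
      ∀ (u : DualB n) (φ : SchwartzAL n), T u φ = u (A φ) := by
  have hn0 : n ≠ 0 := by omega
  exact ⟨radonLM n, backProjCLM hn0, toDualB, toDualSchwartzAL, radonExtension hn0,
    fun f L => ⟨integrable_surfaceMeasure f L, rfl⟩,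
    fun φ x => ⟨integrable_sigma φ x, rfl⟩,
    fun φ _ i => partialDeriv_backProj_isBigO hn0 φ i,
    fun f g => ⟨integrable_mul_spaceB f g, rfl⟩,
    fun F φ => ⟨integrable_mul_schwartzAL F φ, rfl⟩,
    radonExtension_toDualB hn0,
    fun _ hT => eq_radonExtension hn0 hT,
    fun _ _ => rfl⟩
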